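/- **Notation.** Let $e(z)=e^{2\pi i z}$, $\tau=x+iy\in\mathbb H$, $q^{r}=e(r\tau)$; powers of $c\tau+d$ are principal. With Zwegers put $$\vartheta(v;\tau)=\sum_{n\in\mathbb Z}e\big((n+\tfrac12)(v+\tfrac12)\big)q^{\frac12(n+\frac12)^2},\qquad \mu(u,v;\tau)=\frac{e^{\pi i u}}{\vartheta(v;\tau)}\sum_{n\in\mathbb Z}\frac{(-1)^ne^{2\pi i nv}q^{n(n+1)/2}}{1-e^{2\pi i u}q^n},$$ $$R(u;\tau)=\sum_{\nu\in\frac12+\mathbb Z}\Big(\mathrm{sgn}(\nu)-2\int_0^{(\nu+\mathrm{Im}(u)/y)\sqrt{2y}}e^{-\pi t^2}dt\Big)(-1)^{\nu-\frac12}e^{-\pi i\nu^2\tau-2\pi i\nu u},\qquad \widehat\mu(u,v;\tau)=\mu(u,v;\tau)+\tfrac i2R(u-v;\tau).$$ Let $T=\{1,2,3,4,5,6\}$ and $T'=T\cup\{4',4''\}$. A pair $(m,n)$ with $m\in T'$, $1\le n\le 8$ is *admissible* unless it is one of $(1,6),(2,5),(3,8),(5,4),(6,7)$; there are 59 admissible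 pairs. For $n=1,\dots,8$ let $v^{(mn)}_\tau$ be $\frac\tau2,\ \frac\tau2-\frac12,\ \frac\tau3,\ \frac\tau3-\frac12,\ \frac\tau4,\ \frac\tau4-\frac12,\ \frac\tau6,\ \frac\tau6-\frac12$, respectively. For $m=1,2,3,4',4'',5,6$, respectively, let $u^{(mn)}_\tau-v^{(mn)}_\tau$ be $-\frac\tau4+\frac12,\ -\frac\tau4,\ -\frac\tau6+\frac12,\ -\frac{5\tau}{12},\ -\frac\tau{12},\ -\frac\tau3+\frac12,\ -\frac\tau6$, let $w_m$ be $-1,i,-1,i,i,-1,i$, and let $t_m$ be $-\frac1{32},-\frac1{32},-\frac1{72},-\frac{25}{288},-\frac1{288},-\frac1{18},-\frac1{72}$. For $m\ne4$ set $$V_{mn}(\tau)=w_mq^{t_m}\mu(u^{(mn)}_\tau,v^{(mn)}_\tau;\tau),\qquad \widehat V_{mn}(\tau)=w_mq^{t_m}\widehat\mu(u^{(mn)}_\tau,v^{(mn)}_\tau;\tau),$$ and set $V_{4n}=V_{4'n}+V_{4''n}$, $\widehat V_{4n}=\widehat V_{4'n}+\widehat V_{4''n}$. Let $\Gamma^1(N)\subset\mathrm{SL}_2(\mathbb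 Z)$ consist of the $\left(\begin{smallmatrix}a&b\\c&d\end{smallmatrix}\right)$ with $a\equiv d\equiv1$, $b\equiv0\pmod N$. Put $A_{mn}=\Gamma^1(N_{mn})\cap\Gamma_0(2)$ if $m\in\{1,3,5\}$ or $n$ is even, and $A_{mn}=\Gamma^1(N_{mn})$ otherwise. Here $N_{1n}=4$ for $n\in\{1,2,5\}$ and $12$ otherwise; $N_{2n}=4$ for $n\in\{1,2,6\}$ and $12$ otherwise; $N_{3n}=N_{6n}=12$ for $n\in\{5,6\}$ and $6$ otherwise; $N_{53}=3$, $N_{55}=N_{56}=12$, and $N_{5n}=6$ otherwise; $N_{4n}=N_{4'n}=N_{4''n}=12$. Let $\psi(\gamma)$ be the multiplier of Dedekind's eta function: $\eta(\gamma\tau)=\psi(\gamma)(c\tau+d)^{1/2}\eta(\tau)$. For $\gamma=\left(\begin{smallmatrix}a&b\\c&d\end{smallmatrix}\right)$ let $\varepsilon^{(m)}_\gamma=e(abt_m)$ for $m\in\{2,4',4'',6\}$, $\varepsilon^{(1)}_\gamma=e\big(\frac{4-4a-ab+4c}{32}\big)$, $\varepsilon^{(3)}_\gamma=e\big(\frac{6-6a-ab+18c-9cd}{72}\big)$,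 $\varepsilon^{(5)}_\gamma=e\big(\frac{12-12a-4ab+18c-9cd}{72}\big)$. For $m\ne4$ and $\gamma\in A_{mn}$ the integers $k,\ell,r,s$ (depending on $m,n,\gamma$) are those with $$(c\tau+d)\,u^{(mn)}_{\gamma\tau}=u^{(mn)}_\tau+k\tau+\ell,\qquad (c\tau+d)\,v^{(mn)}_{\gamma\tau}=v^{(mn)}_\tau+r\tau+s\qquad(\tau\in\mathbb H).$$ Let $E_1(\tau)=\eta(8\tau)^3$, $E_2(\tau)=\frac{\eta(16\tau)^9}{\eta(8\tau)^3\eta(32\tau)^3}$, $E_3(\tau)=\frac{\eta(3\tau)^2\eta(12\tau)^2}{\eta(6\tau)}$, $E_4(\tau)=\frac{\eta(48\tau)^{13}}{\eta(24\tau)^5\eta(96\tau)^5}$, $E_5(\tau)=\frac{\eta(24\tau)^5}{\eta(48\tau)^2}$, $E_6(\tau)=\frac{\eta(6\tau)^5}{\eta(3\tau)^2}$, and $(c_1,\dots,c_6)=(8,8,6,24,12,6)$. A *harmonic Maass form* of weight $\kappa$ on $\Gamma$ with multiplier $\chi$ is a smooth $F:\mathbb H\to\mathbb C$ such that $F(\gamma\tau)=\chi(\gamma)(c\tau+d)^\kappa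 F(\tau)$ with $|\chi(\gamma)|=1$ for $\gamma\in\Gamma$; $\Delta_\kappa F=0$, where $\Delta_\kappa=-y^2\big(\frac{\partial^2}{\partial x^2}+\frac{\partial^2}{\partial y^2}\big)+i\kappa y\big(\frac{\partial}{\partial x}+i\frac{\partial}{\partial y}\big)$; and $F$ has at most linear exponential growth at all cusps, that is, for every $\gamma\in\mathrm{SL}_2(\mathbb Z)$ there is $C$ with $(c\tau+d)^{-\kappa}F(\gamma\tau)=O(e^{Cy})$ as $y\to\infty$. Its *holomorphic part* is the function $f$ with $$f(\tau)=\sum_{n\ge n_0}a_nq^{n/N},\qquad F(\tau)-f(\tau)=\sum_{n\ge1}b_n\,\Gamma\big(1-\kappa,\tfrac{4\pi ny}{N}\big)q^{-n/N}\qquad(\tau\in\mathbb H)$$ for some $N\ge1$, $n_0\in\mathbb Z$ and $a_n,b_n\in\mathbb C$ (the shape of the Fourier expansion when $\xi_\kappa F$ is cuspidal), where $\Gamma(s,x)=\int_x^\infty t^{s-1}e^{-t}dt$. Such an $f$ is a *mock modular form* of weight $\kappa$ on $\Gamma$, $F$ is its completion, and $\xi_\kappa F$, with $\xi_\kappa=2iy^\kappa\overline{\frac{\partial}{\partial\bar\tau}}$,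 is its *shadow*. **Theorem.** Let $(m,n)$ be admissible, $m\in T'$. Then $A_{mn}$ is a congruence subgroup, and $V_{mn}$ is a mock modular form of weight $1/2$ on $A_{mn}$. More precisely, $\widehat V_{mn}$ is a harmonic Maass form of weight $1/2$ on $A_{mn}$ with holomorphic part $V_{mn}$. If $m\neq4$, the integers $k,\ell,r,s$ above exist for every $\gamma\in A_{mn}$, and for all $\tau\in\mathbb H$ $$\widehat V_{mn}(\gamma\tau)=\psi(\gamma)^{-3}(-1)^{k+\ell+r+s}\,\varepsilon^{(m)}_\gamma\,(c\tau+d)^{1/2}\,\widehat V_{mn}(\tau).$$ For $m=4$ the same holds for $\widehat V_{4n}$, where the multiplier is the one of $(4',n)$, which equals the one of $(4'',n)$. Moreover, for every admissible $(m,n)$ with $m\in T$ there is a nonzero constant $C\in\mathbb C$ with $$\xi_{1/2}\widehat V_{mn}(\tau)=C\,E_m\!\Big(\frac{2\tau}{c_m^2}\Big)\qquad(\tau\in\mathbb H),$$ that is, the shadow of $V_{mn}$ is a constant multiple of $E_m(2\tau/c_m^2)$. -/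

import Mathlib

open scoped MatrixGroups ContDiff Real
open UpperHalfPlane hiding I
open Complex (I)

noncomputable section

namespace EtaTheta

/-- `e(z) = exp(2πiz)`; for `τ ∈ ℍ` and a real exponent `x`, `q ^ x` is `e(x τ)`. -/
def e (z : ℂ) : ℂ := Complex.exp (2 * π * I * z)

/-! ### Harmonic Maass forms and mock modular forms -/

/-- The automorphy factor `c τ + d` of `γ = (a, b; c, d)`. -/
def autFactor (γ : SL(2, ℤ)) (τ : ℍ) : ℂ := (γ 1 0 : ℂ) * (τ : ℂ) + (γ 1 1 : ℂ)

/-- `∂F/∂x`, where `τ = x + iy`. -/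
def partialX (F : ℍ → ℂ) (τ : ℍ) : ℂ := fderiv ℝ (F ∘ ofComplex) (τ : ℂ) 1

/-- `∂F/∂y`, where `τ = x + iy`. -/
def partialY (F : ℍ → ℂ) (τ : ℍ) : ℂ := fderiv ℝ (F ∘ ofComplex) (τ : ℂ) I

/-- The weight `k` hyperbolic Laplacian `-y² (∂²/∂x² + ∂²/∂y²) + i k y (∂/∂x + i ∂/∂y)`. -/
def weightLaplacian (k : ℝ) (F : ℍ → ℂ) (τ : ℍ) : ℂ :=
  -(τ.im : ℂ) ^ 2 * (partialX (partialX F) τ + partialY (partialY F) τ)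
    + I * (k : ℂ) * (τ.im : ℂ) * (partialX F τ + I * partialY F τ)

/-- The operator `ξ_k = 2 i y ^ k * conj (∂/∂(conj τ))`, with
`∂/∂(conj τ) = (∂/∂x + i ∂/∂y) / 2`. -/
def xiOperator (k : ℝ) (F : ℍ → ℂ) (τ : ℍ) : ℂ :=
  2 * I * ((τ.im ^ k : ℝ) : ℂ) *
    (starRingEnd ℂ) ((1 / 2 : ℂ) * (partialX F τ + I * partialY F τ))

/-- `F` is a harmonic Maass form of weight `k` on `Γ` with multiplier `ν`. Powers of `c τ + d` are
taken with the principal branch. The last field is linear exponential growth at all cusps: every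
translate of `F` under `SL₂(ℤ)` is `O(exp (C y))` as `y → ∞`, uniformly in `x`. -/
structure IsHarmonicMaassForm (k : ℝ) (Γ : Subgroup SL(2, ℤ)) (ν : SL(2, ℤ) → ℂ)
    (F : ℍ → ℂ) : Prop where
  smooth : ContDiffOn ℝ ∞ (F ∘ ofComplex) {z : ℂ | 0 < z.im}
  norm_multiplier : ∀ γ ∈ Γ, ‖ν γ‖ = 1
  transform : ∀ γ ∈ Γ, ∀ τ : ℍ, F (γ • τ) = ν γ * autFactor γ τ ^ (k : ℂ) * F τ
  harmonic : ∀ τ : ℍ, weightLaplacian k F τ = 0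
  growth : ∀ γ : SL(2, ℤ), ∃ C : ℝ,
    (fun τ : ℍ ↦ autFactor γ τ ^ (-(k : ℂ)) * F (γ • τ)) =O[atImInfty]
      (fun τ : ℍ ↦ Real.exp (C * τ.im))

/-- The upper incomplete Gamma function `Γ(s, x) = ∫_x^∞ t ^ (s - 1) exp (-t) dt`, for `x > 0`. -/
def upperGamma (s x : ℝ) : ℝ := ∫ t in Set.Ioi x, t ^ (s - 1) * Real.exp (-t)

/-- `f` is the holomorphic part of the weight `k` harmonic Maass form `F`: in the Fourier expansion
`F = f + F⁻` at infinity (in the variable `q ^ (1 / N)`), `f` is the part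
`∑_{m ≥ n₀} a_m q ^ (m / N)` and `F⁻` is the non-holomorphic part
`∑_{m > 0} b_m Γ(1 - k, 4 π m y / N) q ^ (- m / N)`. (This is the shape of the expansion for forms
whose image under `ξ_k` is cuspidal.) -/
def IsHolomorphicPart (k : ℝ) (F f : ℍ → ℂ) : Prop :=
  ∃ (N : ℕ) (n₀ : ℤ) (a b : ℕ → ℂ), 0 < N ∧ ∀ τ : ℍ,
    HasSum (fun n : ℕ ↦ a n * e (((n : ℂ) + (n₀ : ℂ)) * τ / N)) (f τ) ∧
    HasSum (fun n : ℕ ↦ b n * (upperGamma (1 - k) (4 * π * ((n : ℝ) + 1) * τ.im / N) : ℂ)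
      * e (-((n : ℂ) + 1) * τ / N)) (F τ - f τ)

/-- A mock modular form of weight `k` on `Γ` (with multiplier `ν`) is the holomorphic part of a
harmonic Maass form of weight `k` on `Γ` (with multiplier `ν`). -/
def IsMockModularForm (k : ℝ) (Γ : Subgroup SL(2, ℤ)) (ν : SL(2, ℤ) → ℂ) (f : ℍ → ℂ) : Prop :=
  ∃ F : ℍ → ℂ, IsHarmonicMaassForm k Γ ν F ∧ IsHolomorphicPart k F f

/-! ### The functions `ϑ`, `μ`, `R`, `μ̂` of Zwegers -/

/-- `ϑ(v; τ) = ∑_{n ∈ ℤ} exp(2πi (n + 1/2) (v + 1/2)) q ^ ((n + 1/2)² / 2)`. -/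
def vartheta (v : ℂ) (τ : ℍ) : ℂ :=
  ∑' n : ℤ, e (((n : ℂ) + 1 / 2) * (v + 1 / 2)) * e (((n : ℂ) + 1 / 2) ^ 2 / 2 * τ)

/-- `μ(u, v; τ) = exp(πi u) / ϑ(v; τ) *
∑_{n ∈ ℤ} (-1) ^ n exp(2πi n v) q ^ (n (n + 1) / 2) / (1 - exp(2πi u) q ^ n)`. -/
def mu (u v : ℂ) (τ : ℍ) : ℂ :=
  e (u / 2) / vartheta v τ *
    ∑' n : ℤ, (-1 : ℂ) ^ n * e (n * v) * e ((n : ℂ) * (n + 1) / 2 * τ) / (1 - e u * e (n * τ))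

/-- `R(u; τ)`, the sum over `ν = n + 1/2` with `n ∈ ℤ` of
`(sgn ν - 2 ∫_0^{(ν + a) √(2y)} exp(-π t²) dt) (-1) ^ n exp(-πi ν² τ - 2πi ν u)`, where
`y = Im τ` and `a = Im u / Im τ`. -/
def zwegersR (u : ℂ) (τ : ℍ) : ℂ :=
  ∑' n : ℤ,
    ((Real.sign ((n : ℝ) + 1 / 2)
        - 2 * ∫ t in (0 : ℝ)..(((n : ℝ) + 1 / 2 + u.im / τ.im) * √(2 * τ.im)),
            Real.exp (-π * t ^ 2) : ℝ) : ℂ)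
      * (-1 : ℂ) ^ n
      * Complex.exp (-π * I * ((n : ℂ) + 1 / 2) ^ 2 * τ - 2 * π * I * ((n : ℂ) + 1 / 2) * u)

/-- `μ̂(u, v; τ) = μ(u, v; τ) + (i / 2) R(u - v; τ)`. -/
def muHat (u v : ℂ) (τ : ℍ) : ℂ := mu u v τ + I / 2 * zwegersR (u - v) τ

/-! ### The odd eta-theta functions and the eta multiplier -/

/-- The index set `T = {1, 2, 3, 4, 5, 6}`. -/
inductive EtaIndex
  | one | two | three | four | five | six

open ModularForm (eta) in
/-- The odd eta-theta functions `E_m`, as eta-quotients. -/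
def oddEtaTheta : EtaIndex → ℂ → ℂ
  | .one, z => eta (8 * z) ^ 3
  | .two, z => eta (16 * z) ^ 9 / (eta (8 * z) ^ 3 * eta (32 * z) ^ 3)
  | .three, z => eta (3 * z) ^ 2 * eta (12 * z) ^ 2 / eta (6 * z)
  | .four, z => eta (48 * z) ^ 13 / (eta (24 * z) ^ 5 * eta (96 * z) ^ 5)
  | .five, z => eta (24 * z) ^ 5 / eta (48 * z) ^ 2
  | .six, z => eta (6 * z) ^ 5 / eta (3 * z) ^ 2

/-- The constants `c_m`. -/
def shadowLevel : EtaIndex → ℕ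
  | .one => 8
  | .two => 8
  | .three => 6
  | .four => 24
  | .five => 12
  | .six => 6

/-- The multiplier `ψ` of the Dedekind eta function, determined by
`η(γ τ) = ψ(γ) (c τ + d) ^ (1/2) η(τ)`; the quotient does not depend on `τ` and is evaluated at
`τ = i`. -/
def etaMultiplier (γ : SL(2, ℤ)) : ℂ :=
  ModularForm.eta ((γ • UpperHalfPlane.I : ℍ) : ℂ) /
    (autFactor γ UpperHalfPlane.I ^ (1 / 2 : ℂ) * ModularForm.eta ((UpperHalfPlane.I : ℍ) : ℂ))

/-! ### The functions `V_{mn}` -/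

/-- The index set `T' \ {4} = {1, 2, 3, 4', 4'', 5, 6}`. -/
inductive MuIndex
  | one | two | three | fourPrime | fourDoublePrime | five | six

/-- The index set `T' = {1, 2, 3, 4, 4', 4'', 5, 6}`. -/
inductive MockIndex
  | ofMu (j : MuIndex)
  | four

/-- The inclusion `T ⊆ T'`. -/
def EtaIndex.toMock : EtaIndex → MockIndex
  | .one => .ofMu .one
  | .two => .ofMu .two
  | .three => .ofMu .three
  | .four => .four
  | .five => .ofMu .five
  | .six => .ofMu .six

/-- The `μ`-type constituents of an index: `4` has the two constituents `4'` and `4''`, any other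
index is its own constituent. -/
def MockIndex.constituents : MockIndex → Set MuIndex
  | .ofMu j => {j}
  | .four => {.fourPrime, .fourDoublePrime}

/-- The admissible pairs: `1 ≤ n ≤ 8`, without `(1,6)`, `(2,5)`, `(3,8)`, `(5,4)`, `(6,7)`. -/
def Admissible (m : MockIndex) (n : ℕ) : Prop :=
  1 ≤ n ∧ n ≤ 8 ∧
    match m with
    | .ofMu .one => n ≠ 6
    | .ofMu .two => n ≠ 5
    | .ofMu .three => n ≠ 8
    | .ofMu .five => n ≠ 4
    | .ofMu .six => n ≠ 7
    | _ => True

/-- `vCoeff n = (α, β)` encodes `v_τ^{(mn)} = α τ + β`, which depends on `n` only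
(junk value unless `1 ≤ n ≤ 8`). -/
def vCoeff : ℕ → ℚ × ℚ
  | 1 => (1 / 2, 0)
  | 2 => (1 / 2, -1 / 2)
  | 3 => (1 / 3, 0)
  | 4 => (1 / 3, -1 / 2)
  | 5 => (1 / 4, 0)
  | 6 => (1 / 4, -1 / 2)
  | 7 => (1 / 6, 0)
  | 8 => (1 / 6, -1 / 2)
  | _ => (0, 0)

/-- `dCoeff m = (α, β)` encodes `u_τ^{(mn)} - v_τ^{(mn)} = α τ + β`, which depends on `m` only. -/
def dCoeff : MuIndex → ℚ × ℚ
  | .one => (-1 / 4, 1 / 2)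
  | .two => (-1 / 4, 0)
  | .three => (-1 / 6, 1 / 2)
  | .fourPrime => (-5 / 12, 0)
  | .fourDoublePrime => (-1 / 12, 0)
  | .five => (-1 / 3, 1 / 2)
  | .six => (-1 / 6, 0)

/-- The parameter `v_τ^{(mn)}`. -/
def vParam (n : ℕ) (τ : ℍ) : ℂ := ((vCoeff n).1 : ℂ) * τ + ((vCoeff n).2 : ℂ)

/-- The parameter `u_τ^{(mn)}`. -/
def uParam (j : MuIndex) (n : ℕ) (τ : ℍ) : ℂ :=
  vParam n τ + (((dCoeff j).1 : ℂ) * τ + ((dCoeff j).2 : ℂ))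

/-- The constants `w_m`. -/
def wConst : MuIndex → ℂ
  | .one => -1
  | .two => I
  | .three => -1
  | .fourPrime => I
  | .fourDoublePrime => I
  | .five => -1
  | .six => I

/-- The exponents `t_m`. -/
def tConst : MuIndex → ℚ
  | .one => -1 / 32
  | .two => -1 / 32
  | .three => -1 / 72
  | .fourPrime => -25 / 288
  | .fourDoublePrime => -1 / 288
  | .five => -1 / 18
  | .six => -1 / 72

/-- `w_m q ^ {t_m} μ(u_τ^{(mn)}, v_τ^{(mn)}; τ)` for `m ∈ T' \ {4}`. -/
def muV (j : MuIndex) (n : ℕ) (τ : ℍ) : ℂ :=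
  wConst j * e ((tConst j : ℂ) * τ) * mu (uParam j n τ) (vParam n τ) τ

/-- `w_m q ^ {t_m} μ̂(u_τ^{(mn)}, v_τ^{(mn)}; τ)` for `m ∈ T' \ {4}`. -/
def muVHat (j : MuIndex) (n : ℕ) (τ : ℍ) : ℂ :=
  wConst j * e ((tConst j : ℂ) * τ) * muHat (uParam j n τ) (vParam n τ) τ

/-- The functions `V_{mn}`, `m ∈ T'`; in particular `V_{4n} = V_{4'n} + V_{4''n}`. -/
def mockV : MockIndex → ℕ → ℍ → ℂ
  | .ofMu j, n => muV j n
  | .four, n => fun τ ↦ muV .fourPrime n τ + muV .fourDoublePrime n τ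

/-- The completions `V̂_{mn}`, `m ∈ T'`; in particular `V̂_{4n} = V̂_{4'n} + V̂_{4''n}`. -/
def mockVHat : MockIndex → ℕ → ℍ → ℂ
  | .ofMu j, n => muVHat j n
  | .four, n => fun τ ↦ muVHat .fourPrime n τ + muVHat .fourDoublePrime n τ

/-! ### The groups `A_{mn}` and the multiplier -/

/-- `Γ¹(N)`: the matrices `(a, b; c, d)` in `SL₂(ℤ)` with `a ≡ d ≡ 1` and `b ≡ 0` modulo `N`. -/
def GammaUpperOne (N : ℕ) : Subgroup SL(2, ℤ) where
  carrier := {γ | (γ 0 0 : ZMod N) = 1 ∧ (γ 1 1 : ZMod N) = 1 ∧ (γ 0 1 : ZMod N) = 0}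
  one_mem' := by simp
  mul_mem' {x} {y} hx hy := by
    obtain ⟨h1, h2, h3⟩ := hx
    obtain ⟨k1, k2, k3⟩ := hy
    have h := Matrix.two_mul_expl x.1 y.1
    simp only [Set.mem_ofPred_eq, Matrix.SpecialLinearGroup.coe_mul] at *
    rw [h.1, h.2.1, h.2.2.2]
    push_cast
    simp [h1, h2, h3, k1, k2, k3]
  inv_mem' {x} hx := by
    simp only [Set.mem_ofPred_eq] at hx ⊢
    simpa [Matrix.SpecialLinearGroup.SL2_inv_expl x, and_left_comm] using hx

/-- The level `N` of the factor `Γ¹(N)` of `A_{mn}` (for admissible `(m, n)`). -/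
def groupLevel : MockIndex → ℕ → ℕ
  | .ofMu .one, n => if n = 1 ∨ n = 2 ∨ n = 5 then 4 else 12
  | .ofMu .two, n => if n = 1 ∨ n = 2 ∨ n = 6 then 4 else 12
  | .ofMu .three, n => if n = 5 ∨ n = 6 then 12 else 6
  | .ofMu .five, n => if n = 3 then 3 else if n = 5 ∨ n = 6 then 12 else 6
  | .ofMu .six, n => if n = 5 ∨ n = 6 then 12 else 6
  | _, _ => 12

/-- Whether `A_{mn}` is `Γ¹(N) ∩ Γ₀(2)` rather than `Γ¹(N)`: this is so for `m = 1, 3, 5` and all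
`n`, and for `m = 2, 4, 4', 4'', 6` and even `n`. -/
def NeedsGammaZeroTwo : MockIndex → ℕ → Prop
  | .ofMu .one, _ => True
  | .ofMu .three, _ => True
  | .ofMu .five, _ => True
  | _, n => Even n

open Classical in
/-- The groups `A_{mn}`. -/
def groupA (m : MockIndex) (n : ℕ) : Subgroup SL(2, ℤ) :=
  if NeedsGammaZeroTwo m n then GammaUpperOne (groupLevel m n) ⊓ CongruenceSubgroup.Gamma0 2
  else GammaUpperOne (groupLevel m n)

/-- The roots of unity `ε_γ^{(m)}`, for `γ = (a, b; c, d)`. -/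
def epsilonFactor (j : MuIndex) (γ : SL(2, ℤ)) : ℂ :=
  let a : ℂ := (γ 0 0 : ℂ)
  let b : ℂ := (γ 0 1 : ℂ)
  let c : ℂ := (γ 1 0 : ℂ)
  let d : ℂ := (γ 1 1 : ℂ)
  match j with
  | .one => e ((4 - 4 * a - a * b + 4 * c) / 32)
  | .three => e ((6 - 6 * a - a * b + 18 * c - 9 * c * d) / 72)
  | .five => e ((12 - 12 * a - 4 * a * b + 18 * c - 9 * c * d) / 72)
  | j => e (a * b * (tConst j : ℂ))

/-- The integers `k, l, r, s` attached to `γ` and the pair `(j, n)`: they are determined by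
`(c τ + d) u_{γτ} = u_τ + k τ + l` and `(c τ + d) v_{γτ} = v_τ + r τ + s`. -/
def IsShift (j : MuIndex) (n : ℕ) (γ : SL(2, ℤ)) (k l r s : ℤ) : Prop :=
  ∀ τ : ℍ, uParam j n (γ • τ) * autFactor γ τ = uParam j n τ + k * τ + l ∧
    vParam n (γ • τ) * autFactor γ τ = vParam n τ + r * τ + s

/-- The multiplier `ψ(γ)⁻³ (-1) ^ (k + l + r + s) ε_γ`. -/
def multiplierValue (j : MuIndex) (γ : SL(2, ℤ)) (k l r s : ℤ) : ℂ :=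
  etaMultiplier γ ^ (-3 : ℤ) * (-1 : ℂ) ^ (k + l + r + s) * epsilonFactor j γ

end EtaTheta

end

open EtaTheta

/-! ### Exponentials and Jacobi's theta function. -/

namespace EtaTheta

open Filter Topology

/-! ### The exponential `e` -/

/-! Write $u-v=\alpha\tau+\beta$. In every row of the table $t_m=-\alpha^2/2$, so each $\widehat
V_{mn}$ with $m\neq4$ is a constant times `torsionMuHat`, the normalised value of Zwegers'
$\widehat\mu$ at a pair of torsion points. The completion $\widehat\mu$ behaves like a two-variable
Jacobi form of weight $1/2$ with multiplier $\psi^{-3}$. An element of $A_{mn}$ moves the real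
coordinates of $u$ and $v$ by integers, so the elliptic law returns the same function, up to a root
of unity.

Modularity of $\widehat\mu$. Translation by $1$ is elementary. For inversion, multiply by
$\vartheta(v)$ to clear the denominator. The resulting numerator is quasi-periodic in $v$ with
elementary factors, because the theta defect of the Appell sum cancels that of $R$
(`NonLattice.muNumerator_add_tau`). It is not holomorphic, but $\partial R/\partial\bar u$ is an
elementary multiple of $\overline{\vartheta}$, so the modular law of $\vartheta$ makes the inversion
defect of $R$ holomorphic (`differentiable_zwegersR_S`). The difference of the two sides of the
inversion law is therefore entire and quasi-periodic, and Liouville's theorem kills it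
(`NonLattice.muNumerator_S`). Division by $\vartheta$ is legitimate by the triple product
(`vartheta_ne_zero`). The law spreads from the generators to all of $\mathrm{SL}_2(\mathbb Z)$ in
`muHatTransforms`.

Harmonicity and holomorphic part. In every row $|\alpha|<1/2$, so
$\mathrm{sgn}(\nu)=\mathrm{sgn}(\nu+\alpha)$ for half-integral $\nu$. Hence the normalised $R$ is a
purely non-holomorphic theta series: its terms are incomplete Gamma functions
(`nonHolExpansion_torsionR`), and its $\bar\tau$-derivative is $y^{-1/2}$ times an antiholomorphic
theta series (`harmonicHalf_torsionR`). What remains is the normalised $\mu$, which is holomorphic,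
of exponential growth and periodic modulo $288$. A translate of $\widehat V$ to another cusp is the
same construction at other torsion points (`torsionMuHat_smul`), so `expGrowth_torsionMuHat`
controls all cusps at once.

Shadow. Applying $\xi$ leaves a weight $3/2$ unary theta series `thetaSum` with characteristic
$1/2+\alpha\in\{1/4,1/3,1/6,1/12,5/12\}$. It is an eta quotient by rigidity: a suitable theta-by-eta
quotient has weight $0$, is bounded at $i\infty$, and is either of level one (`thetaSum_quarter_eq`)
or one of three functions permuted by $\mathrm{SL}_2(\mathbb Z)$ (`weber_quotients_const`), hence
constant. The remaining shadows follow from the value of $\eta$ at $z+1/2$. For $m=4$ the two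
constituents supply the two parity classes of the theta series for $m=5$. -/

lemma e_add (z w : ℂ) : e (z + w) = e z * e w := by
  simp only [e, ← Complex.exp_add]; ring_nf

lemma e_neg (z : ℂ) : e (-z) = (e z)⁻¹ := by
  simp only [e, ← Complex.exp_neg]; ring_nf

lemma e_sub (z w : ℂ) : e (z - w) = e z / e w := by
  rw [sub_eq_add_neg, e_add, e_neg, div_eq_mul_inv]

@[simp] lemma e_zero : e 0 = 1 := by simp [e]

@[simp] lemma e_ne_zero (z : ℂ) : e z ≠ 0 := Complex.exp_ne_zero _

lemma e_int (n : ℤ) : e n = 1 := by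
  rw [e, show (2 * π * I * n : ℂ) = n * (2 * π * I) by ring]
  exact Complex.exp_int_mul_two_pi_mul_I n

lemma e_add_int (z : ℂ) (n : ℤ) : e (z + n) = e z := by rw [e_add, e_int, mul_one]

lemma e_half : e (1 / 2) = -1 := by
  rw [e, show (2 * π * I * (1 / 2) : ℂ) = π * I by ring, Complex.exp_pi_mul_I]

lemma e_quarter : e (1 / 4) = I := by
  rw [e, show (2 * π * I * (1 / 4) : ℂ) = π / 2 * I by ring, Complex.exp_pi_div_two_mul_I]

lemma e_int_mul (n : ℤ) (z : ℂ) : e (n * z) = e z ^ n := by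
  rw [e, e, ← Complex.exp_int_mul]; ring_nf

lemma e_nat_mul (n : ℕ) (z : ℂ) : e (n * z) = e z ^ n := by
  rw [e, e, ← Complex.exp_nat_mul]; ring_nf

lemma e_int_div_two (n : ℤ) : e (n / 2) = (-1 : ℂ) ^ n := by
  rw [← e_half, ← e_int_mul]; ring_nf

lemma e_eq_one_iff (z : ℂ) : e z = 1 ↔ ∃ n : ℤ, z = n := by
  rw [e, Complex.exp_eq_one_iff]
  refine exists_congr fun n ↦ ?_
  rw [mul_comm (n : ℂ)]
  exact mul_right_inj' Complex.two_pi_I_ne_zero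

lemma norm_e (z : ℂ) : ‖e z‖ = Real.exp (-(2 * π * z.im)) := by
  rw [e, Complex.norm_exp]
  simp

lemma norm_e_ofReal (x : ℝ) : ‖e x‖ = 1 := by simp [norm_e]

lemma conj_e (z : ℂ) : (starRingEnd ℂ) (e z) = e (-(starRingEnd ℂ) z) := by
  rw [e, e, ← Complex.exp_conj]; simp [Complex.conj_ofNat]

@[fun_prop] lemma differentiable_e : Differentiable ℂ e := by
  unfold e; fun_prop

lemma hasDerivAt_e (z : ℂ) : HasDerivAt e (2 * π * I * e z) z := by
  have := ((hasDerivAt_id z).const_mul (2 * π * I)).cexp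
  convert! this using 1
  simp [e, mul_comm]

lemma e_mul_int_of_exp {z w : ℂ} (n : ℤ) (h : z = w + n) : e z = e w := by
  rw [h, e_add_int]

/-! ### The Jacobi theta function `ϑ` -/

/-- Expanding $(n+1/2)^2$ moves the half-integral shift into the elliptic variable. Through this
identity $\vartheta$ inherits quasi-periodicity, inversion and holomorphy from `jacobiTheta₂`. -/
lemma vartheta_eq (v : ℂ) (τ : ℍ) :
    vartheta v τ = e ((v + 1 / 2) / 2 + τ / 8) * jacobiTheta₂ (v + 1 / 2 + τ / 2) τ := by
  rw [vartheta, jacobiTheta₂, ← tsum_mul_left]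
  refine tsum_congr fun n ↦ ?_
  simp only [jacobiTheta₂_term, e, ← Complex.exp_add]
  ring_nf

lemma vartheta_add_one (v : ℂ) (τ : ℍ) : vartheta (v + 1) τ = -vartheta v τ := by
  rw [vartheta_eq, vartheta_eq, show v + 1 + 1 / 2 + (τ : ℂ) / 2 = v + 1 / 2 + τ / 2 + 1 by ring,
    jacobiTheta₂_add_left, show (v + 1 + 1 / 2) / 2 + (τ : ℂ) / 8 = 1 / 2 + ((v + 1 / 2) / 2 + τ / 8)
    by ring, e_add, e_half]
  ring

lemma vartheta_add_tau (v : ℂ) (τ : ℍ) :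
    vartheta (v + τ) τ = -e (-τ / 2 - v) * vartheta v τ := by
  have h : Complex.exp (-π * I * (τ + 2 * (v + 1 / 2 + (τ : ℂ) / 2))) = e (-τ - v - 1 / 2) := by
    rw [e]; congr 1; ring
  rw [vartheta_eq, vartheta_eq, show v + τ + 1 / 2 + (τ : ℂ) / 2 = v + 1 / 2 + τ / 2 + τ by ring,
    jacobiTheta₂_add_left', h, ← mul_assoc, ← e_add, ← neg_one_mul (e _), ← mul_assoc, ← e_half,
    ← e_add, ← e_add]
  congr 1
  exact e_mul_int_of_exp (-1) (by push_cast; ring)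

lemma vartheta_T (v : ℂ) (τ τ' : ℍ) (h : (τ' : ℂ) = τ + 1) :
    vartheta v τ' = e (1 / 8) * vartheta v τ := by
  rw [vartheta, vartheta, ← tsum_mul_left]
  refine tsum_congr fun n ↦ ?_
  -- Since $n(n+1)$ is even, $(n+1/2)^2/2\equiv1/8$ modulo $1$, the same for all $n$.
  obtain ⟨m, hm⟩ := Int.even_mul_succ_self n
  rw [h, ← e_add, ← e_add, ← e_add]
  have hm' : (n * (n + 1) : ℂ) = m + m := by exact_mod_cast hm
  refine e_mul_int_of_exp m ?_
  linear_combination hm' / 2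

lemma mul_neg_I_sqrt_ne_zero (τ : ℍ) : ((-I * τ : ℂ)) ^ (1 / 2 : ℂ) ≠ 0 := by
  rw [Complex.cpow_ne_zero_iff]
  left
  simp [τ.ne_zero]

/-- The behaviour of `ϑ` under `τ ↦ -1/τ`. -/
lemma vartheta_S (v : ℂ) (τ τ' : ℍ) (h : (τ' : ℂ) = -1 / τ) :
    vartheta (v / τ) τ' = -I * (-I * τ) ^ (1 / 2 : ℂ) * e (v ^ 2 / (2 * τ)) * vartheta v τ := by
  have hτ : (τ : ℂ) ≠ 0 := τ.ne_zero
  have key := jacobiTheta₂_functional_equation (v + 1 / 2 + (τ : ℂ) / 2) τ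
  -- The shift $1/2+\tau/2$ divided by $\tau$ differs from $1/2+\tau'/2$ by exactly one period
  -- $\tau'$, which costs one quasi-periodicity factor.
  have h1 : (v + 1 / 2 + (τ : ℂ) / 2) / τ + τ' = v / τ + 1 / 2 + (τ' : ℂ) / 2 := by
    rw [h]; field_simp; ring
  have h2 : jacobiTheta₂ ((v + 1 / 2 + (τ : ℂ) / 2) / τ) τ' =
      e (v / τ + 1 / 2) * jacobiTheta₂ (v / τ + 1 / 2 + (τ' : ℂ) / 2) τ' := by
    have := jacobiTheta₂_add_left' ((v + 1 / 2 + (τ : ℂ) / 2) / τ) τ'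
    rw [h1] at this
    rw [this, e, ← mul_assoc, ← Complex.exp_add, eq_comm]
    convert one_mul _
    rw [Complex.exp_eq_one_iff]
    refine ⟨0, ?_⟩
    rw [h]
    field_simp
    ring
  rw [← h, h2] at key
  rw [vartheta_eq, vartheta_eq, key]
  have h3 := mul_neg_I_sqrt_ne_zero τ
  have h4 : Complex.exp (-π * I * (v + 1 / 2 + (τ : ℂ) / 2) ^ 2 / τ) =
      e (-(v + 1 / 2 + (τ : ℂ) / 2) ^ 2 / (2 * τ)) := by
    rw [e]; congr 1; field_simp
  have h5 : -I = e (-(1 / 4)) := by rw [e_neg, e_quarter, Complex.inv_I]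
  rw [h4]
  set J := jacobiTheta₂ (v / τ + 1 / 2 + (τ' : ℂ) / 2) τ'
  have h6 : e ((v / τ + 1 / 2) / 2 + τ' / 8) = -I * e (v ^ 2 / (2 * τ)) *
      e ((v + 1 / 2) / 2 + τ / 8) * e (-(v + 1 / 2 + (τ : ℂ) / 2) ^ 2 / (2 * τ)) *
      e (v / τ + 1 / 2) := by
    rw [h5]
    simp only [← e_add]
    congr 1
    rw [h]
    field_simp
    ring
  rw [h6]
  generalize (-I * (τ : ℂ)) ^ (1 / 2 : ℂ) = c at h3 ⊢
  field_simp

lemma differentiable_vartheta (τ : ℍ) : Differentiable ℂ (vartheta · τ) := by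
  intro v
  simp only [vartheta_eq]
  have h := (differentiableAt_jacobiTheta₂_fst (v + 1 / 2 + (τ : ℂ) / 2) τ.im_pos).comp
    (f := fun v : ℂ ↦ v + 1 / 2 + (τ : ℂ) / 2) v (by fun_prop)
  exact DifferentiableAt.mul (by fun_prop) h

lemma summable_vartheta (v : ℂ) (τ : ℍ) : Summable fun n : ℤ ↦
    e (((n : ℂ) + 1 / 2) * (v + 1 / 2)) * e (((n : ℂ) + 1 / 2) ^ 2 / 2 * τ) := by
  have := ((summable_jacobiTheta₂_term_iff (v + 1 / 2 + (τ : ℂ) / 2) τ).mpr τ.im_pos).mul_left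
    (e ((v + 1 / 2) / 2 + τ / 8))
  refine this.congr fun n ↦ ?_
  simp only [jacobiTheta₂_term, e, ← Complex.exp_add]
  ring_nf

/-- Up to an elementary factor, `ϑ` is the series `∑ (-1) ^ n e(n v) q ^ (n (n + 1) / 2)`. -/
lemma hasSum_vartheta (v : ℂ) (τ : ℍ) :
    HasSum (fun n : ℤ ↦ (-1 : ℂ) ^ n * e (n * v) * e ((n : ℂ) * (n + 1) / 2 * τ))
      (-I * e (-v / 2 - τ / 8) * vartheta v τ) := by
  have := (summable_vartheta v τ).hasSum.mul_left (-I * e (-v / 2 - τ / 8))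
  convert! this using 2 with n
  rw [← e_int_div_two, show -I = e (-(1 / 4)) by rw [e_neg, e_quarter, Complex.inv_I]]
  simp only [← e_add]
  congr 1
  ring

end EtaTheta

/-! ### Product formula for $\vartheta$ and its nonvanishing off the lattice. -/

namespace EtaTheta

open Filter Topology

/-! ### The Jacobi triple product and the zeros of `ϑ` -/

/-- The finite product `(1 - q) ⋯ (1 - q ^ k)`. -/
def qPoch (q : ℂ) (k : ℕ) : ℂ := ∏ i ∈ Finset.range k, (1 - q ^ (i + 1))

lemma qPoch_succ (q : ℂ) (k : ℕ) : qPoch q (k + 1) = qPoch q k * (1 - q ^ (k + 1)) :=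
  Finset.prod_range_succ _ _

lemma one_sub_pow_succ_ne_zero {q : ℂ} (hq : ‖q‖ < 1) (k : ℕ) : 1 - q ^ (k + 1) ≠ 0 := by
  intro h
  have h1 : ‖q ^ (k + 1)‖ < 1 := by
    rw [norm_pow]; exact pow_lt_one₀ (norm_nonneg _) hq (by omega)
  rw [← sub_eq_zero.mp h, norm_one] at h1
  exact lt_irrefl _ h1

lemma qPoch_ne_zero {q : ℂ} (hq : ‖q‖ < 1) (k : ℕ) : qPoch q k ≠ 0 :=
  Finset.prod_ne_zero_iff.mpr fun i _ ↦ one_sub_pow_succ_ne_zero hq i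

/-- Pascal's rule for Gaussian binomials with upper index $k+r+1$. Using $r$ as a variable avoids
truncated subtraction. -/
lemma qBinomial_succ {q : ℂ} (hq : ‖q‖ < 1) (k r : ℕ) :
    qPoch q (k + r + 2) / (qPoch q (k + 1) * qPoch q (r + 1)) =
      qPoch q (k + r + 1) / (qPoch q (k + 1) * qPoch q r) +
        q ^ (r + 1) * (qPoch q (k + r + 1) / (qPoch q k * qPoch q (r + 1))) := by
  have h1 := qPoch_ne_zero hq k
  have h2 := qPoch_ne_zero hq r
  have h3 := one_sub_pow_succ_ne_zero hq k
  have h4 := one_sub_pow_succ_ne_zero hq r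
  rw [qPoch_succ q (k + r + 1), qPoch_succ q k, qPoch_succ q r]
  field_simp
  ring

/-- The finite `q`-binomial theorem. -/
lemma prod_one_add_mul_pow {q : ℂ} (hq : ‖q‖ < 1) (x : ℂ) (M : ℕ) :
    ∏ j ∈ Finset.range M, (1 + x * q ^ j) = ∑ k ∈ Finset.range (M + 1),
      q ^ (k.choose 2) * x ^ k * (qPoch q M / (qPoch q k * qPoch q (M - k))) := by
  induction M with
  | zero => simp [qPoch]
  | succ M ih =>
    rw [Finset.prod_range_succ, ih, mul_add, mul_one]
    conv_lhs =>
      congr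
      · rw [Finset.sum_range_succ']
      · rw [Finset.sum_range_succ, add_mul, Finset.sum_mul]
    rw [Finset.sum_range_succ' _ (M + 1), Finset.sum_range_succ]
    have h0 := qPoch_ne_zero hq M
    have h1 := qPoch_ne_zero hq (M + 1)
    have key : ∀ k ∈ Finset.range M,
        q ^ ((k + 1).choose 2) * x ^ (k + 1) *
          (qPoch q (M + 1) / (qPoch q (k + 1) * qPoch q (M + 1 - (k + 1)))) =
        q ^ ((k + 1).choose 2) * x ^ (k + 1) *
          (qPoch q M / (qPoch q (k + 1) * qPoch q (M - (k + 1)))) +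
        q ^ (k.choose 2) * x ^ k * (qPoch q M / (qPoch q k * qPoch q (M - k))) * (x * q ^ M) := by
      intro k hk
      obtain ⟨r, rfl⟩ := Nat.exists_eq_add_of_lt (Finset.mem_range.mp hk)
      have e1 : k + r + 1 + 1 - (k + 1) = r + 1 := by omega
      have e2 : k + r + 1 - (k + 1) = r := by omega
      have e3 : k + r + 1 - k = r + 1 := by omega
      rw [e1, e2, e3, qBinomial_succ hq k r, Nat.choose_succ_succ' k 1, Nat.choose_one_right]
      ring
    rw [Finset.sum_congr rfl key, Finset.sum_add_distrib]
    have e4 : M.choose 2 + M = (M + 1).choose 2 := by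
      rw [Nat.choose_succ_succ' M 1, Nat.choose_one_right, add_comm]
    simp only [Nat.sub_self, ← e4, Nat.sub_zero]
    have h2 : qPoch q 0 = 1 := by simp [qPoch]
    simp only [h2, pow_zero, mul_one, one_mul, Nat.choose_zero_succ, div_self h0, div_self h1]
    ring

variable {s : ℂ} {τ : ℍ}

lemma tprod_one_sub_ne_zero (τ : ℍ) : ∏' i : ℕ, (1 - e τ ^ (i + 1)) ≠ 0 := by
  simpa only [ModularForm.eta_q_eq_pow, e] using ModularForm.eta_tprod_ne_zero (z := τ) τ.im_pos

lemma norm_e_coe_lt_one (τ : ℍ) : ‖e τ‖ < 1 := by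
  rw [norm_e, Real.exp_lt_one_iff]
  have := τ.im_pos
  simp only [coe_im, Left.neg_neg_iff]
  positivity

/-- The finite form of the Jacobi triple product. -/
lemma finite_triple_product (s : ℂ) (τ : ℍ) (N : ℕ) :
    (∏ i ∈ Finset.range N, (1 + e s * e τ ^ i)) *
      (∏ i ∈ Finset.range N, (1 + (e s)⁻¹ * e τ ^ (i + 1))) =
    ∑ k ∈ Finset.range (2 * N + 1), e (((k : ℂ) - N) * s + ((k : ℂ) - N) * (k - N - 1) / 2 * τ) *
      (qPoch (e τ) (2 * N) / (qPoch (e τ) k * qPoch (e τ) (2 * N - k))) := by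
  -- With $x=e(s)q^{-N}$ and $2N$ factors, the upper half of the product is $\prod(1+e(s)q^i)$. The
  -- lower half, reversed and stripped of the monomials $e(s)q^{-(i+1)}$, is
  -- $\prod(1+e(s)^{-1}q^{i+1})$.
  have h := prod_one_add_mul_pow (norm_e_coe_lt_one τ) (e (s - N * τ)) (2 * N)
  rw [two_mul, Finset.prod_range_add, ← two_mul, ← Finset.prod_range_reflect] at h
  have h1 : ∀ i ∈ Finset.range N, 1 + e (s - N * τ) * e τ ^ (N - 1 - i) =
      (e (s - τ) * (e τ)⁻¹ ^ i) * (1 + (e s)⁻¹ * e τ ^ (i + 1)) := by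
    intro i hi
    obtain ⟨r, rfl⟩ := Nat.exists_eq_add_of_lt (Finset.mem_range.mp hi)
    rw [show i + r + 1 - 1 - i = r by omega]
    push_cast
    rw [mul_add, mul_one, add_comm]
    congr 1
    · rw [← e_nat_mul, ← e_neg, ← e_nat_mul, ← e_add, ← e_add]; congr 1; ring
    · rw [← e_neg, ← e_neg, ← e_nat_mul, ← e_nat_mul, ← e_add, ← e_add, ← e_add, ← e_zero]
      congr 1; push_cast; ring
  have h2 : ∀ i ∈ Finset.range N, 1 + e (s - N * τ) * e τ ^ (N + i) = 1 + e s * e τ ^ i := by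
    intro i _
    rw [← e_nat_mul, ← e_nat_mul, ← e_add, ← e_add]; congr 2; push_cast; ring
  rw [Finset.prod_congr rfl h1, Finset.prod_congr rfl h2, Finset.prod_mul_distrib,
    Finset.prod_mul_distrib, Finset.prod_const, Finset.prod_pow_eq_pow_sum, Finset.card_range,
    Finset.sum_range_id, ← Nat.choose_two_right] at h
  have h3 : (e (s - τ) ^ N * (e τ)⁻¹ ^ (N.choose 2))⁻¹ = e (-(N * s) + N * (N + 1) / 2 * τ) := by
    rw [← e_nat_mul, ← e_neg, ← e_nat_mul, ← e_add, ← e_neg, Nat.cast_choose_two]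
    congr 1; ring
  have h4 : e (s - τ) ^ N * (e τ)⁻¹ ^ (N.choose 2) ≠ 0 := by simp
  rw [mul_comm (Finset.prod _ _) (Finset.prod _ _), ← mul_right_inj' h4, ← mul_assoc, h,
    ← mul_right_inj' (inv_ne_zero h4), ← mul_assoc _ _ (Finset.sum _ _), inv_mul_cancel₀ h4,
    one_mul, h3, Finset.mul_sum]
  refine Finset.sum_congr rfl fun k _ ↦ ?_
  rw [← e_nat_mul, ← e_nat_mul, ← e_add, ← mul_assoc, ← e_add, Nat.cast_choose_two]
  congr 2
  ring

lemma tendsto_qPoch {q : ℂ} (hq : ‖q‖ < 1) :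
    Tendsto (qPoch q) atTop (𝓝 (∏' i : ℕ, (1 - q ^ (i + 1)))) :=
  (ModularForm.multipliable_one_sub_pow hq).hasProd.tendsto_prod_nat

lemma summable_norm_e_quadratic (s : ℂ) (τ : ℍ) :
    Summable fun n : ℤ ↦ ‖e (n * s + (n : ℂ) * (n - 1) / 2 * τ)‖ := by
  have := ((summable_jacobiTheta₂_term_iff (s - (τ : ℂ) / 2) τ).mpr τ.im_pos).norm
  refine this.congr fun n ↦ ?_
  simp only [jacobiTheta₂_term, e]
  ring_nf

lemma multipliable_one_add_mul_pow (x : ℂ) {q : ℂ} (hq : ‖q‖ < 1) :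
    Multipliable fun i : ℕ ↦ 1 + x * q ^ i :=
  multipliable_one_add_of_summable
    (by simpa using (summable_geometric_of_lt_one (norm_nonneg _) hq).mul_left ‖x‖)

/-- A sequence with a nonzero limit and its inverses are bounded. This bounds all Gaussian binomials
at once and dominates the limit in the triple product. -/
lemma exists_norm_qPoch_bounds {q : ℂ} (hq : ‖q‖ < 1) (hP : ∏' i : ℕ, (1 - q ^ (i + 1)) ≠ 0) :
    ∃ C : ℝ, ∀ k, ‖qPoch q k‖ ≤ C ∧ ‖(qPoch q k)⁻¹‖ ≤ C := by
  obtain ⟨C, hC⟩ := (tendsto_qPoch hq).norm.bddAbove_range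
  obtain ⟨D, hD⟩ := ((tendsto_qPoch hq).inv₀ hP).norm.bddAbove_range
  refine ⟨max C D, fun k ↦ ⟨?_, ?_⟩⟩
  · exact (hC ⟨k, rfl⟩).trans (le_max_left _ _)
  · exact (hD ⟨k, rfl⟩).trans (le_max_right _ _)

/-- The Jacobi triple product. -/
theorem jacobi_triple_product (s : ℂ) (τ : ℍ) :
    ∑' n : ℤ, e (n * s + (n : ℂ) * (n - 1) / 2 * τ) =
      (∏' i : ℕ, (1 - e τ ^ (i + 1))) *
      ((∏' i : ℕ, (1 + e s * e τ ^ i)) * ∏' i : ℕ, (1 + (e s)⁻¹ * e τ ^ (i + 1))) := by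
  have hq := norm_e_coe_lt_one τ
  set P := ∏' i : ℕ, (1 - e τ ^ (i + 1)) with hPdef
  have hP : P ≠ 0 := tprod_one_sub_ne_zero τ
  obtain ⟨C, hC⟩ := exists_norm_qPoch_bounds hq hP
  have hC0 : 0 ≤ C := (norm_nonneg _).trans (hC 0).1
  -- The finite identity is recentred by $k=N+n$ and extended by zero, so that all $N$ share the
  -- index set $\mathbb Z$.
  let F : ℕ → ℤ → ℂ := fun N n ↦ if n.natAbs ≤ N then
    e (n * s + (n : ℂ) * (n - 1) / 2 * τ) *
      (qPoch (e τ) (2 * N) / (qPoch (e τ) (N + n).toNat * qPoch (e τ) (N - n).toNat)) else 0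
  have hF : ∀ N, ∑' n, F N n = (∏ i ∈ Finset.range N, (1 + e s * e τ ^ i)) *
      (∏ i ∈ Finset.range N, (1 + (e s)⁻¹ * e τ ^ (i + 1))) := by
    intro N
    rw [finite_triple_product, tsum_eq_sum (s := Finset.Icc (-N : ℤ) N)]
    · refine Finset.sum_nbij' (fun n ↦ (N + n).toNat) (fun k ↦ (k : ℤ) - N) ?_ ?_ ?_ ?_ ?_
      · intro n hn; simp at hn ⊢; omega
      · intro k hk; simp at hk ⊢; omega
      · intro n hn; simp at hn ⊢; omega
      · intro k hk; simp at hk ⊢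
      · intro n hn
        simp only [Finset.mem_Icc] at hn
        have h1 : n.natAbs ≤ N := by omega
        have h2 : 2 * N - (N + n).toNat = (N - n).toNat := by omega
        have h3 : (((N + n).toNat : ℕ) : ℂ) = N + n := by
          have : (((N + n).toNat : ℕ) : ℤ) = N + n := Int.toNat_of_nonneg (by omega)
          exact_mod_cast this
        simp only [F, h1, if_true, h2, h3]
        congr 2
        ring
    · intro n hn
      simp only [Finset.mem_Icc] at hn
      simp only [F]
      rw [if_neg (by omega)]
  have hlim1 : Tendsto (fun N ↦ ∑' n, F N n) atTop
      -- For fixed $n$, all three finite products tend to $P$, so the central binomials tend to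
      -- $P/P^2$.
      (𝓝 (∑' n : ℤ, e (n * s + (n : ℂ) * (n - 1) / 2 * τ) * (P / (P * P)))) := by
    refine tendsto_tsum_of_dominated_convergence
      (bound := fun n ↦ ‖e (n * s + (n : ℂ) * (n - 1) / 2 * τ)‖ * (C * (C * C)))
      ((summable_norm_e_quadratic s τ).mul_right _) ?_ (Eventually.of_forall fun N n ↦ ?_)
    · intro n
      have h1 : Tendsto (fun N : ℕ ↦ 2 * N) atTop atTop :=
        tendsto_id.const_mul_atTop' two_pos
      have h2 : Tendsto (fun N : ℕ ↦ (N + n).toNat) atTop atTop := by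
        refine tendsto_atTop_atTop.mpr fun b ↦ ⟨b + n.natAbs, fun a ha ↦ ?_⟩; omega
      have h3 : Tendsto (fun N : ℕ ↦ (N - n).toNat) atTop atTop := by
        refine tendsto_atTop_atTop.mpr fun b ↦ ⟨b + n.natAbs, fun a ha ↦ ?_⟩; omega
      have h4 := ((tendsto_qPoch hq).comp h1).div (((tendsto_qPoch hq).comp h2).mul
        ((tendsto_qPoch hq).comp h3)) (mul_ne_zero hP hP)
      refine Tendsto.congr' ?_ (h4.const_mul (e (n * s + (n : ℂ) * (n - 1) / 2 * τ)))
      filter_upwards [eventually_ge_atTop n.natAbs] with N hN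
      simp [F, hN]
    · simp only [F]
      split_ifs with h
      · rw [norm_mul, div_eq_mul_inv (qPoch _ _), mul_inv, norm_mul (qPoch _ _), norm_mul (_)⁻¹]
        gcongr
        · exact (hC _).1
        · exact (hC _).2
        · exact (hC _).2
      · simp only [norm_zero]; positivity
  have hlim2 := ((multipliable_one_add_mul_pow (e s) hq).hasProd.tendsto_prod_nat).mul
    ((multipliable_one_add_mul_pow ((e s)⁻¹ * e τ) hq).hasProd.tendsto_prod_nat)
  simp only [mul_assoc, ← pow_succ'] at hlim2
  have := tendsto_nhds_unique hlim1 (hlim2.congr fun N ↦ (hF N).symm)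
  rw [tsum_mul_right] at this
  rw [← this, mul_comm P, mul_assoc, div_mul_cancel_right₀ hP, inv_mul_cancel₀ hP, mul_one]

/-- `ϑ(v; τ)` vanishes only at the points `v ∈ ℤ τ + ℤ`. -/
theorem vartheta_ne_zero {v : ℂ} {τ : ℍ} (h : ∀ m n : ℤ, v ≠ m * τ + n) : vartheta v τ ≠ 0 := by
  have hq := norm_e_coe_lt_one τ
  have h1 := (hasSum_vartheta v τ).tsum_eq
  have h2 := jacobi_triple_product (1 / 2 - v) τ
  have h3 : ∑' n : ℤ, e (n * (1 / 2 - v) + (n : ℂ) * (n - 1) / 2 * τ) =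
      ∑' n : ℤ, (-1 : ℂ) ^ n * e (n * v) * e ((n : ℂ) * (n + 1) / 2 * τ) := by
    rw [← (Equiv.neg ℤ).tsum_eq]
    refine tsum_congr fun n ↦ ?_
    rw [← e_int_div_two, ← e_add, ← e_add]
    refine e_mul_int_of_exp (-n) ?_
    simp only [Equiv.neg_apply]
    push_cast
    ring
  -- Both families of factors reduce to this: $m=i$ for the first, and $m=-(i+1)$, up to a unit, for
  -- the second. A zero would put $v$ in the lattice.
  have h4 : ∀ m : ℤ, 1 + e (1 / 2 - v) * e (m * τ) ≠ 0 := by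
    intro m h0
    rw [sub_eq_add_neg, e_add, e_half, mul_assoc, ← e_add, neg_one_mul, ← sub_eq_add_neg,
      sub_eq_zero, eq_comm, e_eq_one_iff] at h0
    obtain ⟨n, hn⟩ := h0
    exact h m (-n) (by push_cast; linear_combination -hn)
  rw [← h3, h2] at h1
  intro h0
  rw [h0, mul_zero] at h1
  refine (mul_ne_zero (tprod_one_sub_ne_zero τ) (mul_ne_zero ?_ ?_)) h1
  · refine tprod_one_add_ne_zero_of_summable (f := fun i ↦ e (1 / 2 - v) * e τ ^ i) ?_ ?_
    · intro i
      have := h4 i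
      rwa [e_int_mul, zpow_natCast] at this
    · simpa using (summable_geometric_of_lt_one (norm_nonneg _) hq).mul_left ‖e (1 / 2 - v)‖
  · refine tprod_one_add_ne_zero_of_summable
      (f := fun i ↦ (e (1 / 2 - v))⁻¹ * e τ ^ (i + 1)) ?_ ?_
    · intro i h5
      refine h4 (-(i + 1 : ℕ)) ?_
      rw [e_int_mul, zpow_neg, zpow_natCast]
      have h6 : e τ ^ (i + 1) ≠ 0 := pow_ne_zero _ (e_ne_zero _)
      have h7 := e_ne_zero (1 / 2 - v)
      field_simp at h5 ⊢
      linear_combination h5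
    · simp only [pow_succ', ← mul_assoc, norm_mul, norm_pow]
      exact (summable_geometric_of_lt_one (norm_nonneg _) hq).mul_left _

end EtaTheta

/-! ### Wirtinger calculus, error-function bounds and Gaussian majorants. -/

namespace EtaTheta

open Filter Topology MeasureTheory

/-! ### Wirtinger derivatives -/

/-- The real-linear map `h ↦ p h + b conj(h)`. -/
noncomputable def wirtinger (p b : ℂ) : ℂ →L[ℝ] ℂ :=
  p • (1 : ℂ →L[ℝ] ℂ) + b • (Complex.conjCLE : ℂ →L[ℝ] ℂ)

@[simp] lemma wirtinger_apply (p b h : ℂ) : wirtinger p b h = p * h + b * (starRingEnd ℂ) h := by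
  simp [wirtinger]

lemma norm_wirtinger_le (p b : ℂ) : ‖wirtinger p b‖ ≤ ‖p‖ + ‖b‖ := by
  refine ContinuousLinearMap.opNorm_le_bound _ (by positivity) fun h ↦ ?_
  rw [wirtinger_apply, add_mul]
  refine (norm_add_le _ _).trans ?_
  rw [norm_mul, norm_mul, RCLike.norm_conj]

/-- `f` has the Wirtinger derivatives `∂f/∂z = p` and `∂f/∂(conj z) = b` at `z`. -/
def HasWirtingerAt (f : ℂ → ℂ) (p b z : ℂ) : Prop := HasFDerivAt f (wirtinger p b) z

lemma _root_.HasDerivAt.hasWirtingerAt {f : ℂ → ℂ} {f' z : ℂ} (h : HasDerivAt f f' z) :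
    HasWirtingerAt f f' 0 z := by
  have := h.hasFDerivAt.restrictScalars ℝ
  refine this.congr_fderiv ?_
  ext w; simp [mul_comm]

lemma HasWirtingerAt.congr_val {f : ℂ → ℂ} {p b p' b' z : ℂ} (h : HasWirtingerAt f p b z)
    (hp : p = p') (hb : b = b') : HasWirtingerAt f p' b' z := hp ▸ hb ▸ h

/-- The Cauchy–Riemann equations: holomorphy is proved below by checking that $\partial/\partial\bar
z$ cancels. -/
lemma HasWirtingerAt.hasDerivAt {f : ℂ → ℂ} {p z : ℂ} (h : HasWirtingerAt f p 0 z) :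
    HasDerivAt f p z := by
  have : HasFDerivAt f (ContinuousLinearMap.toSpanSingleton ℂ p) z := by
    refine hasFDerivAt_of_restrictScalars ℝ h ?_
    ext w; simp [mul_comm]
  exact this.hasDerivAt.congr_deriv (by simp)

lemma HasWirtingerAt.add {f g : ℂ → ℂ} {p b p' b' z : ℂ} (hf : HasWirtingerAt f p b z)
    (hg : HasWirtingerAt g p' b' z) : HasWirtingerAt (fun w ↦ f w + g w) (p + p') (b + b') z := by
  refine (HasFDerivAt.fun_add hf hg).congr_fderiv ?_
  ext w; simp; ring

lemma HasWirtingerAt.mul {f g : ℂ → ℂ} {p b p' b' z : ℂ} (hf : HasWirtingerAt f p b z)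
    (hg : HasWirtingerAt g p' b' z) :
    HasWirtingerAt (fun w ↦ f w * g w) (p * g z + f z * p') (b * g z + f z * b') z := by
  refine (HasFDerivAt.fun_mul hf hg).congr_fderiv ?_
  ext w; simp; ring

lemma HasWirtingerAt.const_mul {f : ℂ → ℂ} {p b z : ℂ} (c : ℂ) (hf : HasWirtingerAt f p b z) :
    HasWirtingerAt (fun w ↦ c * f w) (c * p) (c * b) z := by
  refine (HasFDerivAt.const_mul hf c).congr_fderiv ?_
  ext w; simp; ring

lemma HasWirtingerAt.comp_mul {f : ℂ → ℂ} {p b z : ℂ} (c : ℂ) (hf : HasWirtingerAt f p b (c * z)) :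
    HasWirtingerAt (fun w ↦ f (c * w)) (p * c) (b * (starRingEnd ℂ) c) z := by
  have h1 : HasFDerivAt (fun w : ℂ ↦ c * w) (wirtinger c 0) z :=
    HasDerivAt.hasWirtingerAt (by simpa using (hasDerivAt_id z).const_mul c)
  refine (HasFDerivAt.comp z hf h1).congr_fderiv ?_
  ext w; simp; ring

/-- A real function of `Im w`. -/
lemma HasDerivAt.hasWirtingerAt_im {f : ℝ → ℝ} {f' : ℝ} {z : ℂ} (h : HasDerivAt f f' z.im) :
    HasWirtingerAt (fun w ↦ ((f w.im : ℝ) : ℂ)) (f' * (-I / 2)) (f' * (I / 2)) z := by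
  have h1 : HasFDerivAt (fun w : ℂ ↦ f w.im) (f' • Complex.imCLM) z :=
    h.comp_hasFDerivAt z Complex.imCLM.hasFDerivAt
  have h2 := Complex.ofRealCLM.hasFDerivAt.comp z h1
  refine HasFDerivAt.congr_fderiv (f := fun w : ℂ ↦ ((f w.im : ℝ) : ℂ)) h2 ?_
  ext w
  have h := Complex.sub_conj w
  push_cast at h
  simp only [ContinuousLinearMap.comp_apply, FunLike.coe_smul, Pi.smul_apply,
    Complex.imCLM_apply, Complex.ofRealCLM_apply, wirtinger_apply, smul_eq_mul]
  push_cast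
  linear_combination (f' * I / 2) * h + f' * w.im * Complex.I_mul_I

/-- Termwise differentiation. One majorant serves for both Wirtinger derivatives, and connectedness
lets summability of the series at a single point suffice. -/
lemma hasWirtingerAt_tsum {ι : Type*} {s : Set ℂ} (hs : IsOpen s) (hc : IsPreconnected s)
    {f p b : ι → ℂ → ℂ} {u : ι → ℝ} (hu : Summable u)
    (hf : ∀ n, ∀ z ∈ s, HasWirtingerAt (f n) (p n z) (b n z) z)
    (hp : ∀ n, ∀ z ∈ s, ‖p n z‖ ≤ u n) (hb : ∀ n, ∀ z ∈ s, ‖b n z‖ ≤ u n) {z₀ : ℂ} (hz₀ : z₀ ∈ s)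
    (hf0 : Summable fun n ↦ f n z₀) {z : ℂ} (hz : z ∈ s) :
    HasWirtingerAt (fun w ↦ ∑' n, f n w) (∑' n, p n z) (∑' n, b n z) z := by
  have key := hasFDerivAt_tsum_of_isPreconnected (hu.add hu) hs hc hf
    (fun n x hx ↦ (norm_wirtinger_le _ _).trans (add_le_add (hp n x hx) (hb n x hx))) hz₀ hf0 hz
  refine key.congr_fderiv ?_
  have h1 := (Summable.of_norm_bounded hu fun n ↦ hp n z hz).hasSum
  have h2 := (Summable.of_norm_bounded hu fun n ↦ hb n z hz).hasSum
  exact ((h1.smul_const (1 : ℂ →L[ℝ] ℂ)).add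
    (h2.smul_const (Complex.conjCLE : ℂ →L[ℝ] ℂ))).tsum_eq

/-! ### The error function -/

/-- `E(x) = 2 ∫_0^x exp(-π t²) dt`. -/
noncomputable def erfE (x : ℝ) : ℝ := 2 * ∫ t in (0 : ℝ)..x, Real.exp (-π * t ^ 2)

lemma hasDerivAt_erfE (x : ℝ) : HasDerivAt erfE (2 * Real.exp (-π * x ^ 2)) x := by
  have hc : Continuous fun t : ℝ ↦ Real.exp (-π * t ^ 2) := by fun_prop
  exact (intervalIntegral.integral_hasDerivAt_right (hc.intervalIntegrable _ _)
    (hc.stronglyMeasurableAtFilter _ _) hc.continuousAt).const_mul 2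

lemma integrable_gauss : Integrable fun t : ℝ ↦ Real.exp (-π * t ^ 2) :=
  integrable_exp_neg_mul_sq Real.pi_pos

lemma one_sub_erfE (x : ℝ) : 1 - erfE x = 2 * ∫ t in Set.Ioi x, Real.exp (-π * t ^ 2) := by
  have h1 := integral_gaussian_Ioi π
  rw [div_self Real.pi_ne_zero, Real.sqrt_one] at h1
  have h2 := intervalIntegral.integral_interval_add_Ioi (a := 0) (b := x)
    (integrable_gauss.integrableOn) (integrable_gauss.integrableOn)
  rw [erfE]
  linarith

lemma erfE_neg (x : ℝ) : erfE (-x) = -erfE x := by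
  have := intervalIntegral.integral_comp_neg (a := 0) (b := x)
    (fun t : ℝ ↦ Real.exp (-π * t ^ 2))
  simp only [neg_sq, neg_zero] at this
  rw [erfE, erfE, this, intervalIntegral.integral_symm (-x) 0]
  ring

lemma one_sub_erfE_nonneg (x : ℝ) : 0 ≤ 1 - erfE x := by
  rw [one_sub_erfE]
  exact mul_nonneg two_pos.le (setIntegral_nonneg measurableSet_Ioi fun t _ ↦ (Real.exp_pos _).le)

/-- After shifting the tail integral to start at $0$, $(t+x)^2\ge t^2+x^2$ extracts $e^{-\pi x^2}$
and leaves the full half-line Gaussian. -/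
lemma one_sub_erfE_le {x : ℝ} (hx : 0 ≤ x) : 1 - erfE x ≤ Real.exp (-π * x ^ 2) := by
  have h0 := one_sub_erfE 0
  rw [show erfE 0 = 0 by simp [erfE]] at h0
  rw [one_sub_erfE]
  have h1 : ∫ t in Set.Ioi x, Real.exp (-π * t ^ 2) =
      ∫ t in Set.Ioi (0 : ℝ), Real.exp (-π * (t + x) ^ 2) := by
    have := (measurePreserving_add_right volume x).setIntegral_preimage_emb
      (measurableEmbedding_addRight x) (fun t : ℝ ↦ Real.exp (-π * t ^ 2)) (Set.Ioi x)
    simpa using this.symm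
  have h2 : ∫ t in Set.Ioi (0 : ℝ), Real.exp (-π * (t + x) ^ 2) ≤
      ∫ t in Set.Ioi (0 : ℝ), Real.exp (-π * x ^ 2) * Real.exp (-π * t ^ 2) := by
    refine setIntegral_mono_on (integrable_gauss.comp_add_right x).integrableOn
      (integrable_gauss.const_mul _).integrableOn measurableSet_Ioi fun t ht ↦ ?_
    rw [← Real.exp_add]
    refine Real.exp_le_exp.mpr ?_
    have : 0 ≤ π * (t * x) := mul_nonneg Real.pi_pos.le (mul_nonneg (le_of_lt ht) hx)
    nlinarith
  rw [integral_const_mul] at h2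
  rw [h1]
  nlinarith [Real.exp_pos (-π * x ^ 2)]

lemma abs_sub_erfE_le {σ x : ℝ} (hσ : σ = 1 ∨ σ = -1) (hx : 0 ≤ σ * x) :
    |σ - erfE x| ≤ Real.exp (-π * x ^ 2) := by
  rcases hσ with rfl | rfl
  · rw [one_mul] at hx
    rw [abs_of_nonneg (one_sub_erfE_nonneg x)]
    exact one_sub_erfE_le hx
  · have h1 := one_sub_erfE_nonneg (-x)
    have h2 := one_sub_erfE_le (x := -x) (by linarith)
    rw [erfE_neg] at h1 h2
    rw [show -1 - erfE x = -(1 - -erfE x) by ring, abs_neg, abs_of_nonneg h1]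
    simpa using h2

lemma abs_sub_erfE_le_two {σ : ℝ} (hσ : σ = 1 ∨ σ = -1) (x : ℝ) : |σ - erfE x| ≤ 2 := by
  have h1 := one_sub_erfE_nonneg x
  have h2 := one_sub_erfE_nonneg (-x)
  rw [erfE_neg] at h2
  rw [abs_le]
  rcases hσ with rfl | rfl <;> constructor <;> linarith

lemma real_sign_eq {x : ℝ} (hx : x ≠ 0) : x.sign = 1 ∨ x.sign = -1 :=
  (Real.sign_apply_eq_of_ne_zero x hx).symm

/-- If $\nu$ and $\nu+a$ agree in sign, this is the tail bound. Otherwise $|\nu+a|\le|a|$, the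
exponent is nonnegative, and the trivial bound $2$ suffices. The summand $2\pi ya^2$ is the price
for having one bound in both cases. -/
lemma abs_sign_sub_erfE_le {ν : ℝ} (hν : ν ≠ 0) (a : ℝ) {y : ℝ} (hy : 0 < y) :
    |ν.sign - erfE ((ν + a) * √(2 * y))| ≤
      2 * Real.exp (2 * π * y * a ^ 2 - 2 * π * y * (ν + a) ^ 2) := by
  have hs := real_sign_eq hν
  have hsq : √(2 * y) ^ 2 = 2 * y := Real.sq_sqrt (by positivity)
  have hpi := Real.pi_pos
  by_cases h : 0 ≤ ν.sign * ((ν + a) * √(2 * y))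
  · refine (abs_sub_erfE_le hs h).trans ?_
    rw [mul_pow, hsq]
    have : Real.exp (-π * ((ν + a) ^ 2 * (2 * y))) ≤
        Real.exp (2 * π * y * a ^ 2 - 2 * π * y * (ν + a) ^ 2) := by
      refine Real.exp_le_exp.mpr ?_
      have : 0 ≤ 2 * π * y * a ^ 2 := by positivity
      linarith
    linarith [Real.exp_pos (-π * ((ν + a) ^ 2 * (2 * y)))]
  · refine (abs_sub_erfE_le_two hs _).trans ?_
    have hle : (ν + a) ^ 2 ≤ a ^ 2 := by
      rw [← mul_assoc] at h
      have h' : ν.sign * (ν + a) < 0 := by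
        by_contra h'
        exact h (mul_nonneg (not_lt.mp h') (Real.sqrt_nonneg _))
      rcases lt_or_gt_of_ne hν with h0 | h0
      · rw [Real.sign_of_neg h0] at h'
        nlinarith
      · rw [Real.sign_of_pos h0] at h'
        nlinarith
    have : 1 ≤ Real.exp (2 * π * y * a ^ 2 - 2 * π * y * (ν + a) ^ 2) := by
      refine Real.one_le_exp ?_
      have : 0 ≤ 2 * π * y := by positivity
      nlinarith
    linarith

/-! ### Summability of Gaussian series -/

/-- The source of the Gaussian majorants below. By $n^2/2\le(n+\alpha)^2+\alpha^2$, removing the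
shift costs half the decay rate and a constant factor. -/
lemma summable_gauss_shift (α : ℝ) {S T : ℝ} (hS : 0 ≤ S) (hT : 0 < T) (k : ℕ) :
    Summable fun n : ℤ ↦ |(n : ℝ) + α| ^ k *
      Real.exp (-π * (T * ((n : ℝ) + α) ^ 2 - 2 * S * |(n : ℝ) + α|)) := by
  have h1 := summable_pow_mul_jacobiTheta₂_term_bound S (half_pos hT) k
  have h2 := summable_pow_mul_jacobiTheta₂_term_bound S (half_pos hT) 0
  have h3 := (h1.add h2).mul_left ((1 + |α|) ^ k * Real.exp (π * (T * α ^ 2 + 2 * S * |α|)))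
  refine Summable.of_nonneg_of_le (fun n ↦ by positivity) (fun n ↦ ?_) h3
  have hn : |(n : ℝ) + α| ≤ |(n : ℝ)| + |α| := abs_add_le _ _
  have hpow : |(n : ℝ) + α| ^ k ≤ (1 + |α|) ^ k * (|(n : ℝ)| ^ k + |(n : ℝ)| ^ 0) := by
    rcases le_total |(n : ℝ)| 1 with h | h
    · calc |(n : ℝ) + α| ^ k ≤ (1 + |α|) ^ k := by gcongr; linarith
        _ ≤ _ := le_mul_of_one_le_right (by positivity) (by simp)
    · calc |(n : ℝ) + α| ^ k ≤ ((1 + |α|) * |(n : ℝ)|) ^ k := by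
            gcongr
            nlinarith [abs_nonneg α]
        _ = (1 + |α|) ^ k * |(n : ℝ)| ^ k := mul_pow _ _ _
        _ ≤ _ := by gcongr; simp
  have hexp : Real.exp (-π * (T * ((n : ℝ) + α) ^ 2 - 2 * S * |(n : ℝ) + α|)) ≤
      Real.exp (π * (T * α ^ 2 + 2 * S * |α|)) *
        Real.exp (-π * (T / 2 * (n : ℝ) ^ 2 - 2 * S * |(n : ℝ)|)) := by
    rw [← Real.exp_add]
    refine Real.exp_le_exp.mpr ?_
    have e1 : (n : ℝ) ^ 2 / 2 ≤ ((n : ℝ) + α) ^ 2 + α ^ 2 := by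
      nlinarith [sq_nonneg ((n : ℝ) + 2 * α)]
    have e2 : T * ((n : ℝ) ^ 2 / 2) ≤ T * (((n : ℝ) + α) ^ 2 + α ^ 2) :=
      mul_le_mul_of_nonneg_left e1 hT.le
    have e3 : 2 * S * |(n : ℝ) + α| ≤ 2 * S * (|(n : ℝ)| + |α|) :=
      mul_le_mul_of_nonneg_left hn (by positivity)
    have e4 : 0 ≤ π * ((T * (((n : ℝ) + α) ^ 2 + α ^ 2) - T * ((n : ℝ) ^ 2 / 2)) +
        (2 * S * (|(n : ℝ)| + |α|) - 2 * S * |(n : ℝ) + α|)) :=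
      mul_nonneg Real.pi_pos.le (by linarith)
    linarith
  calc _ ≤ ((1 + |α|) ^ k * (|(n : ℝ)| ^ k + |(n : ℝ)| ^ 0)) *
        (Real.exp (π * (T * α ^ 2 + 2 * S * |α|)) *
          Real.exp (-π * (T / 2 * (n : ℝ) ^ 2 - 2 * S * |(n : ℝ)|))) := by gcongr
    _ = _ := by push_cast; ring

end EtaTheta

/-! ### Zwegers' non-holomorphic function $R$. -/

namespace EtaTheta

open Filter Topology MeasureTheory

/-! ### The function `R` -/

/-- The `n`-th phase `(-1) ^ n exp(-πi ν² τ - 2πi ν u)`, `ν = n + 1/2`, in the series for `R`. -/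
noncomputable def phaseR (n : ℤ) (u : ℂ) (τ : ℍ) : ℂ :=
  (-1 : ℂ) ^ n * e (-((n : ℂ) + 1 / 2) ^ 2 / 2 * τ - ((n : ℂ) + 1 / 2) * u)

/-- The `n`-th term in the series for `R`. -/
noncomputable def termR (n : ℤ) (u : ℂ) (τ : ℍ) : ℂ :=
  ((Real.sign ((n : ℝ) + 1 / 2) -
    erfE (((n : ℝ) + 1 / 2 + u.im / τ.im) * √(2 * τ.im)) : ℝ) : ℂ) * phaseR n u τ

lemma zwegersR_eq (u : ℂ) (τ : ℍ) : zwegersR u τ = ∑' n, termR n u τ := by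
  refine tsum_congr fun n ↦ ?_
  rw [termR, phaseR, erfE, mul_assoc, e]
  congr 3
  ring

lemma int_add_half_ne_zero (n : ℤ) : (n : ℝ) + 1 / 2 ≠ 0 := by
  intro h
  have : (2 * n + 1 : ℝ) = 0 := by linarith
  have h2 : (2 * n + 1 : ℤ) = 0 := by exact_mod_cast this
  omega

lemma norm_phaseR (n : ℤ) (u : ℂ) (τ : ℍ) :
    ‖phaseR n u τ‖ = Real.exp (π * ((n : ℝ) + 1 / 2) ^ 2 * τ.im +
      2 * π * ((n : ℝ) + 1 / 2) * u.im) := by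
  rw [phaseR, norm_mul, norm_zpow, norm_neg, norm_one, one_zpow, one_mul, norm_e]
  congr 1
  rw [show (-((n : ℂ) + 1 / 2) ^ 2 / 2 * τ - ((n : ℂ) + 1 / 2) * u) =
    ((-((n : ℝ) + 1 / 2) ^ 2 / 2 : ℝ) : ℂ) * τ - (((n : ℝ) + 1 / 2 : ℝ) : ℂ) * u by push_cast; ring,
    Complex.sub_im, Complex.im_ofReal_mul, Complex.im_ofReal_mul, coe_im]
  ring

lemma im_eq_div_mul (u : ℂ) (τ : ℍ) : u.im = u.im / τ.im * τ.im :=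
  (div_mul_cancel₀ _ τ.im_ne_zero).symm

/-- The Gaussian which bounds the series for `R` and its derivatives. -/
noncomputable def gaussR (S y : ℝ) (n : ℤ) : ℝ :=
  Real.exp (-π * (y * ((n : ℝ) + 1 / 2) ^ 2 - 2 * S * |(n : ℝ) + 1 / 2|))

lemma exp_le_gaussR {u : ℂ} {τ : ℍ} {S : ℝ} (hu : |u.im| ≤ S) (n : ℤ) :
    Real.exp (-(π * τ.im * ((n : ℝ) + 1 / 2) ^ 2) - 2 * π * ((n : ℝ) + 1 / 2) * u.im) ≤
      gaussR S τ.im n := by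
  refine Real.exp_le_exp.mpr ?_
  have h1 : -(((n : ℝ) + 1 / 2) * u.im) ≤ |(n : ℝ) + 1 / 2| * S := by
    refine (neg_le_abs _).trans ?_
    rw [abs_mul]
    gcongr
  have h2 := mul_le_mul_of_nonneg_left h1 Real.two_pi_pos.le
  linarith

lemma gauss_mul_norm_phaseR_le {u : ℂ} {τ : ℍ} {S : ℝ} (hu : |u.im| ≤ S) (n : ℤ) :
    Real.exp (-π * (((n : ℝ) + 1 / 2 + u.im / τ.im) * √(2 * τ.im)) ^ 2) * ‖phaseR n u τ‖ ≤
      gaussR S τ.im n := by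
  refine le_trans ?_ (exp_le_gaussR hu n)
  have hsq : √(2 * τ.im) ^ 2 = 2 * τ.im := Real.sq_sqrt (by have := τ.im_pos; positivity)
  rw [norm_phaseR, ← Real.exp_add, mul_pow, hsq]
  refine Real.exp_le_exp.mpr ?_
  generalize hν : (n : ℝ) + 1 / 2 = ν
  have hy := τ.im_pos
  have ha := im_eq_div_mul u τ
  generalize u.im / τ.im = a at *
  rw [ha]
  have : 0 ≤ 2 * π * τ.im * a ^ 2 := by positivity
  nlinarith

lemma norm_termR_le {u : ℂ} {τ : ℍ} {S : ℝ} (hu : |u.im| ≤ S) (n : ℤ) :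
    ‖termR n u τ‖ ≤ 2 * gaussR S τ.im n := by
  have h1 := abs_sign_sub_erfE_le (int_add_half_ne_zero n) (u.im / τ.im) τ.im_pos
  rw [termR, norm_mul, Complex.norm_real, Real.norm_eq_abs]
  calc _ ≤ 2 * Real.exp (2 * π * τ.im * (u.im / τ.im) ^ 2 -
        2 * π * τ.im * ((n : ℝ) + 1 / 2 + u.im / τ.im) ^ 2) * ‖phaseR n u τ‖ := by gcongr
    _ = 2 * Real.exp (-(π * τ.im * ((n : ℝ) + 1 / 2) ^ 2) -
          2 * π * ((n : ℝ) + 1 / 2) * u.im) := by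
        rw [norm_phaseR, mul_assoc, ← Real.exp_add]
        congr 2
        have ha := im_eq_div_mul u τ
        generalize u.im / τ.im = a at *
        rw [ha]
        ring
    _ ≤ _ := by gcongr; exact exp_le_gaussR hu n

lemma summable_pow_mul_gaussR {S y : ℝ} (hS : 0 ≤ S) (hy : 0 < y) (k : ℕ) :
    Summable fun n : ℤ ↦ |(n : ℝ) + 1 / 2| ^ k * gaussR S y n :=
  summable_gauss_shift (1 / 2) hS hy k

lemma summable_gaussR {S y : ℝ} (hS : 0 ≤ S) (hy : 0 < y) : Summable (gaussR S y) := by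
  simpa using summable_pow_mul_gaussR hS hy 0

lemma summable_termR (u : ℂ) (τ : ℍ) : Summable fun n ↦ termR n u τ :=
  Summable.of_norm_bounded ((summable_gaussR (abs_nonneg u.im) τ.im_pos).mul_left 2)
    (norm_termR_le le_rfl)

lemma norm_zwegersR_le {u : ℂ} {τ : ℍ} {S : ℝ} (hu : |u.im| ≤ S) :
    ‖zwegersR u τ‖ ≤ 2 * ∑' n, gaussR S τ.im n := by
  rw [zwegersR_eq, ← tsum_mul_left]
  exact tsum_of_norm_bounded
    ((summable_gaussR ((abs_nonneg _).trans hu) τ.im_pos).mul_left 2).hasSum (norm_termR_le hu)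

lemma zwegersR_add_one (u : ℂ) (τ : ℍ) : zwegersR (u + 1) τ = -zwegersR u τ := by
  rw [zwegersR_eq, zwegersR_eq, ← tsum_neg]
  refine tsum_congr fun n ↦ ?_
  rw [termR, termR, ← mul_neg]
  congr 1
  · simp
  · rw [phaseR, phaseR, ← mul_neg, ← neg_one_mul (e _), ← e_half, ← e_add]
    congr 1
    exact e_mul_int_of_exp (-n - 1) (by push_cast; ring)

lemma zwegersR_T (u : ℂ) (τ τ' : ℍ) (h : (τ' : ℂ) = τ + 1) :
    zwegersR u τ' = e (-(1 / 8)) * zwegersR u τ := by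
  have him : τ'.im = τ.im := by
    rw [← coe_im, h, Complex.add_im, Complex.one_im, add_zero, coe_im]
  rw [zwegersR_eq, zwegersR_eq, ← tsum_mul_left]
  refine tsum_congr fun n ↦ ?_
  rw [termR, termR, him, mul_left_comm]
  congr 1
  rw [phaseR, phaseR, mul_left_comm, ← e_add]
  congr 1
  obtain ⟨m, hm⟩ := Int.even_mul_succ_self n
  have hm' : (n * (n + 1) : ℂ) = m + m := by exact_mod_cast hm
  refine e_mul_int_of_exp (-m) ?_
  rw [h]
  push_cast
  linear_combination -hm' / 2

/-- Adding $\tau$ to $u$ raises $\mathrm{Im}(u)/y$ by $1$, so the error function already sees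
$\nu+1$. Only $\mathrm{sgn}(\nu)$ lags behind, and only where $\nu=-1/2$ becomes $1/2$, that is, at
$n=-1$. -/
lemma termR_add_tau (n : ℤ) (u : ℂ) (τ : ℍ) : termR n (u + τ) τ =
    -e (u + τ / 2) * termR (n + 1) u τ + if n = -1 then 2 * e (u / 2 + 3 * τ / 8) else 0 := by
  have h1 : phaseR n (u + τ) τ = -e (u + τ / 2) * phaseR (n + 1) u τ := by
    rw [phaseR, phaseR, zpow_add_one₀ (by norm_num)]
    rw [show -e (u + τ / 2) * ((-1) ^ n * -1 * e (-(((n + 1 : ℤ) : ℂ) + 1 / 2) ^ 2 / 2 * τ -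
      (((n + 1 : ℤ) : ℂ) + 1 / 2) * u)) = (-1) ^ n * (e (u + τ / 2) *
      e (-(((n + 1 : ℤ) : ℂ) + 1 / 2) ^ 2 / 2 * τ - (((n + 1 : ℤ) : ℂ) + 1 / 2) * u)) by ring,
      ← e_add]
    congr 2
    push_cast
    ring
  have h2 : (n : ℝ) + 1 / 2 + (u + (τ : ℂ)).im / τ.im =
      ((n + 1 : ℤ) : ℝ) + 1 / 2 + u.im / τ.im := by
    have := τ.im_ne_zero
    rw [Complex.add_im, coe_im]
    push_cast
    field_simp
    ring
  rw [termR, termR, h1, h2]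
  split_ifs with h
  · subst h
    have h3 : ((-1 : ℤ) : ℝ) + 1 / 2 < 0 := by norm_num
    have h4 : 0 < ((-1 + 1 : ℤ) : ℝ) + 1 / 2 := by norm_num
    have h5 : phaseR (-1 + 1) u τ = e (-τ / 8 - u / 2) := by
      rw [phaseR]; norm_num; congr 1; ring
    have h6 : e (u / 2 + 3 * τ / 8) = e (u + τ / 2) * e (-τ / 8 - u / 2) := by
      rw [← e_add]; congr 1; ring
    rw [Real.sign_of_neg h3, Real.sign_of_pos h4, h5, h6]
    push_cast
    ring
  · have : Real.sign ((n : ℝ) + 1 / 2) = Real.sign (((n + 1 : ℤ) : ℝ) + 1 / 2) := by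
      rcases lt_or_ge n (-1) with h7 | h7
      · have : (n : ℝ) + 2 ≤ 0 := by exact_mod_cast (by omega : n + 2 ≤ 0)
        rw [Real.sign_of_neg (by linarith), Real.sign_of_neg (by push_cast; linarith)]
      · have : (0 : ℝ) ≤ n := by exact_mod_cast (by omega : 0 ≤ n)
        rw [Real.sign_of_pos (by linarith), Real.sign_of_pos (by push_cast; linarith)]
    rw [this]
    ring

lemma zwegersR_add_tau (u : ℂ) (τ : ℍ) :
    zwegersR (u + τ) τ = -e (u + τ / 2) * zwegersR u τ + 2 * e (u / 2 + 3 * τ / 8) := by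
  rw [zwegersR_eq, zwegersR_eq, ← (Equiv.addRight (1 : ℤ)).tsum_eq (fun n ↦ termR n u τ),
    ← tsum_mul_left]
  simp only [termR_add_tau, Equiv.coe_addRight]
  have h1 := ((Equiv.addRight (1 : ℤ)).summable_iff.mpr (summable_termR u τ)).mul_left
    (-e (u + τ / 2))
  have h2 := hasSum_ite_eq (-1 : ℤ) (2 * e (u / 2 + 3 * τ / 8))
  exact (h1.hasSum.add h2).tsum_eq

/-- The derivative `∂R/∂(conj u)` is, up to an elementary factor, the conjugate of `ϑ`. -/
noncomputable def dbarR (u : ℂ) (τ : ℍ) : ℂ :=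
  ((√(2 * τ.im) / τ.im * Real.exp (-(2 * π * u.im ^ 2 / τ.im)) : ℝ) : ℂ) *
    (starRingEnd ℂ) (vartheta u τ)

/-- Completing the square: the Gaussian produced by differentiating the error function replaces
$\tau$ and $u$ in the phase by their conjugates and leaves a factor independent of $n$. Hence the
derivative sums to a conjugate theta function. -/
lemma gauss_mul_phaseR (n : ℤ) (u : ℂ) (τ : ℍ) :
    ((Real.exp (-π * (((n : ℝ) + 1 / 2 + u.im / τ.im) * √(2 * τ.im)) ^ 2) : ℝ) : ℂ) *
      phaseR n u τ = I * ((Real.exp (-(2 * π * u.im ^ 2 / τ.im)) : ℝ) : ℂ) * (starRingEnd ℂ)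
      (e (((n : ℂ) + 1 / 2) * (u + 1 / 2)) * e (((n : ℂ) + 1 / 2) ^ 2 / 2 * τ)) := by
  have hsq : √(2 * τ.im) ^ 2 = 2 * τ.im := Real.sq_sqrt (by have := τ.im_pos; positivity)
  have hy : ((τ.im : ℝ) : ℂ) ≠ 0 := by exact_mod_cast τ.im_ne_zero
  rw [← e_add, conj_e, phaseR, ← e_int_div_two, mul_pow, hsq, ← e_add, ← e_quarter]
  have h1 : ∀ x : ℝ, ((Real.exp x : ℝ) : ℂ) = e (-I * x / (2 * π)) := by
    intro x
    rw [e, Complex.ofReal_exp]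
    congr 1
    have : (π : ℂ) ≠ 0 := by exact_mod_cast Real.pi_ne_zero
    field_simp
    rw [Complex.I_sq]
    ring
  rw [h1, h1]
  simp only [← e_add]
  refine e_mul_int_of_exp n ?_
  have hu := Complex.sub_conj u
  have hτ := Complex.sub_conj (τ : ℂ)
  have hpi : (π : ℂ) ≠ 0 := by exact_mod_cast Real.pi_ne_zero
  simp only [map_add, map_mul, map_div₀, map_pow, Complex.conj_ofNat, map_one,
    map_intCast]
  push_cast at hu hτ ⊢
  rw [coe_im] at hτ
  have e1 : (starRingEnd ℂ) u = u - 2 * u.im * I := by linear_combination -hu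
  have e2 : (starRingEnd ℂ) (τ : ℂ) = τ - 2 * τ.im * I := by linear_combination -hτ
  rw [e1, e2]
  field_simp
  ring

lemma hasWirtingerAt_termR (n : ℤ) (u : ℂ) (τ : ℍ) :
    HasWirtingerAt (fun w ↦ termR n w τ)
      (((√(2 * τ.im) / τ.im : ℝ) : ℂ) * I * (((Real.exp (-π * (((n : ℝ) + 1 / 2 +
          u.im / τ.im) * √(2 * τ.im)) ^ 2) : ℝ) : ℂ) * phaseR n u τ) +
        -(2 * π * I) * (((n : ℝ) + 1 / 2 : ℝ) : ℂ) * termR n u τ)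
      (((√(2 * τ.im) / τ.im : ℝ) : ℂ) * -I * (((Real.exp (-π * (((n : ℝ) + 1 / 2 +
          u.im / τ.im) * √(2 * τ.im)) ^ 2) : ℝ) : ℂ) * phaseR n u τ)) u := by
  have h1 : HasDerivAt (fun t : ℝ ↦ Real.sign ((n : ℝ) + 1 / 2) -
      erfE (((n : ℝ) + 1 / 2 + t / τ.im) * √(2 * τ.im)))
      (-(2 * Real.exp (-π * (((n : ℝ) + 1 / 2 + u.im / τ.im) * √(2 * τ.im)) ^ 2) *
        (1 / τ.im * √(2 * τ.im)))) u.im := by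
    have h2 : HasDerivAt (fun t : ℝ ↦ ((n : ℝ) + 1 / 2 + t / τ.im) * √(2 * τ.im))
        (1 / τ.im * √(2 * τ.im)) u.im :=
      (((hasDerivAt_id u.im).div_const τ.im).const_add _).mul_const _
    exact ((hasDerivAt_erfE _).comp u.im h2).const_sub _
  have h3 := HasDerivAt.hasWirtingerAt_im h1
  have h4 : HasDerivAt (fun w ↦ phaseR n w τ)
      (-(2 * π * I) * (((n : ℝ) + 1 / 2 : ℝ) : ℂ) * phaseR n u τ) u := by
    have h5 : HasDerivAt (fun w : ℂ ↦ -((n : ℂ) + 1 / 2) ^ 2 / 2 * τ - ((n : ℂ) + 1 / 2) * w)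
        (-((n : ℂ) + 1 / 2)) u := by
      simpa using ((hasDerivAt_id u).const_mul ((n : ℂ) + 1 / 2)).const_sub
        (-((n : ℂ) + 1 / 2) ^ 2 / 2 * (τ : ℂ))
    refine (((hasDerivAt_e _).comp u h5).const_mul ((-1 : ℂ) ^ n)).congr_deriv ?_
    rw [phaseR]
    push_cast
    ring
  refine (h3.mul h4.hasWirtingerAt).congr_val ?_ ?_
  · simp only [termR]
    push_cast
    ring
  · push_cast
    ring

lemma exists_hasWirtingerAt_zwegersR (u : ℂ) (τ : ℍ) :
    ∃ p, HasWirtingerAt (fun w ↦ zwegersR w τ) p (dbarR u τ) u := by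
  set S := |u.im| + 1
  have hS : 0 ≤ S := by positivity
  -- A horizontal strip around $u$ is convex and the Gaussian majorants are uniform on it.
  let s : Set ℂ := Complex.im ⁻¹' Set.Ioo (-S) S
  have hs : IsOpen s := isOpen_Ioo.preimage Complex.continuous_im
  have hc : IsPreconnected s := by
    have : Convex ℝ s := (convex_Ioo (-S) S).linear_preimage Complex.imLm
    exact this.isPreconnected
  have hus : u ∈ s := ⟨by linarith [neg_abs_le u.im], by linarith [le_abs_self u.im]⟩
  set c : ℝ := √(2 * τ.im) / τ.im
  have hc0 : 0 ≤ c := div_nonneg (Real.sqrt_nonneg _) τ.im_pos.le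
  have hsum : Summable fun n : ℤ ↦ c * gaussR S τ.im n +
      4 * π * (|(n : ℝ) + 1 / 2| ^ 1 * gaussR S τ.im n) :=
    ((summable_gaussR hS τ.im_pos).mul_left c).add
      ((summable_pow_mul_gaussR hS τ.im_pos 1).mul_left (4 * π))
  have hg : ∀ n : ℤ, ∀ z ∈ s, ‖((Real.exp (-π * (((n : ℝ) + 1 / 2 + z.im / τ.im) *
      √(2 * τ.im)) ^ 2) : ℝ) : ℂ) * phaseR n z τ‖ ≤ gaussR S τ.im n := by
    intro n z hz
    rw [norm_mul, Complex.norm_real, Real.norm_eq_abs, abs_of_pos (Real.exp_pos _)]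
    exact gauss_mul_norm_phaseR_le (abs_lt.mpr hz).le n
  have hg0 : ∀ n, 0 ≤ gaussR S τ.im n := fun n ↦ (Real.exp_pos _).le
  have key := hasWirtingerAt_tsum hs hc hsum (fun n z _ ↦ hasWirtingerAt_termR n z τ)
    (fun n z hz ↦ ?_) (fun n z hz ↦ ?_) hus (summable_termR u τ) hus
  · refine ⟨_, HasWirtingerAt.congr_val (f := fun w ↦ zwegersR w τ)
      (by simpa only [zwegersR_eq] using key) rfl ?_⟩
    rw [tsum_mul_left]
    simp only [gauss_mul_phaseR]
    rw [tsum_mul_left, ← Complex.conj_tsum, dbarR, vartheta]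
    push_cast
    linear_combination (-(√(2 * τ.im) / τ.im : ℂ) * Complex.exp (-(2 * π * u.im ^ 2 / τ.im)) *
      (starRingEnd ℂ) (∑' n : ℤ, e (((n : ℂ) + 1 / 2) * (u + 1 / 2)) *
        e (((n : ℂ) + 1 / 2) ^ 2 / 2 * τ))) * Complex.I_mul_I
  · refine (norm_add_le _ _).trans (add_le_add ?_ ?_)
    · rw [norm_mul, norm_mul, Complex.norm_real, Complex.norm_I, mul_one, Real.norm_eq_abs,
        abs_of_nonneg hc0]
      exact mul_le_mul_of_nonneg_left (hg n z hz) hc0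
    · rw [norm_mul, norm_mul, norm_neg, norm_mul, norm_mul, Complex.norm_I, Complex.norm_real,
        Complex.norm_real, Real.norm_eq_abs, Real.norm_eq_abs, abs_of_pos Real.pi_pos, mul_one,
        Complex.norm_ofNat, pow_one]
      have := norm_termR_le (u := z) (τ := τ) (abs_lt.mpr hz).le n
      calc _ ≤ 2 * π * |(n : ℝ) + 1 / 2| * (2 * gaussR S τ.im n) := by gcongr
        _ = _ := by ring
  · rw [norm_mul, norm_mul, norm_neg, Complex.norm_real, Complex.norm_I, mul_one,
      Real.norm_eq_abs, abs_of_nonneg hc0]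
    have := mul_le_mul_of_nonneg_left (hg n z hz) hc0
    have : 0 ≤ 4 * π * (|(n : ℝ) + 1 / 2| ^ 1 * gaussR S τ.im n) :=
      mul_nonneg (by positivity) (mul_nonneg (by positivity) (hg0 n))
    linarith

lemma im_neg_inv (τ τ' : ℍ) (h : (τ' : ℂ) = -1 / τ) : τ'.im = τ.im / ‖(τ : ℂ)‖ ^ 2 := by
  rw [← coe_im, h, neg_div, one_div, Complex.neg_im, Complex.inv_im, Complex.normSq_eq_norm_sq,
    coe_im]
  ring

lemma dbar_exponent (τ τ' : ℍ) (h : (τ' : ℂ) = -1 / τ) (s : ℂ) :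
    Real.exp (-(2 * π * (τ * s).im ^ 2 / τ.im)) =
      Real.exp (-(2 * π * s.im ^ 2 / τ'.im)) * ‖e (s ^ 2 * τ / 2)‖ ^ 2 := by
  rw [norm_e, ← Real.exp_nat_mul, ← Real.exp_add, im_neg_inv τ τ' h, ← Complex.normSq_eq_norm_sq,
    Complex.normSq_apply]
  congr 1
  have hy := τ.im_ne_zero
  rw [← coe_im] at hy ⊢
  have h1 : (s ^ 2 * τ / 2).im =
      ((s.re ^ 2 - s.im ^ 2) * (τ : ℂ).im + 2 * s.re * s.im * (τ : ℂ).re) / 2 := by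
    rw [Complex.div_ofNat_im]
    simp only [pow_two, Complex.mul_im, Complex.mul_re]
    ring
  rw [h1, Complex.mul_im]
  rw [coe_im] at hy ⊢
  push_cast
  field_simp
  ring

/-- For $\kappa^2=-i\tau$ one has $\kappa\bar\kappa=|\tau|$, hence
$\bar\kappa=\kappa|\tau|/\kappa^2$. -/
lemma conj_cpow_half_div (τ : ℍ) : (starRingEnd ℂ) ((-I * (τ : ℂ)) ^ (1 / 2 : ℂ)) =
    (-I * (τ : ℂ)) ^ (1 / 2 : ℂ) * (I * ‖(τ : ℂ)‖ / τ) := by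
  have hτ := τ.ne_zero
  have h0 := mul_neg_I_sqrt_ne_zero τ
  have h1 : ((-I * (τ : ℂ)) ^ (1 / 2 : ℂ)) ^ 2 = -I * τ := by
    rw [one_div]; exact Complex.cpow_nat_inv_pow _ two_ne_zero
  have h2 : ‖(-I * (τ : ℂ)) ^ (1 / 2 : ℂ)‖ ^ 2 = ‖(τ : ℂ)‖ := by
    rw [← norm_pow, h1]; simp
  have h3 := Complex.mul_conj ((-I * (τ : ℂ)) ^ (1 / 2 : ℂ))
  rw [Complex.normSq_eq_norm_sq, h2] at h3
  rw [← mul_right_inj' h0, h3, ← mul_assoc, ← pow_two, h1]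
  field_simp
  linear_combination (‖(τ : ℂ)‖ : ℂ) * Complex.I_sq

lemma conj_e_eq (z : ℂ) : (starRingEnd ℂ) (e z) = ((‖e z‖ : ℝ) : ℂ) ^ 2 / e z := by
  rw [eq_div_iff (e_ne_zero z), mul_comm, Complex.mul_conj, Complex.normSq_eq_norm_sq]
  push_cast
  ring

lemma sqrt_im_div (τ : ℍ) : √(2 * (τ.im / ‖(τ : ℂ)‖ ^ 2)) / (τ.im / ‖(τ : ℂ)‖ ^ 2) =
    √(2 * τ.im) / τ.im * ‖(τ : ℂ)‖ := by
  have h1 : 0 < ‖(τ : ℂ)‖ := norm_pos_iff.mpr τ.ne_zero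
  have h2 := τ.im_ne_zero
  rw [← mul_div_assoc, Real.sqrt_div' _ (by positivity), Real.sqrt_sq h1.le]
  field_simp

/-- The failure of modularity of `R` under `τ ↦ -1/τ` is a holomorphic function. -/
lemma differentiable_zwegersR_S (τ τ' : ℍ) (h : (τ' : ℂ) = -1 / τ) : Differentiable ℂ fun w ↦
    zwegersR w τ + ((-I * τ) ^ (1 / 2 : ℂ))⁻¹ * e (w ^ 2 / (2 * τ)) * zwegersR (w / τ) τ' := by
  intro w
  have hτ := τ.ne_zero
  obtain ⟨p, hp⟩ := exists_hasWirtingerAt_zwegersR w τ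
  obtain ⟨p', hp'⟩ := exists_hasWirtingerAt_zwegersR ((τ : ℂ)⁻¹ * w) τ'
  have h1 : DifferentiableAt ℂ
      (fun w : ℂ ↦ ((-I * τ) ^ (1 / 2 : ℂ))⁻¹ * e (w ^ 2 / (2 * τ))) w := by fun_prop
  have h2 := hp.add (h1.hasDerivAt.hasWirtingerAt.mul (hp'.comp_mul (τ : ℂ)⁻¹))
  -- The total $\bar w$-derivative vanishes: `vartheta_S` makes the two conjugate theta functions
  -- proportional, and `dbar_exponent`, `sqrt_im_div` and `conj_cpow_half_div` match the Gaussian,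
  -- $\sqrt{2y}/y$ and square-root factors.
  have h3 : dbarR w τ + (0 * zwegersR ((τ : ℂ)⁻¹ * w) τ' + ((-I * τ) ^ (1 / 2 : ℂ))⁻¹ *
      e (w ^ 2 / (2 * τ)) * (dbarR ((τ : ℂ)⁻¹ * w) τ' * (starRingEnd ℂ) (τ : ℂ)⁻¹)) = 0 := by
    have hE : ((τ : ℂ)⁻¹ * w) ^ 2 * τ / 2 = w ^ 2 / (2 * τ) := by field_simp
    have hS := vartheta_S w τ τ' h
    rw [div_eq_inv_mul, ← hE] at hS
    rw [dbarR, dbarR, hS, ← hE]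
    simp only [map_mul, map_neg, Complex.conj_I]
    have hre := dbar_exponent τ τ' h ((τ : ℂ)⁻¹ * w)
    rw [mul_inv_cancel_left₀ hτ] at hre
    rw [hre, im_neg_inv τ τ' h]
    have hκ := conj_cpow_half_div τ
    have hκ0 := mul_neg_I_sqrt_ne_zero τ
    generalize (-I * (τ : ℂ)) ^ (1 / 2 : ℂ) = κ at hκ hκ0 ⊢
    have hN : (‖(τ : ℂ)‖ : ℂ) ≠ 0 := by simpa using hτ
    have hNN : (‖(τ : ℂ)‖ : ℂ) ^ 2 = τ * (starRingEnd ℂ) τ := by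
      rw [Complex.mul_conj, Complex.normSq_eq_norm_sq]; push_cast; ring
    have hcτ : (starRingEnd ℂ) (τ : ℂ) ≠ 0 := by simpa using hτ
    have hE0 := e_ne_zero (((τ : ℂ)⁻¹ * w) ^ 2 * τ / 2)
    rw [hκ, conj_e_eq, sqrt_im_div τ]
    push_cast
    have hy : ((τ.im : ℝ) : ℂ) ≠ 0 := by exact_mod_cast τ.im_ne_zero
    rw [map_inv₀]
    field_simp
    rw [Complex.I_sq, hNN]
    ring
  have h4 := (h2.congr_val rfl h3).hasDerivAt.differentiableAt
  refine h4.congr_of_eventuallyEq (Eventually.of_forall fun z ↦ ?_)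
  simp only [div_eq_inv_mul]

end EtaTheta

/-! ### The Appell sum and the inversion of the completed numerator. -/

namespace EtaTheta

open Filter Topology

/-! ### The Appell sum in the definition of `μ` -/

/-- `u` is not in the lattice `ℤ τ + ℤ`. -/
def NonLattice (u : ℂ) (τ : ℍ) : Prop := ∀ m n : ℤ, u ≠ m * τ + n

/-- The Appell sum `∑ (-1) ^ n exp(2πi n v) q ^ (n (n + 1) / 2) / (1 - exp(2πi u) q ^ n)`. -/
noncomputable def appellSum (u v : ℂ) (τ : ℍ) : ℂ :=
  ∑' n : ℤ, (-1 : ℂ) ^ n * e (n * v) * e ((n : ℂ) * (n + 1) / 2 * τ) / (1 - e u * e (n * τ))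

lemma NonLattice.one_sub_ne_zero {u : ℂ} {τ : ℍ} (hu : NonLattice u τ) (n : ℤ) :
    1 - e u * e (n * τ) ≠ 0 := by
  intro h
  rw [← e_add, sub_eq_zero, eq_comm, e_eq_one_iff] at h
  obtain ⟨m, hm⟩ := h
  exact hu (-n) m (by push_cast; linear_combination hm)

lemma exists_real_coordinates (u : ℂ) (τ : ℍ) : ∃ p r : ℝ, u = p * τ + r := by
  refine ⟨u.im / τ.im, u.re - u.im / τ.im * τ.re, ?_⟩
  have := τ.im_ne_zero
  apply Complex.ext
  · simp
  · simp [this]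

lemma not_both_int_of_nonLattice {p r : ℝ} {τ : ℍ} (h : NonLattice (p * τ + r) τ) (m n : ℤ) :
    ¬(p = m ∧ r = n) := by
  rintro ⟨rfl, rfl⟩
  exact h m n (by simp)

lemma nonLattice_of_not_both_int {p r : ℝ} (h : ∀ m n : ℤ, ¬(p = m ∧ r = n)) (τ : ℍ) :
    NonLattice (p * τ + r) τ := by
  intro m n h1
  have h2 := congrArg Complex.im h1
  simp only [Complex.add_im, Complex.im_ofReal_mul, Complex.ofReal_im, add_zero, coe_im, ← Complex.ofReal_intCast] at h2
  have h3 : p = m := mul_right_cancel₀ τ.im_ne_zero h2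
  refine h m n ⟨h3, ?_⟩
  rw [h3] at h1
  have : ((r : ℝ) : ℂ) = n := by simpa using h1
  exact_mod_cast this

lemma exists_dist_int_pos (p : ℝ) : ∃ δ > 0, ∀ n : ℤ, (n : ℝ) + p = 0 ∨ δ ≤ |(n : ℝ) + p| := by
  have h0 := Int.fract_nonneg p
  have h1 := Int.fract_lt_one p
  have hfl := Int.floor_add_fract p
  rcases h0.eq_or_lt with h | h
  · refine ⟨1, one_pos, fun n ↦ ?_⟩
    rw [← h, add_zero] at hfl
    rw [← hfl]
    by_cases hn : n + ⌊p⌋ = 0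
    · left; exact_mod_cast hn
    · right; exact_mod_cast Int.one_le_abs hn
  · refine ⟨min (Int.fract p) (1 - Int.fract p), lt_min h (by linarith), fun n ↦ Or.inr ?_⟩
    rcases le_or_gt 0 (n + ⌊p⌋) with hn | hn
    · have : (0 : ℝ) ≤ n + ⌊p⌋ := by exact_mod_cast hn
      exact (min_le_left _ _).trans (le_trans (by linarith) (le_abs_self _))
    · have : (n : ℝ) + ⌊p⌋ ≤ -1 := by exact_mod_cast (by omega : n + ⌊p⌋ ≤ -1)
      exact (min_le_right _ _).trans (le_trans (by linarith) (neg_le_abs _))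

lemma norm_e_real_mul_add (p r : ℝ) (τ : ℍ) :
    ‖e (p * τ + r)‖ = Real.exp (-(2 * π * (p * τ.im))) := by
  rw [norm_e]; simp

/-- The denominators of the Appell sum are uniformly bounded below. -/
lemma exists_le_norm_one_sub {p r : ℝ} (h : ∀ m n : ℤ, ¬(p = m ∧ r = n)) {y₀ : ℝ} (hy₀ : 0 < y₀) :
    ∃ c > 0, ∀ (n : ℤ) (τ : ℍ), y₀ ≤ τ.im → c ≤ ‖1 - e (p * τ + r) * e (n * τ)‖ := by
  obtain ⟨δ, hδ, hn⟩ := exists_dist_int_pos p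
  have hpi := Real.pi_pos
  set t := Real.exp (-(2 * π * (δ * y₀)))
  have ht : t < 1 := by
    have : 0 < 2 * π * (δ * y₀) := by positivity
    exact Real.exp_lt_one_iff.mpr (by linarith)
  have ht0 : 0 < t := Real.exp_pos _
  refine ⟨min (1 - t) (if e r = 1 then 1 else ‖1 - e r‖), ?_, fun n τ hy ↦ ?_⟩
  · refine lt_min (by linarith) ?_
    split_ifs with hr
    · exact one_pos
    · exact norm_pos_iff.mpr (sub_ne_zero.mpr (Ne.symm hr))
  rw [← e_add, show (p * τ + r + n * τ : ℂ) = ((n + p : ℝ) : ℂ) * τ + r by push_cast; ring]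
  rcases hn n with h0 | h0
  · refine (min_le_right _ _).trans ?_
    rw [h0, Complex.ofReal_zero, zero_mul, zero_add]
    split_ifs with hr
    · obtain ⟨m, hm⟩ := (e_eq_one_iff _).mp hr
      exact absurd ⟨by push_cast; linarith, by exact_mod_cast hm⟩ (h (-n) m)
    · exact le_rfl
  · refine (min_le_left _ _).trans ?_
    have hnorm := norm_e_real_mul_add (n + p) r τ
    rcases le_total 0 ((n : ℝ) + p) with h1 | h1
    · rw [abs_of_nonneg h1] at h0
      have h2 : ‖e (((n + p : ℝ) : ℂ) * τ + r)‖ ≤ t := by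
        rw [hnorm]
        refine Real.exp_le_exp.mpr ?_
        have : δ * y₀ ≤ ((n : ℝ) + p) * τ.im := by gcongr
        nlinarith
      have := norm_sub_norm_le (1 : ℂ) (e (((n + p : ℝ) : ℂ) * τ + r))
      rw [norm_one] at this
      linarith
    · rw [abs_of_nonpos h1] at h0
      have h2 : t⁻¹ ≤ ‖e (((n + p : ℝ) : ℂ) * τ + r)‖ := by
        rw [hnorm, ← Real.exp_neg]
        refine Real.exp_le_exp.mpr ?_
        have : δ * y₀ ≤ -((n : ℝ) + p) * τ.im := by gcongr; linarith
        nlinarith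
      have h3 := norm_sub_norm_le (e (((n + p : ℝ) : ℂ) * τ + r)) 1
      rw [norm_one, norm_sub_rev] at h3
      have h4 : 1 - t ≤ t⁻¹ - 1 := by
        have : t * t⁻¹ = 1 := mul_inv_cancel₀ ht0.ne'
        nlinarith [inv_pos.mpr ht0, sq_nonneg (t⁻¹ - 1), sq_nonneg (t - 1)]
      linarith

lemma NonLattice.exists_le {u : ℂ} {τ : ℍ} (hu : NonLattice u τ) :
    ∃ c > 0, ∀ n : ℤ, c ≤ ‖1 - e u * e (n * τ)‖ := by
  obtain ⟨p, r, rfl⟩ := exists_real_coordinates u τ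
  obtain ⟨c, hc, h⟩ := exists_le_norm_one_sub (not_both_int_of_nonLattice hu) τ.im_pos
  exact ⟨c, hc, fun n ↦ h n τ le_rfl⟩

lemma norm_appell_numerator (n : ℤ) (v : ℂ) (τ : ℍ) :
    ‖(-1 : ℂ) ^ n * e (n * v) * e ((n : ℂ) * (n + 1) / 2 * τ)‖ =
      Real.exp (-(2 * π * (n * v.im + n * (n + 1) / 2 * τ.im))) := by
  rw [norm_mul, norm_mul, norm_zpow, norm_neg, norm_one, one_zpow, one_mul, norm_e, norm_e,
    ← Real.exp_add,
    show ((n : ℂ) * (n + 1) / 2 * τ) = (((n : ℝ) * (n + 1) / 2 : ℝ) : ℂ) * τ by push_cast; ring,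
    show (n : ℂ) * v = ((n : ℝ) : ℂ) * v by push_cast; ring,
    Complex.im_ofReal_mul, Complex.im_ofReal_mul, coe_im]
  ring_nf

lemma norm_appell_numerator_le (n : ℤ) {v : ℂ} {τ : ℍ} {S : ℝ} (hv : |v.im| ≤ S) :
    ‖(-1 : ℂ) ^ n * e (n * v) * e ((n : ℂ) * (n + 1) / 2 * τ)‖ ≤
      Real.exp (-π * (τ.im * (n : ℝ) ^ 2 - 2 * (S + τ.im / 2) * |(n : ℝ)|)) := by
  rw [norm_appell_numerator]
  refine Real.exp_le_exp.mpr ?_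
  have hy := τ.im_pos
  have h1 : -((n : ℝ) * v.im) ≤ |(n : ℝ)| * S := by
    refine (neg_le_abs _).trans ?_
    rw [abs_mul]
    gcongr
  have h2 : -((n : ℝ) * τ.im) ≤ |(n : ℝ)| * τ.im := by
    nlinarith [neg_le_abs (n : ℝ)]
  have h3 := mul_le_mul_of_nonneg_left h1 Real.two_pi_pos.le
  have h4 := mul_le_mul_of_nonneg_left h2 Real.pi_pos.le
  nlinarith

lemma summable_appell_bound {S : ℝ} (hS : 0 ≤ S) (τ : ℍ) :
    Summable fun n : ℤ ↦ Real.exp (-π * (τ.im * (n : ℝ) ^ 2 - 2 * (S + τ.im / 2) * |(n : ℝ)|)) := by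
  have := summable_gauss_shift 0 (S := S + τ.im / 2) (by have := τ.im_pos; positivity) τ.im_pos 0
  simpa using this

lemma NonLattice.norm_appell_term_le {u : ℂ} {τ : ℍ} {c : ℝ} (hc : 0 < c)
    (h : ∀ n : ℤ, c ≤ ‖1 - e u * e (n * τ)‖) {v : ℂ} {S : ℝ} (hv : |v.im| ≤ S) (n : ℤ) :
    ‖(-1 : ℂ) ^ n * e (n * v) * e ((n : ℂ) * (n + 1) / 2 * τ) / (1 - e u * e (n * τ))‖ ≤
      Real.exp (-π * (τ.im * (n : ℝ) ^ 2 - 2 * (S + τ.im / 2) * |(n : ℝ)|)) / c := by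
  rw [norm_div]
  exact div_le_div₀ (Real.exp_pos _).le (norm_appell_numerator_le n hv) hc (h n)

lemma NonLattice.summable_appell {u : ℂ} {τ : ℍ} (hu : NonLattice u τ) (v : ℂ) :
    Summable fun n : ℤ ↦
      (-1 : ℂ) ^ n * e (n * v) * e ((n : ℂ) * (n + 1) / 2 * τ) / (1 - e u * e (n * τ)) := by
  obtain ⟨c, hc, h⟩ := hu.exists_le
  exact Summable.of_norm_bounded ((summable_appell_bound (abs_nonneg v.im) τ).div_const c)
    (NonLattice.norm_appell_term_le hc h le_rfl)

lemma NonLattice.differentiable_appellSum {u : ℂ} {τ : ℍ} (hu : NonLattice u τ) :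
    Differentiable ℂ fun v ↦ appellSum u v τ := by
  intro v
  obtain ⟨c, hc, h⟩ := hu.exists_le
  set S := |v.im| + 1
  let s : Set ℂ := Complex.im ⁻¹' Set.Ioo (-S) S
  have hs : IsOpen s := isOpen_Ioo.preimage Complex.continuous_im
  have hvs : v ∈ s := ⟨by linarith [neg_abs_le v.im], by linarith [le_abs_self v.im]⟩
  have := Complex.differentiableOn_tsum_of_summable_norm
    (F := fun (n : ℤ) (v : ℂ) ↦
      (-1 : ℂ) ^ n * e (n * v) * e ((n : ℂ) * (n + 1) / 2 * τ) / (1 - e u * e (n * τ)))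
    (U := s) ((summable_appell_bound (S := S) (by positivity) τ).div_const c)
    (fun n ↦ by fun_prop) hs
    (fun n w hw ↦ NonLattice.norm_appell_term_le hc h (abs_lt.mpr hw).le n)
  exact this.differentiableAt (hs.mem_nhds hvs)

lemma appellSum_add_one (u v : ℂ) (τ : ℍ) : appellSum u (v + 1) τ = appellSum u v τ := by
  refine tsum_congr fun n ↦ ?_
  rw [mul_add, mul_one, e_add_int]

/-- With $x=e(u)$, $q^n/(1-xq^n)=x^{-1}\bigl(1/(1-xq^n)-1\bigr)$. The $-1$ sums to a theta series,
the defect that $R$ must compensate. -/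
lemma NonLattice.appellSum_add_tau {u : ℂ} {τ : ℍ} (hu : NonLattice u τ) (v : ℂ) :
    appellSum u (v + τ) τ =
      (e u)⁻¹ * (appellSum u v τ + I * e (-v / 2 - τ / 8) * vartheta v τ) := by
  have h := ((hu.summable_appell v).hasSum.sub (hasSum_vartheta v τ)).mul_left (e u)⁻¹
  rw [← appellSum] at h
  rw [appellSum, show appellSum u v τ + I * e (-v / 2 - τ / 8) * vartheta v τ =
    appellSum u v τ - -I * e (-v / 2 - τ / 8) * vartheta v τ by ring, ← h.tsum_eq]
  refine tsum_congr fun n ↦ ?_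
  have h1 := hu.one_sub_ne_zero n
  have h2 := e_ne_zero u
  rw [mul_add, e_add]
  generalize e u = x at *
  generalize e (n * τ) = Q at *
  have h3 : Q / (1 - x * Q) = x⁻¹ * (1 / (1 - x * Q) - 1) := by
    rw [eq_inv_mul_iff_mul_eq₀ h2, ← mul_div_assoc, eq_sub_iff_add_eq, div_add_one h1]
    ring
  rw [← mul_assoc, mul_right_comm _ Q, mul_div_assoc, h3]
  ring

/-! ### The completed numerator of `μ` -/

/-- The function `ϑ(v) μ̂(u, v)`, which is entire up to a Gaussian correction in `v`. -/
noncomputable def muNumerator (u v : ℂ) (τ : ℍ) : ℂ :=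
  e (u / 2) * appellSum u v τ + I / 2 * vartheta v τ * zwegersR (u - v) τ

lemma muHat_eq {u v : ℂ} {τ : ℍ} (hv : NonLattice v τ) :
    muHat u v τ = muNumerator u v τ / vartheta v τ := by
  have := vartheta_ne_zero hv
  rw [muHat, mu, muNumerator, ← appellSum]
  field_simp

lemma muNumerator_add_one (u v : ℂ) (τ : ℍ) : muNumerator u (v + 1) τ = muNumerator u v τ := by
  have h := zwegersR_add_one (u - (v + 1)) τ
  rw [show u - (v + 1) + 1 = u - v by ring] at h
  rw [muNumerator, muNumerator, appellSum_add_one, vartheta_add_one, h]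
  ring

lemma zwegersR_sub_tau (w : ℂ) (τ : ℍ) :
    zwegersR (w - τ) τ = -e (-w + τ / 2) * (zwegersR w τ - 2 * e (w / 2 - τ / 8)) := by
  have h := zwegersR_add_tau (w - τ) τ
  have h1 : e (-w + τ / 2) = (e (w - τ + τ / 2))⁻¹ := by rw [← e_neg]; congr 1; ring
  rw [sub_add_cancel, show (w - τ) / 2 + 3 * (τ : ℂ) / 8 = w / 2 - τ / 8 by ring] at h
  rw [h, h1]
  have := e_ne_zero (w - τ + τ / 2)
  field_simp
  ring

/-- The coefficient $i/2$ in $\widehat\mu$ is exactly what cancels the theta defect of the Appell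
sum against the inhomogeneous term of $R$. -/
lemma NonLattice.muNumerator_add_tau {u : ℂ} {τ : ℍ} (hu : NonLattice u τ) (v : ℂ) :
    muNumerator u (v + τ) τ = e (-u) * muNumerator u v τ := by
  have h1 : e (-u) = e (-τ / 2 - v) * e (-(u - v) + τ / 2) := by rw [← e_add]; congr 1; ring
  have h2 : e (u / 2) * e (-v / 2 - τ / 8) = e ((u - v) / 2 - τ / 8) := by
    rw [← e_add]; congr 1; ring
  rw [muNumerator, muNumerator, hu.appellSum_add_tau, vartheta_add_tau, ← sub_sub,
    zwegersR_sub_tau, ← e_neg]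
  linear_combination (e (-u) * I * vartheta v τ) * h2 - (I / 2 * vartheta v τ *
    (zwegersR (u - v) τ - 2 * e ((u - v) / 2 - τ / 8))) * h1

/-! ### Liouville's theorem for quasi-periodic functions -/

lemma bounded_of_norm_periodic {g : ℂ → ℂ} (hg : Continuous g) (τ : ℍ)
    (h1 : ∀ v, ‖g (v + 1)‖ = ‖g v‖) (h2 : ∀ v, ‖g (v + τ)‖ = ‖g v‖) :
    ∃ C, ∀ v, ‖g v‖ ≤ C := by
  have h1' : ∀ (n : ℤ) v, ‖g (v + n)‖ = ‖g v‖ := by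
    intro n
    induction n with
    | zero => simp
    | succ n ih => intro v; push_cast at ih ⊢; rw [← add_assoc, h1, ih]
    | pred n ih => intro v; rw [← h1, ← ih v]; congr 2; push_cast; ring
  have h2' : ∀ (n : ℤ) v, ‖g (v + n * τ)‖ = ‖g v‖ := by
    intro n
    induction n with
    | zero => simp
    | succ n ih =>
      intro v; push_cast at ih ⊢; rw [add_mul, one_mul, ← add_assoc, h2, ih]
    | pred n ih => intro v; rw [← h2, ← ih v]; congr 2; push_cast; ring
  have hK : IsCompact ((fun t : ℝ × ℝ ↦ (t.1 * τ + t.2 : ℂ)) '' (Set.Icc 0 1 ×ˢ Set.Icc 0 1)) :=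
    (isCompact_Icc.prod isCompact_Icc).image (by fun_prop)
  obtain ⟨C, hC⟩ := hK.exists_bound_of_continuousOn hg.continuousOn
  refine ⟨C, fun v ↦ ?_⟩
  obtain ⟨p, r, rfl⟩ := exists_real_coordinates v τ
  have : (p * τ + r : ℂ) = ((Int.fract p : ℝ) * τ + (Int.fract r : ℝ)) + ⌊p⌋ * τ + ⌊r⌋ := by
    conv_lhs => rw [← Int.floor_add_fract p, ← Int.floor_add_fract r]
    push_cast
    ring
  rw [this, h1', h2']
  exact hC _ ⟨(Int.fract p, Int.fract r), ⟨⟨Int.fract_nonneg _, (Int.fract_lt_one _).le⟩,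
    ⟨Int.fract_nonneg _, (Int.fract_lt_one _).le⟩⟩, rfl⟩

/-- With $u=p\tau+r$, the function $e(pv)M(v)$ has the unimodular multipliers $e(p)$ and $e(-r)$, so
it is bounded and constant. If it were nonzero, both multipliers would be $1$ and $u$ would be a
lattice point. -/
lemma NonLattice.eq_zero_of_quasiperiodic {u : ℂ} {τ : ℍ} (hu : NonLattice u τ) {M : ℂ → ℂ}
    (hM : Differentiable ℂ M) (h1 : ∀ v, M (v + 1) = M v) (h2 : ∀ v, M (v + τ) = e (-u) * M v)
    (v : ℂ) : M v = 0 := by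
  obtain ⟨p, r, rfl⟩ := exists_real_coordinates u τ
  let g : ℂ → ℂ := fun v ↦ e (p * v) * M v
  have hg : Differentiable ℂ g := by fun_prop
  have g1 : ∀ v, g (v + 1) = e p * g v := by
    intro v
    simp only [g, h1, mul_add, e_add, mul_one]
    ring
  have g2 : ∀ v, g (v + τ) = e (-r) * g v := by
    intro v
    simp only [g, h2, ← mul_assoc, ← e_add]
    congr 2
    ring
  obtain ⟨C, hC⟩ := bounded_of_norm_periodic hg.continuous τ
    (fun v ↦ by rw [g1, norm_mul, norm_e_ofReal, one_mul])
    (fun v ↦ by rw [g2, norm_mul, ← Complex.ofReal_neg, norm_e_ofReal, one_mul])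
  have hconst := hg.apply_eq_apply_of_bounded (isBounded_iff_forall_norm_le.mpr
    ⟨C, by rintro _ ⟨v, rfl⟩; exact hC v⟩)
  have hg0 : g v = 0 := by
    by_contra hne
    have k1 := g1 v
    have k2 := g2 v
    rw [hconst (v + 1) v, eq_comm, mul_eq_right₀ hne, e_eq_one_iff] at k1
    rw [hconst (v + τ) v, eq_comm, mul_eq_right₀ hne, e_eq_one_iff] at k2
    obtain ⟨m, hm⟩ := k1
    obtain ⟨n, hn⟩ := k2
    exact hu m (-n) (by rw [hm]; push_cast; linear_combination -hn)
  exact (mul_eq_zero.mp hg0).resolve_left (e_ne_zero _)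

/-! ### The transformation `τ ↦ -1/τ` -/

lemma NonLattice.div_tau {u : ℂ} {τ τ' : ℍ} (h : (τ' : ℂ) = -1 / τ) (hu : NonLattice u τ) :
    NonLattice (u / τ) τ' := by
  intro m n h1
  have hτ := τ.ne_zero
  refine hu n (-m) ?_
  rw [h, div_eq_iff hτ] at h1
  rw [h1]
  field_simp
  push_cast
  ring

/-- As functions of $v$ both sides have the same quasi-periods, inversion exchanging the roles of
$1$ and $\tau$. Their difference is entire, so it vanishes, and the inversion defect of $R$ never
has to be computed. -/
lemma NonLattice.muNumerator_S {u : ℂ} {τ τ' : ℍ} (h : (τ' : ℂ) = -1 / τ) (hu : NonLattice u τ)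
    (v : ℂ) : muNumerator u v τ =
      1 / τ * e (u ^ 2 / (2 * τ) - u * v / τ) * muNumerator (u / τ) (v / τ) τ' := by
  have hτ := τ.ne_zero
  have hu' := hu.div_tau h
  let M : ℂ → ℂ := fun v ↦ muNumerator u v τ -
    1 / τ * e (u ^ 2 / (2 * τ) - u * v / τ) * muNumerator (u / τ) (v / τ) τ'
  suffices H : M v = 0 from sub_eq_zero.mp H
  refine hu.eq_zero_of_quasiperiodic ?_ (fun v ↦ ?_) (fun v ↦ ?_) v
  · have e1 : ∀ v, M v = e (u / 2) * appellSum u v τ - 1 / τ * e (u ^ 2 / (2 * τ) - u * v / τ) *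
        (e (u / τ / 2) * appellSum (u / τ) (v / τ) τ') + I / 2 * vartheta v τ *
        (zwegersR (u - v) τ + ((-I * τ) ^ (1 / 2 : ℂ))⁻¹ * e ((u - v) ^ 2 / (2 * τ)) *
          zwegersR ((u - v) / τ) τ') := by
      intro v
      simp only [M, muNumerator]
      rw [vartheta_S v τ τ' h, sub_div]
      have h1 : e (u ^ 2 / (2 * τ) - u * v / τ) * e (v ^ 2 / (2 * τ)) =
          e ((u - v) ^ 2 / (2 * τ)) := by
        rw [← e_add]; congr 1; field_simp; ring
      have h2 : ((-I * (τ : ℂ)) ^ (1 / 2 : ℂ)) ^ 2 = -I * τ := by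
        rw [one_div]; exact Complex.cpow_nat_inv_pow _ two_ne_zero
      have h3 := mul_neg_I_sqrt_ne_zero τ
      rw [← h1]
      generalize (-I * (τ : ℂ)) ^ (1 / 2 : ℂ) = κ at h2 h3 ⊢
      have h4 : κ / τ = -I * κ⁻¹ := by
        field_simp
        rw [h2]
        ring
      linear_combination (I * I / 2 * e (u ^ 2 / (2 * τ) - u * v / τ) * e (v ^ 2 / (2 * τ)) *
        vartheta v τ * zwegersR (u / τ - v / τ) τ') * h4 - (I / 2 * κ⁻¹ *
        e (u ^ 2 / (2 * τ) - u * v / τ) * e (v ^ 2 / (2 * τ)) *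
        vartheta v τ * zwegersR (u / τ - v / τ) τ') * Complex.I_mul_I
    have e2 : M = _ := funext e1
    rw [e2]
    have d1 := hu.differentiable_appellSum
    have d2 : Differentiable ℂ fun v : ℂ ↦ appellSum (u / τ) (v / τ) τ' :=
      hu'.differentiable_appellSum.comp (by fun_prop : Differentiable ℂ fun v : ℂ ↦ v / τ)
    have d3 := differentiable_vartheta τ
    have d4 := (differentiable_zwegersR_S τ τ' h).comp
      (by fun_prop : Differentiable ℂ fun v : ℂ ↦ u - v)
    exact ((d1.const_mul _).sub (((by fun_prop : Differentiable ℂ fun v : ℂ ↦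
      1 / (τ : ℂ) * e (u ^ 2 / (2 * τ) - u * v / τ))).mul (d2.const_mul _))).add
      ((d3.const_mul _).mul d4)
  · simp only [M]
    rw [muNumerator_add_one]
    congr 1
    have h1 := hu'.muNumerator_add_tau ((v + 1) / τ)
    rw [show (v + 1) / τ + τ' = v / τ by rw [h]; field_simp; ring] at h1
    rw [h1, ← mul_assoc, mul_assoc (1 / (τ : ℂ)) (e _) (e _), ← e_add]
    congr 3
    field_simp
    ring
  · simp only [M]
    rw [hu.muNumerator_add_tau, add_div, div_self hτ, muNumerator_add_one,
      show u ^ 2 / (2 * τ) - u * (v + τ) / (τ : ℂ) = -u + (u ^ 2 / (2 * τ) - u * v / τ) by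
        field_simp; ring, e_add]
    ring

end EtaTheta

/-! ### Automorphy factors, the eta multiplier and the transformation laws of $\widehat\mu$. -/

namespace EtaTheta

open Filter Topology

/-! ### The automorphy factor -/

lemma autFactor_eq_denom (γ : SL(2, ℤ)) (τ : ℍ) : autFactor γ τ = denom γ τ := by
  rw [autFactor, ModularGroup.denom_apply]

lemma autFactor_ne_zero (γ : SL(2, ℤ)) (τ : ℍ) : autFactor γ τ ≠ 0 := by
  rw [autFactor_eq_denom]
  exact denom_ne_zero _ _

lemma coe_smul_eq (γ : SL(2, ℤ)) (τ : ℍ) :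
    ((γ • τ : ℍ) : ℂ) = ((γ 0 0 : ℂ) * τ + (γ 0 1 : ℂ)) / autFactor γ τ := by
  rw [UpperHalfPlane.specialLinearGroup_apply]
  simp [autFactor]

lemma coe_smul_mul_autFactor (γ : SL(2, ℤ)) (τ : ℍ) :
    ((γ • τ : ℍ) : ℂ) * autFactor γ τ = (γ 0 0 : ℂ) * τ + (γ 0 1 : ℂ) := by
  rw [coe_smul_eq, div_mul_cancel₀ _ (autFactor_ne_zero γ τ)]

lemma det_eq_one_int (γ : SL(2, ℤ)) : γ 0 0 * γ 1 1 - γ 0 1 * γ 1 0 = 1 := by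
  have := γ.det_coe
  rwa [Matrix.det_fin_two] at this

lemma det_eq_one (γ : SL(2, ℤ)) :
    (γ 0 0 : ℂ) * (γ 1 1 : ℂ) - (γ 0 1 : ℂ) * (γ 1 0 : ℂ) = 1 := by
  exact_mod_cast det_eq_one_int γ

lemma mul_apply_one_zero (γ δ : SL(2, ℤ)) :
    (γ * δ) 1 0 = γ 1 0 * δ 0 0 + γ 1 1 * δ 1 0 := by
  simp [Matrix.SpecialLinearGroup.coe_mul, Matrix.mul_apply, Fin.sum_univ_two]

lemma mul_apply_one_one (γ δ : SL(2, ℤ)) :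
    (γ * δ) 1 1 = γ 1 0 * δ 0 1 + γ 1 1 * δ 1 1 := by
  simp [Matrix.SpecialLinearGroup.coe_mul, Matrix.mul_apply, Fin.sum_univ_two]

lemma autFactor_mul (γ δ : SL(2, ℤ)) (τ : ℍ) :
    autFactor (γ * δ) τ = autFactor γ (δ • τ) * autFactor δ τ := by
  rw [autFactor, autFactor, mul_apply_one_zero, mul_apply_one_one, add_mul, mul_assoc (γ 1 0 : ℂ),
    coe_smul_mul_autFactor, autFactor]
  push_cast
  ring

lemma autFactor_one (τ : ℍ) : autFactor 1 τ = 1 := by simp [autFactor]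

/-- Divided by $j_{\gamma\delta}\,j_\delta$, this is the cocycle law for $c/(c\tau+d)$, the
coefficient of the quadratic exponent in the law of $\widehat\mu$. -/
lemma mul_apply_one_zero_mul_autFactor (γ δ : SL(2, ℤ)) (τ : ℍ) :
    ((γ * δ) 1 0 : ℂ) * autFactor δ τ = γ 1 0 + δ 1 0 * autFactor (γ * δ) τ := by
  rw [autFactor, autFactor, mul_apply_one_zero, mul_apply_one_one]
  push_cast
  linear_combination (γ 1 0 : ℂ) * det_eq_one δ

lemma NonLattice.div_autFactor {u : ℂ} {τ : ℍ} (hu : NonLattice u τ) (γ : SL(2, ℤ)) :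
    NonLattice (u / autFactor γ τ) (γ • τ) := by
  intro m n h
  refine hu (m * γ 0 0 + n * γ 1 0) (m * γ 0 1 + n * γ 1 1) ?_
  rw [div_eq_iff (autFactor_ne_zero γ τ), add_mul, mul_assoc, coe_smul_mul_autFactor] at h
  rw [h, autFactor]
  push_cast
  ring

lemma continuous_smul_SL (γ : SL(2, ℤ)) : Continuous fun τ : ℍ ↦ γ • τ := by
  rw [UpperHalfPlane.isEmbedding_coe.continuous_iff]
  have : (UpperHalfPlane.coe ∘ fun τ : ℍ ↦ γ • τ) =
      fun τ : ℍ ↦ ((γ 0 0 : ℂ) * τ + (γ 0 1 : ℂ)) / autFactor γ τ := funext fun τ ↦ coe_smul_eq γ τ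
  rw [this]
  refine Continuous.div (by fun_prop) ?_ (autFactor_ne_zero γ)
  unfold autFactor
  fun_prop

/-- For $c\ne0$ the number $c\tau+d$ is never real and avoids the branch cut; for $c=0$ it is
constant. -/
lemma continuous_autFactor_cpow (γ : SL(2, ℤ)) (s : ℂ) :
    Continuous fun τ : ℍ ↦ autFactor γ τ ^ s := by
  by_cases hc : γ 1 0 = 0
  · simp only [autFactor, hc, Int.cast_zero, zero_mul, zero_add]
    exact continuous_const
  · have h : Continuous fun τ : ℍ ↦ autFactor γ τ := by
      unfold autFactor
      fun_prop
    refine h.cpow continuous_const fun τ ↦ Or.inr ?_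
    have : (autFactor γ τ).im = γ 1 0 * τ.im := by simp [autFactor]
    rw [this]
    exact mul_ne_zero (by exact_mod_cast hc) τ.im_ne_zero

lemma cpow_half_sq (z : ℂ) : (z ^ (1 / 2 : ℂ)) ^ 2 = z := by
  rw [one_div]
  exact Complex.cpow_nat_inv_pow _ two_ne_zero

/-! ### The eta multiplier -/

open ModularForm (eta)

lemma eta_coe_ne_zero (τ : ℍ) : eta τ ≠ 0 := ModularForm.eta_ne_zero τ.2

lemma cpow_half_neg_I_mul (τ : ℍ) :
    (-I * (τ : ℂ)) ^ (1 / 2 : ℂ) = (Complex.sqrt I)⁻¹ * Complex.sqrt τ := by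
  have hτ := τ.ne_zero
  have h : Complex.log (-I * τ) = Complex.log (-I) + Complex.log τ := by
    refine Complex.log_mul (by simp) hτ ?_
    have h1 : 0 ≤ (τ : ℂ).arg := Complex.arg_nonneg_iff.mpr τ.im_pos.le
    have h2 := Complex.arg_le_pi (τ : ℂ)
    rw [Complex.arg_neg_I]
    constructor <;> linarith [Real.pi_pos]
  rw [Complex.cpow_def_of_ne_zero (by simp [hτ]), h, _root_.sqrt_eq_exp Complex.I_ne_zero,
    _root_.sqrt_eq_exp hτ, ← Complex.exp_neg, ← Complex.exp_add, Complex.log_neg_I,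
    Complex.log_I]
  congr 1
  ring

lemma eta_S {τ τ' : ℍ} (h : (τ' : ℂ) = -1 / τ) :
    eta τ' = (-I * (τ : ℂ)) ^ (1 / 2 : ℂ) * eta τ := by
  have := ModularForm.eta_comp_eq_csqrt_I_inv τ.2
  simp only [Function.comp_apply, Pi.smul_apply, Pi.mul_apply, smul_eq_mul] at this
  rw [h, cpow_half_neg_I_mul, mul_assoc]
  exact this

lemma eta_add_one (z : ℂ) : eta (z + 1) = e (1 / 24) * eta z := by
  have h1 : ∀ n, ModularForm.eta_q n (z + 1) = ModularForm.eta_q n z := by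
    intro n
    simp only [ModularForm.eta_q_eq_pow]
    congr 1
    rw [mul_add, Complex.exp_add, mul_one, Complex.exp_two_pi_mul_I, mul_one]
  simp only [eta, h1]
  rw [← mul_assoc]
  congr 1
  rw [Function.Periodic.qParam, Function.Periodic.qParam, e, ← Complex.exp_add]
  congr 1
  push_cast
  ring

lemma eta_smul_pow (γ : SL(2, ℤ)) (τ : ℍ) :
    eta ((γ • τ : ℍ) : ℂ) ^ 24 = autFactor γ τ ^ 12 * eta τ ^ 24 := by
  have h := congrFun (SlashInvariantForm.slash_action_generators_SL2Z ModularForm.discriminant_S_invariant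
    ModularForm.discriminant_T_invariant γ) τ
  have hj := autFactor_ne_zero γ τ
  rw [ModularForm.SL_slash_apply, ← autFactor_eq_denom, zpow_neg, show (12 : ℤ) = (12 : ℕ) from rfl,
    zpow_natCast, ← div_eq_mul_inv, div_eq_iff (pow_ne_zero _ hj)] at h
  rw [mul_comm]
  exact h

lemma continuous_eta : Continuous fun τ : ℍ ↦ eta τ :=
  continuous_iff_continuousAt.mpr fun τ ↦
    (ModularForm.differentiableAt_eta_of_mem_upperHalfPlaneSet τ.2).continuousAt.comp
      UpperHalfPlane.continuous_coe.continuousAt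

lemma etaQuotient_pow (γ : SL(2, ℤ)) (τ : ℍ) :
    (eta ((γ • τ : ℍ) : ℂ) / (autFactor γ τ ^ (1 / 2 : ℂ) * eta τ)) ^ 24 = 1 := by
  have h : (autFactor γ τ ^ (1 / 2 : ℂ)) ^ 24 = autFactor γ τ ^ 12 := by
    rw [show 24 = 2 * 12 from rfl, pow_mul, cpow_half_sq]
  rw [div_pow, mul_pow, h, eta_smul_pow]
  exact div_self (mul_ne_zero (pow_ne_zero _ (autFactor_ne_zero γ τ))
    (pow_ne_zero _ (eta_coe_ne_zero τ)))

lemma autFactor_cpow_half_ne_zero (γ : SL(2, ℤ)) (τ : ℍ) : autFactor γ τ ^ (1 / 2 : ℂ) ≠ 0 := by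
  intro h
  have := cpow_half_sq (autFactor γ τ)
  rw [h] at this
  exact autFactor_ne_zero γ τ (by simpa using this.symm)

/-- The quotient is continuous on the connected half plane with values in the $24$th roots of unity,
by the modularity of $\eta^{24}$. It is therefore constant and may be evaluated at $i$. -/
lemma eta_smul (γ : SL(2, ℤ)) (τ : ℍ) :
    eta ((γ • τ : ℍ) : ℂ) = etaMultiplier γ * autFactor γ τ ^ (1 / 2 : ℂ) * eta τ := by
  let f : ℍ → ℂ := fun τ ↦ eta ((γ • τ : ℍ) : ℂ) / (autFactor γ τ ^ (1 / 2 : ℂ) * eta τ)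
  have hne : ∀ τ : ℍ, autFactor γ τ ^ (1 / 2 : ℂ) * eta τ ≠ 0 := fun τ ↦
    mul_ne_zero (autFactor_cpow_half_ne_zero γ τ) (eta_coe_ne_zero τ)
  have hf : Continuous f := (continuous_eta.comp (continuous_smul_SL γ)).div
    ((continuous_autFactor_cpow γ _).mul continuous_eta) hne
  have hfin : {z : ℂ | z ^ 24 = 1}.Finite := by
    have := (Polynomial.nthRootsFinset 24 (1 : ℂ)).finite_toSet
    refine this.subset fun z hz ↦ ?_
    rw [Finset.mem_coe, Polynomial.mem_nthRootsFinset (by norm_num)]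
    exact hz
  have := isPreconnected_univ.constant_of_mapsTo hfin.isDiscrete (f := f) hf.continuousOn
    (fun τ _ ↦ etaQuotient_pow γ τ) (Set.mem_univ τ) (Set.mem_univ UpperHalfPlane.I)
  rw [mul_assoc, ← div_eq_iff (hne τ)]
  exact this

lemma etaMultiplier_pow (γ : SL(2, ℤ)) : etaMultiplier γ ^ 24 = 1 :=
  etaQuotient_pow γ UpperHalfPlane.I

lemma norm_etaMultiplier (γ : SL(2, ℤ)) : ‖etaMultiplier γ‖ = 1 :=
  Complex.norm_eq_one_of_pow_eq_one (etaMultiplier_pow γ) (by norm_num)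

lemma etaMultiplier_ne_zero (γ : SL(2, ℤ)) : etaMultiplier γ ≠ 0 :=
  norm_ne_zero_iff.mp (by rw [norm_etaMultiplier]; exact one_ne_zero)

/-! ### Modular transformation of `μ̂` -/

lemma mu_T (u v : ℂ) {τ τ' : ℍ} (h : (τ' : ℂ) = τ + 1) :
    mu u v τ' = e (-(1 / 8)) * mu u v τ := by
  rw [mu, mu, vartheta_T v τ τ' h]
  have : ∀ n : ℤ, (-1 : ℂ) ^ n * e (n * v) * e ((n : ℂ) * (n + 1) / 2 * τ') /
      (1 - e u * e (n * τ')) = (-1 : ℂ) ^ n * e (n * v) * e ((n : ℂ) * (n + 1) / 2 * τ) /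
      (1 - e u * e (n * τ)) := by
    intro n
    obtain ⟨k, hk⟩ := Int.even_mul_succ_self n
    have hk' : (n : ℂ) * (n + 1) = k + k := by exact_mod_cast hk
    rw [h, hk', mul_add (n : ℂ), mul_one, e_add_int,
      show ((k : ℂ) + k) / 2 * (τ + 1) = (k + k) / 2 * τ + k by ring, e_add_int]
  rw [tsum_congr this, e_neg, div_mul_eq_div_div_swap]
  ring

lemma muHat_T (u v : ℂ) {τ τ' : ℍ} (h : (τ' : ℂ) = τ + 1) :
    muHat u v τ' = e (-(1 / 8)) * muHat u v τ := by
  rw [muHat, muHat, mu_T u v h, zwegersR_T _ τ τ' h]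
  ring

lemma NonLattice.muHat_S {u v : ℂ} {τ τ' : ℍ} (h : (τ' : ℂ) = -1 / τ) (hu : NonLattice u τ)
    (hv : NonLattice v τ) : muHat (u / τ) (v / τ) τ' * (-I * (τ : ℂ)) ^ (1 / 2 : ℂ) =
      I * τ * e (-(u - v) ^ 2 / (2 * τ)) * muHat u v τ := by
  have hτ := τ.ne_zero
  have hκ := mul_neg_I_sqrt_ne_zero τ
  have hϑ := vartheta_ne_zero hv
  rw [muHat_eq hv, muHat_eq (hv.div_tau h), vartheta_S v τ τ' h, hu.muNumerator_S h]
  have h1 : e (-(u - v) ^ 2 / (2 * τ)) * e (u ^ 2 / (2 * τ) - u * v / τ) =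
      (e (v ^ 2 / (2 * τ)))⁻¹ := by
    rw [← e_add, ← e_neg]; congr 1; field_simp; ring
  have h2 := e_ne_zero (v ^ 2 / (2 * τ))
  generalize (-I * (τ : ℂ)) ^ (1 / 2 : ℂ) = κ at *
  generalize muNumerator (u / τ) (v / τ) τ' = N
  rw [show I * τ * e (-(u - v) ^ 2 / (2 * τ)) * (1 / τ * e (u ^ 2 / (2 * τ) - u * v / τ) * N /
    vartheta v τ) = I * τ * (1 / τ) * N / vartheta v τ * (e (-(u - v) ^ 2 / (2 * τ)) *
      e (u ^ 2 / (2 * τ) - u * v / τ)) by ring, h1]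
  field_simp
  linear_combination -N * Complex.I_sq

/-- Compatibility of the completed Appell function with a modular transformation. -/
def MuHatTransforms (γ : SL(2, ℤ)) : Prop := ∀ (u v : ℂ) (τ : ℍ), NonLattice u τ →
  NonLattice v τ → muHat (u / autFactor γ τ) (v / autFactor γ τ) (γ • τ) * eta (γ • τ : ℍ) ^ 3 =
    autFactor γ τ ^ 2 * e (-(γ 1 0 : ℂ) * (u - v) ^ 2 / (2 * autFactor γ τ)) *
      (muHat u v τ * eta τ ^ 3)

lemma muHatTransforms_T : MuHatTransforms ModularGroup.T := by
  intro u v τ _ _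
  have h1 : autFactor ModularGroup.T τ = 1 := by simp [autFactor, ModularGroup.T]
  have h2 : ((ModularGroup.T • τ : ℍ) : ℂ) = τ + 1 := by
    rw [coe_smul_eq, h1]; simp [ModularGroup.T]
  have h3 : e (-(1 / 8)) * e (1 / 24) ^ 3 = 1 := by
    rw [← e_nat_mul, ← e_add, ← e_zero]; congr 1; push_cast; ring
  rw [h1, div_one, div_one, muHat_T u v h2, h2, eta_add_one,
    show (ModularGroup.T 1 0 : ℤ) = 0 from rfl]
  simp only [Int.cast_zero, neg_zero, zero_mul, zero_div, e_zero]
  linear_combination muHat u v τ * eta τ ^ 3 * h3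

lemma muHatTransforms_S : MuHatTransforms ModularGroup.S := by
  intro u v τ hu hv
  have h1 : autFactor ModularGroup.S τ = τ := by simp [autFactor, ModularGroup.S]
  have h2 : ((ModularGroup.S • τ : ℍ) : ℂ) = -1 / τ := by
    rw [coe_smul_eq, h1]; simp [ModularGroup.S]
  have h3 := NonLattice.muHat_S h2 hu hv
  have h4 := cpow_half_sq (-I * τ)
  rw [h1, eta_S h2, show (ModularGroup.S 1 0 : ℤ) = 1 from rfl]
  push_cast
  rw [neg_one_mul]
  generalize (-I * (τ : ℂ)) ^ (1 / 2 : ℂ) = κ at *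
  linear_combination κ ^ 2 * eta τ ^ 3 * h3 + I * τ * e (-(u - v) ^ 2 / (2 * τ)) *
    muHat u v τ * eta τ ^ 3 * h4 - τ ^ 2 * e (-(u - v) ^ 2 / (2 * τ)) *
    muHat u v τ * eta τ ^ 3 * Complex.I_sq

/-- Multiplied by $\eta^3$, $\widehat\mu$ has weight $2$ and trivial multiplier. Composition then
needs only the cocycle law of $c/(c\tau+d)$, with no branches and no roots of unity. -/
lemma MuHatTransforms.mul {γ δ : SL(2, ℤ)} (hγ : MuHatTransforms γ) (hδ : MuHatTransforms δ) :
    MuHatTransforms (γ * δ) := by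
  intro u v τ hu hv
  have h1 := hγ _ _ _ (hu.div_autFactor δ) (hv.div_autFactor δ)
  have hj := autFactor_ne_zero δ τ
  have hj' := autFactor_ne_zero γ (δ • τ)
  have hc := mul_apply_one_zero_mul_autFactor γ δ τ
  rw [hδ u v τ hu hv, div_div, div_div, mul_comm (autFactor δ τ), ← autFactor_mul, smul_smul,
    ← sub_div] at h1
  rw [h1]
  rw [autFactor_mul] at hc ⊢
  generalize autFactor δ τ = j at *
  generalize autFactor γ (δ • τ) = j' at *
  have h2 : e (-(γ 1 0 : ℂ) * ((u - v) / j) ^ 2 / (2 * j')) *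
      e (-(δ 1 0 : ℂ) * (u - v) ^ 2 / (2 * j)) =
      e (-((γ * δ) 1 0 : ℂ) * (u - v) ^ 2 / (2 * (j' * j))) := by
    rw [← e_add]
    congr 1
    field_simp
    linear_combination (u - v) ^ 2 * hc
  rw [← h2]
  ring

lemma MuHatTransforms.inv {γ : SL(2, ℤ)} (hγ : MuHatTransforms γ) : MuHatTransforms γ⁻¹ := by
  intro u v τ hu hv
  have h1 := hγ _ _ _ (hu.div_autFactor γ⁻¹) (hv.div_autFactor γ⁻¹)
  have hj := autFactor_ne_zero γ⁻¹ τ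
  have hc := mul_apply_one_zero_mul_autFactor γ γ⁻¹ τ
  have hm := autFactor_mul γ γ⁻¹ τ
  rw [mul_inv_cancel, autFactor_one] at hm hc
  rw [div_div, div_div, mul_comm (autFactor γ⁻¹ τ), ← hm, smul_smul, mul_inv_cancel, one_smul,
    ← sub_div, div_one, div_one] at h1
  rw [h1]
  generalize autFactor γ⁻¹ τ = j at *
  generalize autFactor γ (γ⁻¹ • τ) = j' at *
  have hj' : j' = 1 / j := by rw [eq_div_iff hj, hm]
  have h2 : e (-(γ⁻¹ 1 0 : ℂ) * (u - v) ^ 2 / (2 * j)) *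
      e (-(γ 1 0 : ℂ) * ((u - v) / j) ^ 2 / (2 * j')) = 1 := by
    rw [← e_add, ← e_zero]
    congr 1
    rw [hj']
    have : (γ 1 0 : ℂ) + (γ⁻¹ 1 0 : ℂ) = 0 := by simpa using hc.symm
    field_simp
    linear_combination -(u - v) ^ 2 * this
  have h3 : j ^ 2 * j' ^ 2 = 1 := by rw [hj']; field_simp
  generalize e (-(γ⁻¹ 1 0 : ℂ) * (u - v) ^ 2 / (2 * j)) = A at *
  generalize e (-(γ 1 0 : ℂ) * ((u - v) / j) ^ 2 / (2 * j')) = B at *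
  generalize muHat (u / j) (v / j) (γ⁻¹ • τ) * eta ((γ⁻¹ • τ : ℍ) : ℂ) ^ 3 = X
  linear_combination -X * h3 * (A * B) - X * h2

theorem muHatTransforms (γ : SL(2, ℤ)) : MuHatTransforms γ := by
  have h : γ ∈ Subgroup.closure ({ModularGroup.S, ModularGroup.T} : Set SL(2, ℤ)) := by
    rw [SpecialLinearGroup.SL2Z_generators]
    trivial
  induction h using Subgroup.closure_induction with
  | mem x hx =>
    rcases hx with rfl | rfl
    · exact muHatTransforms_S
    · exact muHatTransforms_T
  | one =>
    intro u v τ _ _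
    simp [autFactor_one, e_zero]
  | mul x y _ _ hx hy => exact hx.mul hy
  | inv x _ hx => exact hx.inv

/-- Dividing the weight $2$ law by $\eta(\gamma\tau)^3$ leaves $\psi^{-3}$ and weight $2-3/2$. -/
theorem NonLattice.muHat_smul {u v : ℂ} {τ : ℍ} (hu : NonLattice u τ) (hv : NonLattice v τ)
    (γ : SL(2, ℤ)) : muHat (u / autFactor γ τ) (v / autFactor γ τ) (γ • τ) =
      etaMultiplier γ ^ (-3 : ℤ) * autFactor γ τ ^ (1 / 2 : ℂ) *
        e (-(γ 1 0 : ℂ) * (u - v) ^ 2 / (2 * autFactor γ τ)) * muHat u v τ := by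
  have h := muHatTransforms γ u v τ hu hv
  have hψ := etaMultiplier_ne_zero γ
  have hη := eta_coe_ne_zero τ
  have hκ := autFactor_cpow_half_ne_zero γ τ
  have h2 := cpow_half_sq (autFactor γ τ)
  rw [eta_smul] at h
  rw [zpow_neg, show (3 : ℤ) = (3 : ℕ) from rfl, zpow_natCast]
  generalize autFactor γ τ ^ (1 / 2 : ℂ) = κ at *
  generalize etaMultiplier γ = ψ at *
  rw [← h2] at h ⊢
  generalize muHat (u / κ ^ 2) (v / κ ^ 2) (γ • τ) = X at *
  generalize e (-(γ 1 0 : ℂ) * (u - v) ^ 2 / (2 * κ ^ 2)) = B at *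
  rw [show (ψ ^ 3)⁻¹ * κ * B * muHat u v τ = κ * B * muHat u v τ / ψ ^ 3 by ring,
    eq_div_iff (pow_ne_zero _ hψ)]
  have h5 : κ ^ 3 * eta τ ^ 3 ≠ 0 := by positivity
  refine mul_right_cancel₀ h5 ?_
  linear_combination h

/-! ### Elliptic transformation of `μ̂` -/

lemma neg_one_zpow_add_one (n : ℤ) : (-1 : ℂ) ^ (n + 1) = -(-1) ^ n := by
  rw [zpow_add_one₀ (by norm_num)]; ring

lemma neg_one_zpow_sub_one (n : ℤ) : (-1 : ℂ) ^ (n - 1) = -(-1) ^ n := by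
  rw [zpow_sub_one₀ (by norm_num)]; norm_num

lemma e_half_add (u : ℂ) : e ((u + 1) / 2) = -e (u / 2) := by
  rw [add_div, e_add, e_half]; ring

lemma muHat_add_one_left (u v : ℂ) (τ : ℍ) : muHat (u + 1) v τ = -muHat u v τ := by
  rw [muHat, muHat, mu, mu, e_half_add, add_sub_right_comm, zwegersR_add_one]
  have : e (u + 1) = e u := by simpa using e_add_int u 1
  rw [this]
  ring

lemma muHat_add_one_right (u v : ℂ) (τ : ℍ) : muHat u (v + 1) τ = -muHat u v τ := by
  have h := zwegersR_add_one (u - (v + 1)) τ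
  rw [show u - (v + 1) + 1 = u - v by ring] at h
  rw [muHat, muHat, mu, mu, vartheta_add_one, ← appellSum, ← appellSum, appellSum_add_one, h]
  rw [div_neg]
  ring

lemma NonLattice.add {v : ℂ} {τ : ℍ} (hv : NonLattice v τ) (m n : ℤ) :
    NonLattice (v + (m * τ + n)) τ := by
  intro k l h
  exact hv (k - m) (l - n) (by push_cast; linear_combination h)

lemma NonLattice.muHat_add_tau_right {u v : ℂ} {τ : ℍ} (hu : NonLattice u τ)
    (hv : NonLattice v τ) : muHat u (v + τ) τ = -e (τ / 2 - (u - v)) * muHat u v τ := by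
  have hv' : NonLattice (v + τ) τ := by simpa using hv.add 1 0
  rw [muHat_eq hv, muHat_eq hv', hu.muNumerator_add_tau, vartheta_add_tau]
  have h1 : e (τ / 2 - (u - v)) * e (-τ / 2 - v) = e (-u) := by
    rw [← e_add]; congr 1; ring
  rw [← h1]
  have := e_ne_zero (-τ / 2 - v)
  have := vartheta_ne_zero hv
  field_simp

lemma muHat_add_tau_both (u v : ℂ) (τ : ℍ) : muHat (u + τ) (v + τ) τ = muHat u v τ := by
  have h : appellSum (u + τ) (v + τ) τ = -e (-v - τ) * appellSum u v τ := by
    rw [appellSum, appellSum, ← (Equiv.addRight (-1 : ℤ)).tsum_eq, ← tsum_mul_left]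
    refine tsum_congr fun n ↦ ?_
    simp only [Equiv.coe_addRight]
    rw [← sub_eq_add_neg, neg_one_zpow_sub_one, e_add, mul_assoc (e u), ← e_add (τ : ℂ)]
    push_cast
    rw [show (τ : ℂ) + (n - 1) * τ = n * τ by ring, neg_mul, neg_mul, mul_assoc ((-1 : ℂ) ^ n),
      ← e_add]
    rw [show ((n : ℂ) - 1) * (v + τ) + (n - 1) * (n - 1 + 1) / 2 * τ =
      (-v - τ) + (n * v + n * (n + 1) / 2 * τ) by ring, e_add, e_add]
    ring
  rw [muHat, muHat, mu, mu, add_sub_add_right_eq_sub, ← appellSum, ← appellSum, h,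
    vartheta_add_tau, add_div u, e_add (u / 2)]
  have h1 : e ((τ : ℂ) / 2) * e (-v - τ) = e (-τ / 2 - v) := by rw [← e_add]; congr 1; ring
  have h2 := e_ne_zero (-τ / 2 - v)
  rw [show e (u / 2) * e ((τ : ℂ) / 2) / (-e (-τ / 2 - v) * vartheta v τ) *
      (-e (-v - τ) * appellSum u v τ) = e (u / 2) * (e ((τ : ℂ) / 2) * e (-v - τ)) /
      (e (-τ / 2 - v) * vartheta v τ) * appellSum u v τ by rw [neg_mul, div_neg]; ring, h1,
      mul_comm (e (u / 2)), mul_div_mul_left _ _ h2]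

lemma muHat_add_int_left (u v : ℂ) (τ : ℍ) (l : ℤ) :
    muHat (u + l) v τ = (-1) ^ l * muHat u v τ := by
  induction l with
  | zero => simp
  | succ n ih =>
    rw [neg_one_zpow_add_one]; push_cast at ih ⊢; rw [← add_assoc, muHat_add_one_left, ih]; ring
  | pred n ih =>
    have := muHat_add_one_left (u + (-n - 1 : ℤ)) v τ
    rw [neg_one_zpow_sub_one]
    rw [show u + (-n - 1 : ℤ) + 1 = u + (-n : ℤ) by push_cast; ring, ih] at this
    linear_combination this

lemma muHat_add_int_right (u v : ℂ) (τ : ℍ) (l : ℤ) :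
    muHat u (v + l) τ = (-1) ^ l * muHat u v τ := by
  induction l with
  | zero => simp
  | succ n ih =>
    rw [neg_one_zpow_add_one]; push_cast at ih ⊢; rw [← add_assoc, muHat_add_one_right, ih]; ring
  | pred n ih =>
    have := muHat_add_one_right u (v + (-n - 1 : ℤ)) τ
    rw [neg_one_zpow_sub_one]
    rw [show v + (-n - 1 : ℤ) + 1 = v + (-n : ℤ) by push_cast; ring, ih] at this
    linear_combination this

lemma muHat_add_int_mul_tau_both (u v : ℂ) (τ : ℍ) (l : ℤ) :
    muHat (u + l * τ) (v + l * τ) τ = muHat u v τ := by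
  induction l with
  | zero => simp
  | succ n ih =>
    push_cast at ih ⊢
    rw [add_one_mul, ← add_assoc, ← add_assoc, muHat_add_tau_both, ih]
  | pred n ih =>
    have := muHat_add_tau_both (u + (-n - 1 : ℤ) * τ) (v + (-n - 1 : ℤ) * τ) τ
    rw [← this, ← ih]
    congr 1 <;> push_cast <;> ring

lemma NonLattice.muHat_add_int_mul_tau_right {u v : ℂ} {τ : ℍ} (hu : NonLattice u τ)
    (hv : NonLattice v τ) (m : ℤ) : muHat u (v + m * τ) τ =
      (-1) ^ m * e (m ^ 2 * τ / 2 - m * (u - v)) * muHat u v τ := by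
  have hv' : ∀ m : ℤ, NonLattice (v + m * τ) τ := fun m ↦ by simpa using hv.add m 0
  induction m with
  | zero => simp [e_zero]
  | succ n ih =>
    have h := hu.muHat_add_tau_right (hv' n)
    push_cast at ih h ⊢
    rw [add_one_mul, ← add_assoc, h, ih, ← Nat.cast_succ (R := ℤ), Nat.cast_succ,
      neg_one_zpow_add_one]
    rw [show ((n : ℂ) + 1) ^ 2 * τ / 2 - (n + 1) * (u - v) =
      (τ / 2 - (u - (v + n * τ))) + (n ^ 2 * τ / 2 - n * (u - v)) by ring, e_add]
    ring
  | pred n ih =>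
    have h := hu.muHat_add_tau_right (hv' (-n - 1))
    rw [show v + ((-n - 1 : ℤ) : ℂ) * τ + τ = v + ((-n : ℤ) : ℂ) * τ by push_cast; ring, ih,
      show ((-n : ℤ) : ℂ) ^ 2 * τ / 2 - ((-n : ℤ) : ℂ) * (u - v) =
      (τ / 2 - (u - (v + ((-n - 1 : ℤ) : ℂ) * τ))) +
      (((-n - 1 : ℤ) : ℂ) ^ 2 * τ / 2 - ((-n - 1 : ℤ) : ℂ) * (u - v)) by push_cast; ring,
      e_add] at h
    rw [neg_one_zpow_sub_one]
    refine mul_left_cancel₀ (neg_ne_zero.mpr (e_ne_zero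
      (τ / 2 - (u - (v + ((-n - 1 : ℤ) : ℂ) * τ))))) ?_
    rw [← h]
    ring

/-- A common shift of $u$ and $v$ by $k\tau$ is free, so only the relative shift by $(r-k)\tau$
contributes to the exponential. -/
theorem NonLattice.muHat_elliptic {u v : ℂ} {τ : ℍ} (hu : NonLattice u τ) (hv : NonLattice v τ)
    (k l r s : ℤ) : muHat (u + (k * τ + l)) (v + (r * τ + s)) τ =
      (-1) ^ (k + l + r + s) * e ((k - r) ^ 2 * τ / 2 + (k - r) * (u - v)) * muHat u v τ := by
  have h := hu.muHat_add_int_mul_tau_right hv (r - k)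
  rw [← muHat_add_int_mul_tau_both _ _ τ k] at h
  rw [← add_assoc, ← add_assoc, muHat_add_int_left, muHat_add_int_right,
    show v + (r : ℂ) * τ = v + ((r - k : ℤ) : ℂ) * τ + k * τ by push_cast; ring, h]
  have h1 : (-1 : ℂ) ^ (k + l + r + s) = (-1) ^ l * (-1) ^ s * (-1) ^ (r - k) := by
    rw [← zpow_add₀ (by norm_num), ← zpow_add₀ (by norm_num),
      show k + l + r + s = l + s + (r - k) + 2 * k by ring, zpow_add₀ (by norm_num) _ (2 * k),
      zpow_mul]
    norm_num
  rw [h1, show ((r - k : ℤ) : ℂ) ^ 2 * τ / 2 - ((r - k : ℤ) : ℂ) * (u - v) =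
    (k - r) ^ 2 * τ / 2 + (k - r) * (u - v) by push_cast; ring]
  ring

end EtaTheta

/-! ### Growth at the cusps and specialisation to torsion points. -/

namespace EtaTheta

open Filter Topology Asymptotics

/-! ### Exponential growth at `i∞` -/

/-- At most linear exponential growth at `i∞`. -/
def ExpGrowth (f : ℍ → ℂ) : Prop := ∃ C : ℝ, f =O[atImInfty] fun τ : ℍ ↦ Real.exp (C * τ.im)

lemma eventually_le_im (A : ℝ) : ∀ᶠ τ : ℍ in atImInfty, A ≤ τ.im :=
  (atImInfty_mem _).mpr ⟨A, fun _ h ↦ h⟩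

lemma ExpGrowth.of_norm_le {f : ℍ → ℂ} (C K : ℝ)
    (h : ∀ᶠ τ : ℍ in atImInfty, ‖f τ‖ ≤ K * Real.exp (C * τ.im)) : ExpGrowth f :=
  ⟨C, IsBigO.of_bound K (h.mono fun τ hτ ↦ by
    rwa [Real.norm_eq_abs, abs_of_pos (Real.exp_pos _)])⟩

lemma ExpGrowth.mono_norm {f g : ℍ → ℂ} (hg : ExpGrowth g) (h : ∀ τ, ‖f τ‖ = ‖g τ‖) :
    ExpGrowth f := by
  obtain ⟨C, hC⟩ := hg
  exact ⟨C, (IsBigO.of_norm_eventuallyLE (.of_forall fun τ ↦ (h τ).le)).trans hC.norm_left⟩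

lemma exp_im_isBigO {C D : ℝ} (h : C ≤ D) :
    (fun τ : ℍ ↦ Real.exp (C * τ.im)) =O[atImInfty] fun τ : ℍ ↦ Real.exp (D * τ.im) :=
  IsBigO.of_bound 1 (.of_forall fun τ ↦ by
    rw [one_mul, Real.norm_eq_abs, Real.norm_eq_abs, Real.abs_exp, Real.abs_exp]
    have := τ.im_pos
    gcongr)

lemma ExpGrowth.add {f g : ℍ → ℂ} (hf : ExpGrowth f) (hg : ExpGrowth g) :
    ExpGrowth fun τ ↦ f τ + g τ := by
  obtain ⟨C, hC⟩ := hf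
  obtain ⟨D, hD⟩ := hg
  exact ⟨max C D, (hC.trans (exp_im_isBigO (le_max_left C D))).add
    (hD.trans (exp_im_isBigO (le_max_right C D)))⟩

lemma ExpGrowth.mul {f g : ℍ → ℂ} (hf : ExpGrowth f) (hg : ExpGrowth g) :
    ExpGrowth fun τ ↦ f τ * g τ := by
  obtain ⟨C, hC⟩ := hf
  obtain ⟨D, hD⟩ := hg
  refine ⟨C + D, (hC.mul hD).congr_right fun τ ↦ ?_⟩
  rw [← Real.exp_add]
  ring_nf

lemma ExpGrowth.const_mul {f : ℍ → ℂ} (hf : ExpGrowth f) (c : ℂ) : ExpGrowth fun τ ↦ c * f τ := by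
  obtain ⟨C, hC⟩ := hf
  exact ⟨C, hC.const_mul_left c⟩

lemma norm_e_lin (a : ℝ) (b : ℂ) (τ : ℍ) :
    ‖e (a * τ + b)‖ = ‖e b‖ * Real.exp (-(2 * π * a) * τ.im) := by
  rw [e_add, norm_mul, mul_comm, norm_e (a * τ)]
  congr 2
  simp only [Complex.im_ofReal_mul, coe_im]
  ring

lemma expGrowth_e (a : ℝ) (b : ℂ) : ExpGrowth fun τ ↦ e (a * τ + b) :=
  .of_norm_le (-(2 * π * a)) ‖e b‖ (.of_forall fun τ ↦ (norm_e_lin a b τ).le)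

/-! ### Bounds for the theta-like series at torsion points -/

/-- Along a line $a\tau+b$ the linear term grows with $y$. Half of the quadratic term absorbs it, by
$(|x|-2s)^2\ge0$, at the cost $e^{2\pi s^2y}$; the other half is a majorant independent of $y\ge
y_0$. -/
lemma gauss_le_of_le (s x : ℝ) {y y₀ : ℝ} (hy : y₀ ≤ y) (hy₀ : 0 < y₀) :
    Real.exp (-π * (y * x ^ 2 - 2 * (s * y) * |x|)) ≤
      Real.exp (2 * π * s ^ 2 * y) * Real.exp (-π * (y₀ / 2 * x ^ 2 - 2 * 0 * |x|)) := by
  rw [← Real.exp_add]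
  refine Real.exp_le_exp.mpr ?_
  have h1 : 0 ≤ y * (|x| - 2 * s) ^ 2 := mul_nonneg (hy₀.le.trans hy) (sq_nonneg _)
  have h2 : y₀ * x ^ 2 ≤ y * x ^ 2 := by gcongr
  rw [sub_sq, sq_abs] at h1
  have h3 := mul_le_mul_of_nonneg_left (by linarith : 0 ≤ y * (x ^ 2 - 2 * |x| * (2 * s) +
    (2 * s) ^ 2) + (y - y₀) * x ^ 2) Real.pi_pos.le
  nlinarith

lemma expGrowth_zwegersR (a b : ℝ) : ExpGrowth fun τ ↦ zwegersR (a * τ + b) τ := by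
  refine .of_norm_le (2 * π * |a| ^ 2) (2 * ∑' n : ℤ, Real.exp (-π * (1 / 2 *
    ((n : ℝ) + 1 / 2) ^ 2 - 2 * 0 * |(n : ℝ) + 1 / 2|))) ?_
  filter_upwards [eventually_le_im 1] with τ hτ
  have h1 : |(a * τ + b : ℂ).im| ≤ |a| * τ.im := by
    simp [abs_mul, abs_of_pos τ.im_pos]
  have hs : Summable fun n : ℤ ↦ Real.exp (-π * (1 / 2 *
      ((n : ℝ) + 1 / 2) ^ 2 - 2 * 0 * |(n : ℝ) + 1 / 2|)) := by
    simpa using summable_gauss_shift (1 / 2) (S := 0) le_rfl (T := 1 / 2) (by norm_num) 0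
  have hg : Summable (gaussR (|a| * τ.im) τ.im) :=
    summable_gaussR (by have := τ.im_pos; positivity) τ.im_pos
  refine (norm_zwegersR_le h1).trans ?_
  rw [mul_assoc, mul_comm (tsum _) (Real.exp _), ← tsum_mul_left (a := Real.exp _)]
  exact mul_le_mul_of_nonneg_left (Summable.tsum_le_tsum (f := gaussR (|a| * τ.im) τ.im)
    (fun n ↦ gauss_le_of_le |a| ((n : ℝ) + 1 / 2) hτ one_pos)
    hg (hs.mul_left _)) two_pos.le

lemma norm_appell_line_le {p r a b c y₀ : ℝ} (hy₀ : 0 < y₀) (hc : 0 < c)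
    (h : ∀ (n : ℤ) (τ : ℍ), y₀ ≤ τ.im → c ≤ ‖1 - e (p * τ + r) * e (n * τ)‖) (n : ℤ) {τ : ℍ}
    (hτ : y₀ ≤ τ.im) :
    ‖(-1 : ℂ) ^ n * e (n * (a * τ + b)) * e ((n : ℂ) * (n + 1) / 2 * τ) /
      (1 - e (p * τ + r) * e (n * τ))‖ ≤ Real.exp (2 * π * (|a| + 1 / 2) ^ 2 * τ.im) *
        (Real.exp (-π * (y₀ / 2 * (n : ℝ) ^ 2 - 2 * 0 * |(n : ℝ)|)) / c) := by
  have h1 : |(a * τ + b : ℂ).im| ≤ |a| * τ.im := by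
    simp [abs_mul, abs_of_pos τ.im_pos]
  rw [norm_div, ← mul_div_assoc]
  refine div_le_div₀ (by positivity) ((norm_appell_numerator_le n h1).trans ?_) hc (h n τ hτ)
  have := gauss_le_of_le (|a| + 1 / 2) (n : ℝ) hτ hy₀
  rwa [show (|a| + 1 / 2) * τ.im = |a| * τ.im + τ.im / 2 by ring] at this

lemma summable_gauss_int {y₀ : ℝ} (hy₀ : 0 < y₀) (c : ℝ) :
    Summable fun n : ℤ ↦ Real.exp (-π * (y₀ / 2 * (n : ℝ) ^ 2 - 2 * 0 * |(n : ℝ)|)) / c := by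
  have := summable_gauss_shift 0 (S := 0) le_rfl (half_pos hy₀) 0
  simpa using this.div_const c

lemma expGrowth_appellSum {p r : ℝ} (h : ∀ m n : ℤ, ¬(p = m ∧ r = n)) (a b : ℝ) :
    ExpGrowth fun τ ↦ appellSum (p * τ + r) (a * τ + b) τ := by
  obtain ⟨c, hc, hle⟩ := exists_le_norm_one_sub h one_pos
  refine .of_norm_le (2 * π * (|a| + 1 / 2) ^ 2)
    (∑' n : ℤ, Real.exp (-π * (1 / 2 * (n : ℝ) ^ 2 - 2 * 0 * |(n : ℝ)|)) / c) ?_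
  filter_upwards [eventually_le_im 1] with τ hτ
  rw [mul_comm (tsum _), ← tsum_mul_left]
  exact tsum_of_norm_bounded ((summable_gauss_int one_pos c).mul_left _).hasSum
    fun n ↦ norm_appell_line_le one_pos hc hle n hτ

/-! ### The behaviour of `ϑ` at `i∞` -/

lemma tendsto_e_mul_atImInfty {c : ℝ} (hc : 0 < c) :
    Tendsto (fun τ : ℍ ↦ e (c * τ)) atImInfty (𝓝 0) := by
  rw [tendsto_zero_iff_norm_tendsto_zero]
  have h : ∀ τ : ℍ, ‖e (c * τ)‖ = Real.exp (-(2 * π * c * τ.im)) := by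
    intro τ
    rw [norm_e]
    simp only [Complex.im_ofReal_mul, coe_im]
    ring_nf
  simp only [h]
  refine Real.tendsto_exp_neg_atTop_nhds_zero.comp ?_
  exact Tendsto.const_mul_atTop (by positivity) (tendsto_comap : Tendsto im atImInfty atTop)

lemma int_add_one_mul_nonneg {a : ℝ} (ha : 0 ≤ a) (ha1 : a < 1) {n : ℤ} (hn : n ≠ -1)
    (hn' : ¬(n = 0 ∧ a = 0)) : 0 < ((n : ℝ) + 1) * (n + 2 * a) := by
  rcases lt_trichotomy n (-1) with h | h | h
  · have : (n : ℝ) ≤ -2 := by exact_mod_cast (by omega : n ≤ -2)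
    exact mul_pos_of_neg_of_neg (by linarith) (by linarith)
  · exact absurd h hn
  · rcases eq_or_ne n 0 with rfl | h0
    · have : 0 < a := lt_of_le_of_ne ha fun h ↦ hn' ⟨rfl, h.symm⟩
      push_cast
      nlinarith
    · have : (1 : ℝ) ≤ n := by exact_mod_cast (by omega : 1 ≤ n)
      exact mul_pos (by linarith) (by linarith)

/-- The normalised exponents are $(n+1)(n+2a)/2$. For $0\le a<1$ they are positive except at $n=-1$
and, if $a=0$, at $n=0$. -/
lemma tendsto_vartheta_line {a : ℝ} (ha : 0 ≤ a) (ha1 : a < 1) (b : ℝ) :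
    Tendsto (fun τ : ℍ ↦ e (((a - 1 / 4 : ℝ) : ℂ) / 2 * τ) * vartheta (a * τ + b) τ) atImInfty
      (𝓝 (e (-(b + 1 / 2) / 2) + if a = 0 then e ((b + 1 / 2) / 2) else 0)) := by
  let g : ℤ → ℂ := fun n ↦ if n = -1 then e (-(b + 1 / 2) / 2) else
    if n = 0 ∧ a = 0 then e ((b + 1 / 2) / 2) else 0
  have hg : ∑' n, g n = e (-(b + 1 / 2) / 2) + if a = 0 then e ((b + 1 / 2) / 2) else 0 := by
    rw [tsum_eq_sum (s := {-1, 0})]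
    · simp [g]
    · intro n hn
      simp only [Finset.mem_insert, Finset.mem_singleton, not_or] at hn
      simp [g, hn.1, hn.2]
  rw [← hg]
  let f : ℍ → ℤ → ℂ := fun τ n ↦
    e (((((n : ℝ) + 1) * (n + 2 * a) / 2 : ℝ) : ℂ) * τ) * e (((n + 1 / 2 : ℝ) * (b + 1 / 2 : ℝ) : ℝ))
  have hf : ∀ τ : ℍ, e (((a - 1 / 4 : ℝ) : ℂ) / 2 * τ) * vartheta (a * τ + b) τ = ∑' n, f τ n := by
    intro τ
    rw [vartheta, ← tsum_mul_left]
    refine tsum_congr fun n ↦ ?_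
    simp only [f, ← e_add]
    congr 1
    push_cast
    ring
  simp only [hf]
  have hs : Summable fun n : ℤ ↦ Real.exp (-π * (1 * (n : ℝ) ^ 2 - 2 * (3 / 2) * |(n : ℝ)|)) := by
    simpa using summable_gauss_shift 0 (S := 3 / 2) (by norm_num) one_pos 0
  refine tendsto_tsum_of_dominated_convergence hs (fun n ↦ ?_) ?_
  · by_cases h1 : n = -1
    · subst h1
      simp only [f, g, if_true]
      refine tendsto_const_nhds.congr fun τ ↦ ?_
      rw [← e_add]
      congr 1
      push_cast
      ring
    · by_cases h2 : n = 0 ∧ a = 0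
      · obtain ⟨rfl, rfl⟩ := h2
        simp only [f, g]
        refine tendsto_const_nhds.congr fun τ ↦ ?_
        rw [← e_add]
        simp only [h1, if_false, and_self, if_true]
        congr 1
        push_cast
        ring
      · simp only [f, g, h1, h2, if_false]
        rw [← zero_mul (e (((n + 1 / 2 : ℝ) * (b + 1 / 2 : ℝ) : ℝ)))]
        exact (tendsto_e_mul_atImInfty (half_pos (int_add_one_mul_nonneg ha ha1 h1 h2))).mul_const _
  · filter_upwards [eventually_le_im 1] with τ hτ n
    simp only [f]
    rw [norm_mul, norm_e_ofReal, mul_one, norm_e, Complex.im_ofReal_mul, coe_im]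
    refine Real.exp_le_exp.mpr ?_
    have h0 : 0 ≤ ((n : ℝ) + 1) * (n + 2 * a) := by
      by_cases h1 : n = -1
      · simp [h1]
      · by_cases h2 : n = 0 ∧ a = 0
        · simp [h2.1, h2.2]
        · exact (int_add_one_mul_nonneg ha ha1 h1 h2).le
    have h3 : (n : ℝ) ^ 2 - 3 * |(n : ℝ)| ≤ ((n : ℝ) + 1) * (n + 2 * a) := by
      have := neg_abs_le (n : ℝ)
      have := abs_nonneg (n : ℝ)
      have : -((1 + 2 * a) * |(n : ℝ)|) ≤ (1 + 2 * a) * n := by nlinarith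
      nlinarith
    have h4 : ((n : ℝ) + 1) * (n + 2 * a) ≤ ((n : ℝ) + 1) * (n + 2 * a) * τ.im :=
      le_mul_of_one_le_right h0 hτ
    nlinarith [Real.pi_pos]

lemma expGrowth_vartheta_inv {a : ℝ} (ha : 0 ≤ a) (ha1 : a < 1) {b : ℝ}
    (h : ∀ m n : ℤ, ¬(a = m ∧ b = n)) : ExpGrowth fun τ ↦ (vartheta (a * τ + b) τ)⁻¹ := by
  have ht := tendsto_vartheta_line ha ha1 b
  have hne : e (-(b + 1 / 2) / 2) + (if a = 0 then e ((b + 1 / 2) / 2) else 0) ≠ 0 := by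
    split_ifs with h0
    -- For $a=0$ the two surviving terms cancel only if $e(b)=1$, that is, at a lattice point.
    · intro hz
      have h1 : e ((b : ℂ) + 1 / 2) = e (1 / 2) := by
        rw [e_half, show (b : ℂ) + 1 / 2 = (b + 1 / 2) / 2 - -(b + 1 / 2) / 2 by ring, e_sub,
          eq_neg_of_add_eq_zero_right hz]
        have := e_ne_zero (-((b : ℂ) + 1 / 2) / 2)
        field_simp
      have h2 : e (b : ℂ) = 1 := by
        rw [e_add] at h1
        exact mul_right_cancel₀ (e_ne_zero (1 / 2)) (by rw [h1, one_mul])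
      obtain ⟨n, hn⟩ := (e_eq_one_iff _).mp h2
      exact h 0 n ⟨by simpa using h0, by exact_mod_cast hn⟩
    · rw [add_zero]
      exact e_ne_zero _
  have h1 : (fun τ : ℍ ↦ (e (((a - 1 / 4 : ℝ) : ℂ) / 2 * τ) * vartheta (a * τ + b) τ)⁻¹)
      =O[atImInfty] fun _ ↦ (1 : ℝ) := (ht.inv₀ hne).isBigO_one ℝ
  have h2 : ExpGrowth fun τ : ℍ ↦
      (e (((a - 1 / 4 : ℝ) : ℂ) / 2 * τ) * vartheta (a * τ + b) τ)⁻¹ :=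
    ⟨0, by simpa using h1⟩
  have h3 := (expGrowth_e ((a - 1 / 4) / 2) 0).mul h2
  refine h3.mono_norm fun τ ↦ congrArg norm ?_
  rw [mul_inv, ← mul_assoc, add_zero]
  push_cast
  rw [mul_inv_cancel₀ (e_ne_zero _), one_mul]

/-! ### `μ` and `μ̂` at torsion points -/

/-- A pair of real coordinates which does not describe a lattice point. -/
def NotBothInt (a b : ℝ) : Prop := ∀ m n : ℤ, ¬(a = m ∧ b = n)

lemma NotBothInt.nonLattice {a b : ℝ} (h : NotBothInt a b) (τ : ℍ) : NonLattice (a * τ + b) τ :=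
  nonLattice_of_not_both_int h τ

/-- `e(-(a - a')² τ / 2) μ(a τ + b, a' τ + b'; τ)`. -/
noncomputable def torsionMu (a b a' b' : ℝ) (τ : ℍ) : ℂ :=
  e (((-(a - a') ^ 2 / 2 : ℝ) : ℂ) * τ) * mu (a * τ + b) (a' * τ + b') τ

/-- `e(-(a - a')² τ / 2) μ̂(a τ + b, a' τ + b'; τ)`. -/
noncomputable def torsionMuHat (a b a' b' : ℝ) (τ : ℍ) : ℂ :=
  e (((-(a - a') ^ 2 / 2 : ℝ) : ℂ) * τ) * muHat (a * τ + b) (a' * τ + b') τ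

/-- `e(-a² τ / 2) R(a τ + b; τ)`. -/
noncomputable def torsionR (a b : ℝ) (τ : ℍ) : ℂ :=
  e (((-a ^ 2 / 2 : ℝ) : ℂ) * τ) * zwegersR (a * τ + b) τ

lemma torsionMuHat_eq (a b a' b' : ℝ) (τ : ℍ) :
    torsionMuHat a b a' b' τ = torsionMu a b a' b' τ + I / 2 * torsionR (a - a') (b - b') τ := by
  rw [torsionMuHat, torsionMu, torsionR, muHat]
  rw [show (((a - a' : ℝ) : ℂ) * τ + ((b - b' : ℝ) : ℂ)) = a * τ + b - (a' * τ + b') by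
    push_cast; ring]
  ring

lemma expGrowth_torsionMu {a b a' b' : ℝ} (h : NotBothInt a b) (h' : NotBothInt a' b')
    (ha' : 0 ≤ a') (ha1 : a' < 1) : ExpGrowth (torsionMu a b a' b') := by
  have h1 := (((expGrowth_e (-(a - a') ^ 2 / 2) 0).mul (expGrowth_e (a / 2) (b / 2))).mul
    (expGrowth_vartheta_inv ha' ha1 h')).mul (expGrowth_appellSum h a' b')
  refine h1.mono_norm fun τ ↦ congrArg norm ?_
  rw [torsionMu, mu, ← appellSum, add_zero, add_div]
  push_cast
  rw [show (a : ℂ) * τ / 2 = a / 2 * τ by ring]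
  ring

lemma expGrowth_torsionR (a b : ℝ) : ExpGrowth (torsionR a b) := by
  have := (expGrowth_e (-a ^ 2 / 2) 0).mul (expGrowth_zwegersR a b)
  exact this.mono_norm fun τ ↦ by rw [torsionR, add_zero]

lemma torsionMuHat_add_int {a b a' b' : ℝ} (h : NotBothInt a b) (h' : NotBothInt a' b')
    (k l r s : ℤ) (τ : ℍ) : torsionMuHat (a + k) (b + l) (a' + r) (b' + s) τ =
      (-1) ^ (k + l + r + s) * e (((k - r) * (b - b') : ℝ)) * torsionMuHat a b a' b' τ := by
  have := (h.nonLattice τ).muHat_elliptic (h'.nonLattice τ) k l r s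
  rw [torsionMuHat, torsionMuHat]
  push_cast
  rw [show ((a : ℂ) + k) * τ + (b + l) = a * τ + b + (k * τ + l) by ring,
    show ((a' : ℂ) + r) * τ + (b' + s) = a' * τ + b' + (r * τ + s) by ring, this,
    mul_assoc ((-1 : ℂ) ^ _), mul_left_comm (e _), ← mul_assoc (e _), ← e_add,
    mul_assoc ((-1 : ℂ) ^ _), ← mul_assoc (e _), ← e_add]
  congr 3
  ring

/-- Translates to other cusps have arbitrary $a'$, while $1/\vartheta$ was bounded only for $0\le
a'<1$. An integral shift to the fractional part costs a unimodular factor. -/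
lemma expGrowth_torsionMuHat {a b a' b' : ℝ} (h : NotBothInt a b) (h' : NotBothInt a' b') :
    ExpGrowth (torsionMuHat a b a' b') := by
  have hf : NotBothInt (Int.fract a') b' := by
    rintro m n ⟨hm, hn⟩
    exact h' (⌊a'⌋ + m) n ⟨by push_cast; linarith [Int.floor_add_fract a'], hn⟩
  have h1 : ExpGrowth (torsionMuHat a b (Int.fract a') b') := by
    have := (expGrowth_torsionMu h hf (Int.fract_nonneg a') (Int.fract_lt_one a')).add
      ((expGrowth_torsionR (a - Int.fract a') (b - b')).const_mul (I / 2))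
    exact this.mono_norm fun τ ↦ congrArg norm (torsionMuHat_eq _ _ _ _ τ)
  refine h1.mono_norm fun τ ↦ ?_
  have := torsionMuHat_add_int h hf 0 0 ⌊a'⌋ 0 τ
  rw [Int.cast_zero, add_zero, add_zero, add_zero, Int.fract_add_floor] at this
  rw [this, norm_mul, norm_mul, norm_e_ofReal, norm_zpow, norm_neg, norm_one, one_zpow, one_mul,
    one_mul]

lemma NotBothInt.smul {a b : ℝ} (h : NotBothInt a b) (γ : SL(2, ℤ)) :
    NotBothInt (a * γ 0 0 + b * γ 1 0) (a * γ 0 1 + b * γ 1 1) := by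
  rintro m n ⟨hm, hn⟩
  have hd : (γ 0 0 : ℝ) * (γ 1 1 : ℝ) - (γ 0 1 : ℝ) * (γ 1 0 : ℝ) = 1 := by
    exact_mod_cast det_eq_one_int γ
  refine h (m * γ 1 1 - n * γ 1 0) (n * γ 0 0 - m * γ 0 1) ⟨?_, ?_⟩
  · push_cast
    linear_combination (γ 1 1 : ℝ) * hm - (γ 1 0 : ℝ) * hn - a * hd
  · push_cast
    linear_combination (γ 0 0 : ℝ) * hn - (γ 0 1 : ℝ) * hm - b * hd

lemma lin_smul (a b : ℝ) (γ : SL(2, ℤ)) (τ : ℍ) :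
    (a : ℂ) * (γ • τ : ℍ) + b = (((a * γ 0 0 + b * γ 1 0 : ℝ) : ℂ) * τ +
      ((a * γ 0 1 + b * γ 1 1 : ℝ) : ℂ)) / autFactor γ τ := by
  rw [eq_div_iff (autFactor_ne_zero γ τ), add_mul, mul_assoc, coe_smul_mul_autFactor, autFactor]
  push_cast
  ring

/-- The exponent of the root of unity produced by `γ` acting on torsion points. -/
noncomputable def torsionPhase (α β : ℝ) (γ : SL(2, ℤ)) : ℝ :=
  -(α ^ 2 * γ 0 0 * γ 0 1 / 2) - α * β * γ 0 1 * γ 1 0 - β ^ 2 * γ 1 0 * γ 1 1 / 2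

/-- The prefactor $q^{-(a-a')^2/2}$ is chosen so that the quadratic exponential of the modular law
becomes the prefactor at the new coordinates times a constant of modulus $1$. -/
lemma torsionMuHat_smul {a b a' b' : ℝ} (h : NotBothInt a b) (h' : NotBothInt a' b')
    (γ : SL(2, ℤ)) (τ : ℍ) : torsionMuHat a b a' b' (γ • τ) =
      etaMultiplier γ ^ (-3 : ℤ) * e (torsionPhase (a - a') (b - b') γ) *
        autFactor γ τ ^ (1 / 2 : ℂ) *
        torsionMuHat (a * γ 0 0 + b * γ 1 0) (a * γ 0 1 + b * γ 1 1)
          (a' * γ 0 0 + b' * γ 1 0) (a' * γ 0 1 + b' * γ 1 1) τ := by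
  have h1 := ((h.smul γ).nonLattice τ).muHat_smul ((h'.smul γ).nonLattice τ) γ
  rw [torsionMuHat, torsionMuHat, lin_smul, lin_smul, h1]
  have hj := autFactor_ne_zero γ τ
  have hd := det_eq_one γ
  have h2 : e (((-(a - a') ^ 2 / 2 : ℝ) : ℂ) * (γ • τ : ℍ)) *
      e (-(γ 1 0 : ℂ) * ((((a * γ 0 0 + b * γ 1 0 : ℝ) : ℂ) * τ +
      ((a * γ 0 1 + b * γ 1 1 : ℝ) : ℂ)) - (((a' * γ 0 0 + b' * γ 1 0 : ℝ) : ℂ) * τ +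
      ((a' * γ 0 1 + b' * γ 1 1 : ℝ) : ℂ))) ^ 2 / (2 * autFactor γ τ)) =
      e (torsionPhase (a - a') (b - b') γ) *
        e (((-((a * γ 0 0 + b * γ 1 0) - (a' * γ 0 0 + b' * γ 1 0)) ^ 2 / 2 : ℝ) : ℂ) * τ) := by
    rw [← e_add, ← e_add]
    congr 1
    rw [coe_smul_eq, torsionPhase]
    have hj' : (γ 1 0 : ℂ) * τ + γ 1 1 ≠ 0 := hj
    rw [autFactor]
    push_cast
    generalize (γ 0 0 : ℂ) = A at *
    generalize (γ 0 1 : ℂ) = B at *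
    generalize (γ 1 0 : ℂ) = C at *
    generalize (γ 1 1 : ℂ) = D at *
    generalize (τ : ℂ) = t at *
    obtain ⟨J, hJ⟩ : ∃ J, J = C * t + D := ⟨_, rfl⟩
    rw [← hJ] at hj' ⊢
    field_simp
    subst hJ
    linear_combination ((a - a') ^ 2 * (A * t + B)) * hd
  linear_combination (etaMultiplier γ ^ (-3 : ℤ) * autFactor γ τ ^ (1 / 2 : ℂ) *
    muHat (((a * γ 0 0 + b * γ 1 0 : ℝ) : ℂ) * τ +
      ((a * γ 0 1 + b * γ 1 1 : ℝ) : ℂ)) (((a' * γ 0 0 + b' * γ 1 0 : ℝ) : ℂ) * τ +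
      ((a' * γ 0 1 + b' * γ 1 1 : ℝ) : ℂ)) τ) * h2

end EtaTheta

/-! ### Smoothness of the non-holomorphic theta series. -/

namespace EtaTheta

open Filter Topology

/-! ### Smoothness from Wirtinger derivatives -/

lemma isOpen_im_pos : IsOpen {z : ℂ | 0 < z.im} := isOpen_lt continuous_const Complex.continuous_im

lemma contDiffOn_succ_of_wirtinger {n : ℕ} {f p b : ℂ → ℂ}
    (h : ∀ z ∈ {z : ℂ | 0 < z.im}, HasWirtingerAt f (p z) (b z) z)
    (hp : ContDiffOn ℝ n p {z : ℂ | 0 < z.im}) (hb : ContDiffOn ℝ n b {z : ℂ | 0 < z.im}) :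
    ContDiffOn ℝ (n + 1 : ℕ) f {z : ℂ | 0 < z.im} := by
  push_cast
  rw [contDiffOn_succ_iff_fderiv_of_isOpen isOpen_im_pos]
  refine ⟨fun z hz ↦ (HasFDerivAt.differentiableAt (h z hz)).differentiableWithinAt, by simp, ?_⟩
  have : ContDiffOn ℝ n (fun z ↦ wirtinger (p z) (b z)) {z : ℂ | 0 < z.im} :=
    (hp.smul contDiffOn_const).add (hb.smul contDiffOn_const)
  exact this.congr fun z hz ↦ HasFDerivAt.fderiv (h z hz)

lemma contDiffOn_inv_sqrt_im {n : WithTop ℕ∞} :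
    ContDiffOn ℝ n (fun z : ℂ ↦ (((√(2 * z.im))⁻¹ : ℝ) : ℂ)) {z : ℂ | 0 < z.im} := by
  refine Complex.ofRealCLM.contDiff.comp_contDiffOn ?_
  have h : ∀ z ∈ {z : ℂ | 0 < z.im}, 2 * z.im ≠ 0 := fun z hz ↦ by
    have : 0 < z.im := hz
    positivity
  refine ContDiffOn.inv (ContDiffOn.sqrt ?_ h) fun z hz ↦ ?_
  · exact (contDiff_const.mul Complex.imCLM.contDiff).contDiffOn
  · have : 0 < z.im := hz
    positivity

lemma hasDerivAt_inv_sqrt {y : ℝ} (hy : 0 < y) :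
    HasDerivAt (fun t : ℝ ↦ (√(2 * t))⁻¹) (-(√(2 * y))⁻¹ / (2 * y)) y := by
  have h1 : HasDerivAt (fun t : ℝ ↦ 2 * t) 2 y := by simpa using (hasDerivAt_id y).const_mul 2
  have h2 := (h1.sqrt (by positivity)).inv (by positivity)
  refine h2.congr_deriv ?_
  have h3 : √(2 * y) ^ 2 = 2 * y := Real.sq_sqrt (by positivity)
  have : √(2 * y) ≠ 0 := by positivity
  rw [h3]
  field_simp

lemma hasWirtingerAt_inv_sqrt_im {z : ℂ} (hz : 0 < z.im) :
    HasWirtingerAt (fun w : ℂ ↦ (((√(2 * w.im))⁻¹ : ℝ) : ℂ))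
      (I / (4 * z.im) * ((√(2 * z.im))⁻¹ : ℝ)) (-I / (4 * z.im) * ((√(2 * z.im))⁻¹ : ℝ)) z := by
  refine (HasDerivAt.hasWirtingerAt_im (hasDerivAt_inv_sqrt hz)).congr_val ?_ ?_
  all_goals
    push_cast
    have : (z.im : ℂ) ≠ 0 := by exact_mod_cast hz.ne'
    field_simp
    try ring

/-! ### The non-holomorphic theta series -/

/-- `(sgn l - E(l √(2y))) e(-l² z / 2)`. -/
noncomputable def incErf (l : ℝ) (z : ℂ) : ℂ :=
  ((l.sign - erfE (l * √(2 * z.im)) : ℝ) : ℂ) * e (-(l : ℂ) ^ 2 / 2 * z)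

/-- `conj(e(l² z / 2))`. -/
noncomputable def conjGauss (l : ℝ) (z : ℂ) : ℂ := (starRingEnd ℂ) (e ((l : ℂ) ^ 2 / 2 * z))

lemma norm_conjGauss (l : ℝ) (z : ℂ) : ‖conjGauss l z‖ = Real.exp (-π * (z.im * l ^ 2)) := by
  rw [conjGauss, RCLike.norm_conj, norm_e,
    show (l : ℂ) ^ 2 / 2 = ((l ^ 2 / 2 : ℝ) : ℂ) by push_cast; ring, Complex.im_ofReal_mul]
  ring_nf

lemma gauss_mul_e (l : ℝ) (z : ℂ) :
    ((Real.exp (-π * (2 * z.im * l ^ 2)) : ℝ) : ℂ) * e (-(l : ℂ) ^ 2 / 2 * z) = conjGauss l z := by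
  have h := Complex.sub_conj z
  rw [conjGauss, conj_e, e, e, Complex.ofReal_exp, ← Complex.exp_add]
  congr 1
  simp only [map_mul, map_div₀, map_pow, Complex.conj_ofReal, Complex.conj_ofNat]
  push_cast at h ⊢
  have e1 : (starRingEnd ℂ) z = z - 2 * z.im * I := by linear_combination -h
  rw [e1]
  linear_combination (-2 * π * l ^ 2 * z.im) * Complex.I_sq

lemma norm_incErf_le (l : ℝ) {z : ℂ} (hz : 0 < z.im) :
    ‖incErf l z‖ ≤ Real.exp (-π * (z.im * l ^ 2)) := by
  rcases eq_or_ne l 0 with rfl | hl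
  -- `Real.sign 0 = 0` and $E(0)=0$, so the term with $l=0$ vanishes.
  · simp [incErf, erfE]
  · have hsq : √(2 * z.im) ^ 2 = 2 * z.im := Real.sq_sqrt (by positivity)
    have h : |l.sign - erfE (l * √(2 * z.im))| ≤ Real.exp (-π * (2 * z.im * l ^ 2)) := by
      have := abs_sub_erfE_le (real_sign_eq hl) (x := l * √(2 * z.im)) (by
        rw [← mul_assoc]
        refine mul_nonneg ?_ (Real.sqrt_nonneg _)
        rcases lt_or_gt_of_ne hl with h | h
        · rw [Real.sign_of_neg h]; linarith
        · rw [Real.sign_of_pos h]; linarith)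
      rwa [mul_pow, hsq, mul_comm (l ^ 2)] at this
    rw [← norm_conjGauss, ← gauss_mul_e, incErf, norm_mul, norm_mul, Complex.norm_real,
      Complex.norm_real, Real.norm_eq_abs, Real.norm_eq_abs, Real.abs_exp]
    gcongr

lemma hasWirtingerAt_incErf (l : ℝ) {z : ℂ} (hz : 0 < z.im) :
    HasWirtingerAt (incErf l)
      (I * ((√(2 * z.im))⁻¹ : ℝ) * (l * conjGauss l z) - π * I * (l ^ 2 * incErf l z))
      (-I * ((√(2 * z.im))⁻¹ : ℝ) * (l * conjGauss l z)) z := by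
  have hsq : √(2 * z.im) ^ 2 = 2 * z.im := Real.sq_sqrt (by positivity)
  have h0 : HasDerivAt (fun t : ℝ ↦ √(2 * t)) ((√(2 * z.im))⁻¹) z.im := by
    have h1 : HasDerivAt (fun t : ℝ ↦ 2 * t) 2 z.im := by
      simpa using (hasDerivAt_id z.im).const_mul 2
    refine (h1.sqrt (by positivity)).congr_deriv ?_
    field_simp
  have h1 : HasDerivAt (fun t : ℝ ↦ l.sign - erfE (l * √(2 * t)))
      (-(2 * Real.exp (-π * (2 * z.im * l ^ 2)) * (l * (√(2 * z.im))⁻¹))) z.im := by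
    have := ((hasDerivAt_erfE (l * √(2 * z.im))).comp z.im (h0.const_mul l)).const_sub l.sign
    rwa [mul_pow, hsq, mul_comm (l ^ 2)] at this
  have h4 : HasDerivAt (fun w ↦ e (-(l : ℂ) ^ 2 / 2 * w))
      (-(π * I * l ^ 2) * e (-(l : ℂ) ^ 2 / 2 * z)) z := by
    have h5 : HasDerivAt (fun w : ℂ ↦ -(l : ℂ) ^ 2 / 2 * w) (-(l : ℂ) ^ 2 / 2) z := by
      simpa using (hasDerivAt_id z).const_mul (-(l : ℂ) ^ 2 / 2)
    refine ((hasDerivAt_e _).comp z h5).congr_deriv ?_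
    ring
  refine ((HasDerivAt.hasWirtingerAt_im h1).mul h4.hasWirtingerAt).congr_val ?_ ?_
  all_goals
    rw [← gauss_mul_e]
    try rw [incErf]
    push_cast
    ring

lemma hasWirtingerAt_conjGauss (l : ℝ) (z : ℂ) :
    HasWirtingerAt (conjGauss l) 0 (-π * I * (l ^ 2 * conjGauss l z)) z := by
  have h4 : HasDerivAt (fun w ↦ e ((l : ℂ) ^ 2 / 2 * w))
      ((π * I * l ^ 2) * e ((l : ℂ) ^ 2 / 2 * z)) z := by
    have h5 : HasDerivAt (fun w : ℂ ↦ (l : ℂ) ^ 2 / 2 * w) ((l : ℂ) ^ 2 / 2) z := by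
      simpa using (hasDerivAt_id z).const_mul ((l : ℂ) ^ 2 / 2)
    refine ((hasDerivAt_e _).comp z h5).congr_deriv ?_
    ring
  have h5 := Complex.conjCLE.hasFDerivAt.comp z h4.hasWirtingerAt
  refine HasFDerivAt.congr_fderiv (f := conjGauss l) h5 ?_
  ext w
  simp only [conjGauss, ContinuousLinearMap.comp_apply, wirtinger_apply, zero_mul, add_zero, zero_add,
    ContinuousLinearEquiv.coe_coe, Complex.conjCLE_apply, map_mul, map_pow, Complex.conj_ofReal, Complex.conj_I]
  ring

section series

variable {s : ℤ → ℂ} {c : ℝ}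

/-- `∑ s_n l_n ^ k (sgn l_n - E(l_n √(2y))) e(-l_n² z / 2)`, with `l_n = n + c`. -/
noncomputable def nonHolTheta (s : ℤ → ℂ) (c : ℝ) (k : ℕ) (z : ℂ) : ℂ :=
  ∑' n : ℤ, s n * ((n + c : ℝ) : ℂ) ^ k * incErf (n + c) z

/-- `∑ s_n l_n ^ k conj(e(l_n² z / 2))`, with `l_n = n + c`. -/
noncomputable def conjTheta (s : ℤ → ℂ) (c : ℝ) (k : ℕ) (z : ℂ) : ℂ :=
  ∑' n : ℤ, s n * ((n + c : ℝ) : ℂ) ^ k * conjGauss (n + c) z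

lemma summable_pow_gauss (c : ℝ) {y : ℝ} (hy : 0 < y) (k : ℕ) :
    Summable fun n : ℤ ↦ |(n : ℝ) + c| ^ k * Real.exp (-π * (y * ((n : ℝ) + c) ^ 2)) := by
  simpa using summable_gauss_shift c le_rfl hy k

lemma norm_pow_mul_le (hs : ∀ n, ‖s n‖ = 1) (k : ℕ) (n : ℤ) {x : ℂ} {r : ℝ} (hx : ‖x‖ ≤ r) :
    ‖s n * ((n + c : ℝ) : ℂ) ^ k * x‖ ≤ |(n : ℝ) + c| ^ k * r := by
  rw [norm_mul, norm_mul, hs, one_mul, norm_pow, Complex.norm_real, Real.norm_eq_abs]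
  gcongr

lemma summable_nonHolTheta (hs : ∀ n, ‖s n‖ = 1) (k : ℕ) {z : ℂ} (hz : 0 < z.im) :
    Summable fun n : ℤ ↦ s n * ((n + c : ℝ) : ℂ) ^ k * incErf (n + c) z :=
  Summable.of_norm_bounded (summable_pow_gauss c hz k)
    fun n ↦ norm_pow_mul_le hs k n (norm_incErf_le _ hz)

lemma summable_conjTheta (hs : ∀ n, ‖s n‖ = 1) (k : ℕ) {z : ℂ} (hz : 0 < z.im) :
    Summable fun n : ℤ ↦ s n * ((n + c : ℝ) : ℂ) ^ k * conjGauss (n + c) z :=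
  Summable.of_norm_bounded (summable_pow_gauss c hz k)
    fun n ↦ norm_pow_mul_le hs k n (norm_conjGauss _ z).le

lemma isPreconnected_lt_im (y : ℝ) : IsPreconnected {z : ℂ | y < z.im} := by
  have : Convex ℝ {z : ℂ | y < z.im} := (convex_Ioi y).linear_preimage Complex.imLm
  exact this.isPreconnected

lemma gauss_le_gauss {y y' : ℝ} (h : y ≤ y') (l : ℝ) :
    Real.exp (-π * (y' * l ^ 2)) ≤ Real.exp (-π * (y * l ^ 2)) := by
  refine Real.exp_le_exp.mpr ?_
  rw [neg_mul, neg_mul, neg_le_neg_iff]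
  have := Real.pi_pos
  gcongr

lemma hasWirtingerAt_nonHolTheta (hs : ∀ n, ‖s n‖ = 1) (k : ℕ) {z : ℂ} (hz : 0 < z.im) :
    HasWirtingerAt (nonHolTheta s c k)
      (I * ((√(2 * z.im))⁻¹ : ℝ) * conjTheta s c (k + 1) z - π * I * nonHolTheta s c (k + 2) z)
      (-I * ((√(2 * z.im))⁻¹ : ℝ) * conjTheta s c (k + 1) z) z := by
  have hz2 := half_pos hz
  -- On the half plane above $\mathrm{Im}(z)/2$ the Gaussian majorants are uniform.
  set y := z.im / 2
  have hzs : z ∈ {w : ℂ | y < w.im} := half_lt_self hz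
  have hf : ∀ (n : ℤ), ∀ w ∈ {w : ℂ | y < w.im}, HasWirtingerAt
      (fun w ↦ s n * ((n + c : ℝ) : ℂ) ^ k * incErf (n + c) w)
      (I * ((√(2 * w.im))⁻¹ : ℝ) * (s n * ((n + c : ℝ) : ℂ) ^ (k + 1) * conjGauss (n + c) w) -
        π * I * (s n * ((n + c : ℝ) : ℂ) ^ (k + 2) * incErf (n + c) w))
      (-I * ((√(2 * w.im))⁻¹ : ℝ) * (s n * ((n + c : ℝ) : ℂ) ^ (k + 1) * conjGauss (n + c) w))
      w := by
    intro n w hw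
    refine ((hasWirtingerAt_incErf (n + c) (hz2.trans hw)).const_mul
      (s n * ((n + c : ℝ) : ℂ) ^ k)).congr_val ?_ ?_ <;> ring
  have hb : ∀ (n : ℤ), ∀ w ∈ {w : ℂ | y < w.im}, ‖I * ((√(2 * w.im))⁻¹ : ℝ) *
      (s n * ((n + c : ℝ) : ℂ) ^ (k + 1) * conjGauss (n + c) w)‖ ≤
      (√(2 * y))⁻¹ * (|(n : ℝ) + c| ^ (k + 1) * Real.exp (-π * (y * ((n : ℝ) + c) ^ 2))) := by
    intro n w hw
    have hw' : y ≤ w.im := le_of_lt hw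
    rw [norm_mul, norm_mul, Complex.norm_I, one_mul, Complex.norm_real, norm_inv,
      Real.norm_eq_abs, abs_of_nonneg (Real.sqrt_nonneg _)]
    have h1 := norm_pow_mul_le (c := c) hs (k + 1) n
      ((norm_conjGauss (n + c) w).le.trans (gauss_le_gauss hw' _))
    gcongr
  have hp : ∀ (n : ℤ), ∀ w ∈ {w : ℂ | y < w.im},
      ‖π * I * (s n * ((n + c : ℝ) : ℂ) ^ (k + 2) * incErf (n + c) w)‖ ≤
      π * (|(n : ℝ) + c| ^ (k + 2) * Real.exp (-π * (y * ((n : ℝ) + c) ^ 2))) := by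
    intro n w hw
    have hw' : y ≤ w.im := le_of_lt hw
    rw [norm_mul, norm_mul, Complex.norm_I, mul_one, Complex.norm_real, Real.norm_eq_abs,
      abs_of_pos Real.pi_pos]
    have h1 := norm_pow_mul_le (c := c) hs (k + 2) n
      ((norm_incErf_le (n + c) (hz2.trans hw)).trans (gauss_le_gauss hw' _))
    have := Real.pi_pos
    gcongr
  have hu := ((summable_pow_gauss c hz2 (k + 1)).mul_left (√(2 * y))⁻¹).add
    ((summable_pow_gauss c hz2 (k + 2)).mul_left π)
  have key := hasWirtingerAt_tsum (isOpen_lt continuous_const Complex.continuous_im)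
    (isPreconnected_lt_im y) hu hf
    (fun n w hw ↦ (norm_sub_le _ _).trans (add_le_add (hb n w hw) (hp n w hw)))
    (fun n w hw ↦ by
      rw [neg_mul, neg_mul, norm_neg]
      exact (hb n w hw).trans (le_add_of_nonneg_right (by have := Real.pi_pos; positivity)))
    hzs (summable_nonHolTheta hs k hz) hzs
  refine HasWirtingerAt.congr_val (f := nonHolTheta s c k) key ?_ ?_
  · rw [Summable.tsum_sub ((summable_conjTheta hs (k + 1) hz).mul_left _)
      ((summable_nonHolTheta hs (k + 2) hz).mul_left _), tsum_mul_left, tsum_mul_left]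
    rfl
  · rw [tsum_mul_left]
    rfl

lemma hasWirtingerAt_conjTheta (hs : ∀ n, ‖s n‖ = 1) (k : ℕ) {z : ℂ} (hz : 0 < z.im) :
    HasWirtingerAt (conjTheta s c k) 0 (-π * I * conjTheta s c (k + 2) z) z := by
  have hz2 := half_pos hz
  set y := z.im / 2
  have hzs : z ∈ {w : ℂ | y < w.im} := half_lt_self hz
  have hf : ∀ (n : ℤ), ∀ w ∈ {w : ℂ | y < w.im}, HasWirtingerAt
      (fun w ↦ s n * ((n + c : ℝ) : ℂ) ^ k * conjGauss (n + c) w) 0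
      (-π * I * (s n * ((n + c : ℝ) : ℂ) ^ (k + 2) * conjGauss (n + c) w)) w := by
    intro n w hw
    refine ((hasWirtingerAt_conjGauss (n + c) w).const_mul
      (s n * ((n + c : ℝ) : ℂ) ^ k)).congr_val ?_ ?_ <;> ring
  have hu := (summable_pow_gauss c hz2 (k + 2)).mul_left π
  have key := hasWirtingerAt_tsum (isOpen_lt continuous_const Complex.continuous_im)
    (isPreconnected_lt_im y) hu hf
    (fun n w hw ↦ by have := Real.pi_pos; rw [norm_zero]; positivity)
    (fun n w hw ↦ by
      have hw' : y ≤ w.im := le_of_lt hw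
      rw [norm_mul, norm_mul, Complex.norm_I, mul_one, norm_neg, Complex.norm_real,
        Real.norm_eq_abs, abs_of_pos Real.pi_pos]
      have h1 := norm_pow_mul_le (c := c) hs (k + 2) n
        ((norm_conjGauss (n + c) w).le.trans (gauss_le_gauss hw' _))
      have := Real.pi_pos
      gcongr)
    hzs (summable_conjTheta hs k hz) hzs
  refine HasWirtingerAt.congr_val (f := conjTheta s c k) key tsum_zero ?_
  rw [tsum_mul_left]
  rfl

/-- Differentiation raises the weight $l^k$ to $l^{k+2}$ within the same family, so the induction on
the order of smoothness has to be uniform in $k$. `contDiffOn_nonHolTheta` runs the same way. -/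
lemma contDiffOn_conjTheta (hs : ∀ n, ‖s n‖ = 1) (n k : ℕ) :
    ContDiffOn ℝ n (conjTheta s c k) {z : ℂ | 0 < z.im} := by
  induction n generalizing k with
  | zero =>
    exact contDiffOn_zero.mpr fun z hz ↦
      (HasFDerivAt.continuousAt (hasWirtingerAt_conjTheta hs k hz)).continuousWithinAt
  | succ n ih =>
    exact contDiffOn_succ_of_wirtinger (fun z hz ↦ hasWirtingerAt_conjTheta hs k hz)
      contDiffOn_const (contDiffOn_const.mul (ih (k + 2)))

lemma contDiffOn_nonHolTheta (hs : ∀ n, ‖s n‖ = 1) (n k : ℕ) :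
    ContDiffOn ℝ n (nonHolTheta s c k) {z : ℂ | 0 < z.im} := by
  induction n generalizing k with
  | zero =>
    exact contDiffOn_zero.mpr fun z hz ↦
      (HasFDerivAt.continuousAt (hasWirtingerAt_nonHolTheta hs k hz)).continuousWithinAt
  | succ n ih =>
    have h := contDiffOn_conjTheta (c := c) hs n (k + 1)
    exact contDiffOn_succ_of_wirtinger (fun z hz ↦ hasWirtingerAt_nonHolTheta hs k hz)
      (((contDiffOn_const.mul contDiffOn_inv_sqrt_im).mul h).sub
        (contDiffOn_const.mul (ih (k + 2))))
      ((contDiffOn_const.mul contDiffOn_inv_sqrt_im).mul h)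

end series

end EtaTheta

/-! ### Harmonicity, the splitting at torsion points and Fourier expansions. -/

namespace EtaTheta

open Filter Topology Asymptotics

/-! ### Harmonicity from Wirtinger derivatives -/

lemma partialX_eq {F : ℍ → ℂ} {p b : ℂ} {τ : ℍ} (h : HasWirtingerAt (F ∘ ofComplex) p b τ) :
    partialX F τ = p + b := by
  rw [partialX, HasFDerivAt.fderiv h]; simp

lemma partialY_eq {F : ℍ → ℂ} {p b : ℂ} {τ : ℍ} (h : HasWirtingerAt (F ∘ ofComplex) p b τ) :
    partialY F τ = I * (p - b) := by
  rw [partialY, HasFDerivAt.fderiv h]; simp; ring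

/-- Harmonicity of weight `1/2`, in terms of Wirtinger derivatives: `b` is `∂F/∂(conj τ)`. -/
structure HarmonicHalf (F : ℍ → ℂ) (b : ℂ → ℂ) : Prop where
  smooth : ContDiffOn ℝ ∞ (F ∘ ofComplex) {z : ℂ | 0 < z.im}
  wirtinger : ∃ p : ℂ → ℂ, ∀ z : ℂ, 0 < z.im → HasWirtingerAt (F ∘ ofComplex) (p z) (b z) z ∧
    ∃ p₁ b₂ c, HasWirtingerAt p p₁ c z ∧ HasWirtingerAt b c b₂ z ∧ 4 * z.im * c = I * b z

lemma HarmonicHalf.add {F G : ℍ → ℂ} {b b' : ℂ → ℂ} (hF : HarmonicHalf F b)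
    (hG : HarmonicHalf G b') : HarmonicHalf (fun τ ↦ F τ + G τ) fun z ↦ b z + b' z := by
  obtain ⟨hs, p, hp⟩ := hF
  obtain ⟨hs', p', hp'⟩ := hG
  refine ⟨hs.add hs', fun z ↦ p z + p' z, fun z hz ↦ ?_⟩
  obtain ⟨h1, p₁, b₂, c, h2, h3, h4⟩ := hp z hz
  obtain ⟨h1', p₁', b₂', c', h2', h3', h4'⟩ := hp' z hz
  exact ⟨h1.add h1', _, _, _, h2.add h2', h3.add h3', by rw [mul_add, mul_add, h4, h4']⟩

lemma HarmonicHalf.const_mul {F : ℍ → ℂ} {b : ℂ → ℂ} (hF : HarmonicHalf F b) (a : ℂ) :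
    HarmonicHalf (fun τ ↦ a * F τ) fun z ↦ a * b z := by
  obtain ⟨hs, p, hp⟩ := hF
  refine ⟨contDiffOn_const.mul hs, fun z ↦ a * p z, fun z hz ↦ ?_⟩
  obtain ⟨h1, p₁, b₂, c, h2, h3, h4⟩ := hp z hz
  exact ⟨h1.const_mul a, _, _, _, h2.const_mul a, h3.const_mul a, by
    rw [mul_left_comm, h4]; ring⟩

lemma ofComplex_coe_of_im_pos {z : ℂ} (hz : 0 < z.im) : ((ofComplex z : ℍ) : ℂ) = z := by
  rw [ofComplex_apply_of_im_pos hz]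

/-- In weight $1/2$ the Laplacian is $-4y^2\partial\bar\partial+iy\bar\partial$, so harmonicity
reads $4y\,\partial\bar\partial F=i\,\bar\partial F$. The structure uses one $c$ for both orders of
the mixed derivative. -/
lemma HarmonicHalf.weightLaplacian_eq_zero {F : ℍ → ℂ} {b : ℂ → ℂ} (h : HarmonicHalf F b)
    (τ : ℍ) : weightLaplacian (1 / 2) F τ = 0 := by
  obtain ⟨p, hp⟩ := h.wirtinger
  obtain ⟨h1, p₁, b₂, c, h2, h3, h4⟩ := hp τ τ.im_pos
  have hev : ∀ᶠ z : ℂ in 𝓝 (τ : ℂ), 0 < z.im := isOpen_im_pos.mem_nhds τ.im_pos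
  have hX : HasWirtingerAt (partialX F ∘ ofComplex) (p₁ + c) (c + b₂) τ := by
    refine HasFDerivAt.congr_of_eventuallyEq (h2.add h3) ?_
    filter_upwards [hev] with z hz
    refine partialX_eq (τ := ofComplex z) ?_
    rw [ofComplex_coe_of_im_pos hz]
    exact (hp z hz).1
  have hY : HasWirtingerAt (partialY F ∘ ofComplex) (I * (p₁ + -1 * c)) (I * (c + -1 * b₂)) τ := by
    refine HasFDerivAt.congr_of_eventuallyEq ((h2.add (h3.const_mul (-1))).const_mul I) ?_
    filter_upwards [hev] with z hz
    refine (partialY_eq (τ := ofComplex z) (p := p z) (b := b z) ?_).trans (by ring)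
    rw [ofComplex_coe_of_im_pos hz]
    exact (hp z hz).1
  rw [weightLaplacian, partialX_eq hX, partialY_eq hY, partialX_eq h1, partialY_eq h1]
  rw [coe_im] at h4
  push_cast
  linear_combination (-τ.im : ℂ) * h4 + (-(τ.im : ℂ) ^ 2 * (p₁ - 2 * c + b₂) + I * τ.im / 2 * (p τ - b τ)) * Complex.I_sq

lemma HarmonicHalf.xiOperator_eq {F : ℍ → ℂ} {b : ℂ → ℂ} (h : HarmonicHalf F b)
    (τ : ℍ) : xiOperator (1 / 2) F τ = 2 * I * (√τ.im : ℝ) * (starRingEnd ℂ) (b τ) := by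
  obtain ⟨p, hp⟩ := h.wirtinger
  obtain ⟨h1, -⟩ := hp τ τ.im_pos
  rw [xiOperator, partialX_eq h1, partialY_eq h1, Real.sqrt_eq_rpow]
  congr 2
  linear_combination (p τ - b τ) / 2 * Complex.I_sq

/-! ### Holomorphic functions on the upper half plane -/

/-- Holomorphy on the upper half plane. -/
def HolUHP (f : ℍ → ℂ) : Prop := DifferentiableOn ℂ (f ∘ ofComplex) {z : ℂ | 0 < z.im}

lemma HolUHP.of_eq {f : ℍ → ℂ} {g : ℂ → ℂ} (h : ∀ τ : ℍ, f τ = g τ)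
    (hg : DifferentiableOn ℂ g {z : ℂ | 0 < z.im}) : HolUHP f :=
  hg.congr fun z hz ↦ by rw [Function.comp_apply, h, ofComplex_coe_of_im_pos hz]

lemma HolUHP.add {f g : ℍ → ℂ} (hf : HolUHP f) (hg : HolUHP g) : HolUHP fun τ ↦ f τ + g τ :=
  DifferentiableOn.add hf hg

lemma HolUHP.mul {f g : ℍ → ℂ} (hf : HolUHP f) (hg : HolUHP g) : HolUHP fun τ ↦ f τ * g τ :=
  DifferentiableOn.mul hf hg

lemma HolUHP.inv {f : ℍ → ℂ} (hf : HolUHP f) (h : ∀ τ, f τ ≠ 0) : HolUHP fun τ ↦ (f τ)⁻¹ :=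
  DifferentiableOn.inv hf fun _ _ ↦ h _

lemma holUHP_const (c : ℂ) : HolUHP fun _ ↦ c := differentiableOn_const c

lemma HolUHP.const_mul {f : ℍ → ℂ} (hf : HolUHP f) (c : ℂ) : HolUHP fun τ ↦ c * f τ :=
  (holUHP_const c).mul hf

lemma holUHP_e (a b : ℂ) : HolUHP fun τ ↦ e (a * τ + b) :=
  .of_eq (g := fun z ↦ e (a * z + b)) (fun _ ↦ rfl) (by fun_prop)

lemma HolUHP.harmonicHalf {f : ℍ → ℂ} (hf : HolUHP f) : HarmonicHalf f fun _ ↦ 0 := by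
  refine ⟨(DifferentiableOn.contDiffOn hf isOpen_im_pos).restrict_scalars ℝ, deriv (f ∘ ofComplex), fun z hz ↦ ?_⟩
  have hd := DifferentiableOn.deriv hf isOpen_im_pos
  refine ⟨((hf z hz).differentiableAt (isOpen_im_pos.mem_nhds hz)).hasDerivAt.hasWirtingerAt,
    _, 0, 0, ((hd z hz).differentiableAt (isOpen_im_pos.mem_nhds hz)).hasDerivAt.hasWirtingerAt,
    (hasDerivAt_const z (0 : ℂ)).hasWirtingerAt, by simp⟩

lemma holUHP_vartheta (a b : ℝ) : HolUHP fun τ ↦ vartheta (a * τ + b) τ := by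
  refine .of_eq (g := fun z ↦ e ((a * z + b + 1 / 2) / 2 + z / 8) *
    jacobiTheta₂ (a * z + b + 1 / 2 + z / 2) z) (fun τ ↦ vartheta_eq _ τ) fun z hz ↦ ?_
  have h1 : DifferentiableAt ℂ (fun p : ℂ × ℂ ↦ jacobiTheta₂ p.1 p.2)
      (a * z + b + 1 / 2 + z / 2, z) := (hasFDerivAt_jacobiTheta₂ _ hz).differentiableAt
  have h2 : DifferentiableAt ℂ (fun z : ℂ ↦ ((a * z + b + 1 / 2 + z / 2, z) : ℂ × ℂ)) z := by
    fun_prop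
  have h3 : DifferentiableAt ℂ (fun z : ℂ ↦ jacobiTheta₂ (a * z + b + 1 / 2 + z / 2) z) z :=
    DifferentiableAt.comp (f := fun z : ℂ ↦ ((a * z + b + 1 / 2 + z / 2, z) : ℂ × ℂ)) z h1 h2
  exact (DifferentiableAt.mul (by fun_prop) h3).differentiableWithinAt

lemma holUHP_appellSum {p r : ℝ} (h : NotBothInt p r) (a b : ℝ) :
    HolUHP fun τ ↦ appellSum (p * τ + r) (a * τ + b) τ := by
  let F : ℤ → ℂ → ℂ := fun n z ↦ (-1 : ℂ) ^ n * e (n * (a * z + b)) *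
    e ((n : ℂ) * (n + 1) / 2 * z) / (1 - e (p * z + r) * e (n * z))
  refine .of_eq (g := fun z ↦ ∑' n, F n z) (fun τ ↦ rfl) fun z hz ↦ ?_
  have hz2 : 0 < z.im / 2 := half_pos hz
  obtain ⟨c, hc, hle⟩ := exists_le_norm_one_sub h hz2
  -- The lower edge keeps the denominators away from zero; the upper edge bounds the factor
  -- $e^{C\,\mathrm{Im}\,w}$.
  let s : Set ℂ := Complex.im ⁻¹' Set.Ioo (z.im / 2) (2 * z.im)
  have hs : IsOpen s := isOpen_Ioo.preimage Complex.continuous_im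
  have hzs : z ∈ s := ⟨half_lt_self hz, by have : 0 < z.im := hz; linarith⟩
  have hpos : ∀ w ∈ s, 0 < w.im := fun w hw ↦ hz2.trans hw.1
  have key := Complex.differentiableOn_tsum_of_summable_norm (F := F) (U := s)
    ((summable_gauss_int hz2 c).mul_left (Real.exp (2 * π * (|a| + 1 / 2) ^ 2 * (2 * z.im))))
    (fun n w hw ↦ ?_) hs (fun n w hw ↦ ?_)
  · exact (key.differentiableAt (hs.mem_nhds hzs)).differentiableWithinAt
  · have : 1 - e (p * w + r) * e (n * w) ≠ 0 :=
      NonLattice.one_sub_ne_zero (h.nonLattice ⟨w, hpos w hw⟩) n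
    exact (DifferentiableAt.div (c := fun w : ℂ ↦ (-1 : ℂ) ^ n * e (n * (a * w + b)) *
      e ((n : ℂ) * (n + 1) / 2 * w)) (d := fun w : ℂ ↦ 1 - e (p * w + r) * e (n * w))
      (by fun_prop) (by fun_prop) this).differentiableWithinAt
  · refine (norm_appell_line_le (τ := ⟨w, hpos w hw⟩) (a := a) (b := b) hz2 hc hle n hw.1.le).trans ?_
    have : w.im ≤ 2 * z.im := hw.2.le
    have := Real.pi_pos
    change Real.exp (2 * π * (|a| + 1 / 2) ^ 2 * w.im) * _ ≤ _
    gcongr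

lemma holUHP_torsionMu {a b a' b' : ℝ} (h : NotBothInt a b) (h' : NotBothInt a' b') :
    HolUHP (torsionMu a b a' b') := by
  have h1 := ((holUHP_e ((-(a - a') ^ 2 / 2 : ℝ) : ℂ) 0).mul (holUHP_e (a / 2) (b / 2))).mul
    ((holUHP_vartheta a' b').inv fun τ ↦ vartheta_ne_zero (h'.nonLattice τ))
  have h2 := h1.mul (holUHP_appellSum h a' b')
  refine DifferentiableOn.congr h2 fun z _ ↦ ?_
  simp only [Function.comp_apply, torsionMu, mu, add_zero]
  rw [← appellSum, add_div, show (a : ℂ) * (ofComplex z : ℍ) / 2 = a / 2 * (ofComplex z : ℍ) by ring]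
  ring

/-! ### The non-holomorphic part -/

/-- The phases of the theta series attached to a torsion point. -/
noncomputable def torsionSign (b : ℝ) (n : ℤ) : ℂ := (-1 : ℂ) ^ n * e (-(((n : ℝ) + 1 / 2) * b : ℝ))

lemma norm_torsionSign (b : ℝ) (n : ℤ) : ‖torsionSign b n‖ = 1 := by
  rw [torsionSign, ← Complex.ofReal_neg, norm_mul, norm_e_ofReal, norm_zpow, norm_neg, norm_one,
    one_zpow, one_mul]

/-- This is where $|\alpha|<1/2$ enters: without a sign mismatch, the normalised $R$ has no
holomorphic contribution, and $\mu$ itself is the holomorphic part. -/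
lemma sign_add_of_abs_lt {a : ℝ} (ha : |a| < 1 / 2) (n : ℤ) :
    ((n : ℝ) + 1 / 2).sign = ((n : ℝ) + (1 / 2 + a)).sign := by
  obtain ⟨h1, h2⟩ := abs_lt.mp ha
  rcases le_or_gt 0 n with hn | hn
  · have : (0 : ℝ) ≤ n := by exact_mod_cast hn
    rw [Real.sign_of_pos (by linarith), Real.sign_of_pos (by linarith)]
  · have : (n : ℝ) ≤ -1 := by exact_mod_cast (by omega : n ≤ -1)
    rw [Real.sign_of_neg (by linarith), Real.sign_of_neg (by linarith)]

lemma torsionR_term_eq {a : ℝ} (ha : |a| < 1 / 2) (b : ℝ) (τ : ℍ) (n : ℤ) :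
    e (((-a ^ 2 / 2 : ℝ) : ℂ) * τ) * termR n (a * τ + b) τ =
      torsionSign b n * incErf (n + (1 / 2 + a)) τ := by
  have him : (a * τ + b : ℂ).im / τ.im = a := by
    have := τ.im_ne_zero
    simp [this]
  rw [termR, incErf, him, sign_add_of_abs_lt ha, phaseR, torsionSign, coe_im, ← add_assoc]
  have : e (((-a ^ 2 / 2 : ℝ) : ℂ) * τ) *
      e (-((n : ℂ) + 1 / 2) ^ 2 / 2 * τ - ((n : ℂ) + 1 / 2) * (a * τ + b)) =
      e (-(((n : ℝ) + 1 / 2) * b : ℝ)) * e (-((n + 1 / 2 + a : ℝ) : ℂ) ^ 2 / 2 * τ) := by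
    rw [← e_add, ← e_add]
    congr 1
    push_cast
    ring
  linear_combination ((((n : ℝ) + 1 / 2 + a).sign -
    erfE (((n : ℝ) + 1 / 2 + a) * √(2 * τ.im)) : ℝ) : ℂ) * (-1) ^ n * this

lemma torsionR_eq {a : ℝ} (ha : |a| < 1 / 2) (b : ℝ) (τ : ℍ) :
    torsionR a b τ = nonHolTheta (torsionSign b) (1 / 2 + a) 0 τ := by
  rw [torsionR, zwegersR_eq, nonHolTheta, ← tsum_mul_left]
  refine tsum_congr fun n ↦ ?_
  rw [pow_zero, mul_one]
  exact torsionR_term_eq ha b τ n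

/-- $\bar\partial$ yields $(2y)^{-1/2}$ times an antiholomorphic series, so $\partial$ acts on the
power of $y$ alone and multiplies by $i/(4y)$. This is the harmonicity equation. -/
lemma harmonicHalf_torsionR {a : ℝ} (ha : |a| < 1 / 2) (b : ℝ) :
    HarmonicHalf (torsionR a b) fun z ↦ (((√(2 * z.im))⁻¹ : ℝ) : ℂ) *
      (-I * conjTheta (torsionSign b) (1 / 2 + a) 1 z) := by
  have hs := norm_torsionSign b
  set s := torsionSign b
  set c := 1 / 2 + a
  have heq : ∀ z ∈ {z : ℂ | 0 < z.im}, (torsionR a b ∘ ofComplex) z = nonHolTheta s c 0 z := by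
    intro z hz
    rw [Function.comp_apply, torsionR_eq ha, ofComplex_coe_of_im_pos hz]
  refine ⟨(contDiffOn_infty.mpr fun n ↦ contDiffOn_nonHolTheta hs n 0).congr heq, fun z ↦
    (((√(2 * z.im))⁻¹ : ℝ) : ℂ) * (I * conjTheta s c 1 z) + -(π * I) * nonHolTheta s c 2 z,
    fun z hz ↦ ⟨?_, ?_⟩⟩
  · have h1 := hasWirtingerAt_nonHolTheta (c := c) hs 0 hz
    refine HasWirtingerAt.congr_val (p := _) (b := _) (HasFDerivAt.congr_of_eventuallyEq h1 ?_)
      (by ring) (by ring)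
    filter_upwards [isOpen_im_pos.mem_nhds hz] with w hw
    exact heq w hw
  · have h1 := hasWirtingerAt_conjTheta (c := c) hs 1 hz
    have h2 := hasWirtingerAt_nonHolTheta (c := c) hs 2 hz
    have h3 := hasWirtingerAt_inv_sqrt_im hz
    have hz0 : (z.im : ℂ) ≠ 0 := by exact_mod_cast hz.ne'
    refine ⟨_, _, I / (4 * z.im) * ((√(2 * z.im))⁻¹ : ℝ) * (-I * conjTheta s c 1 z),
      ((h3.mul (h1.const_mul I)).add (h2.const_mul (-(π * I)))).congr_val rfl ?_,
      (h3.mul (h1.const_mul (-I))).congr_val (by ring) rfl, ?_⟩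
    · ring
    · field_simp

/-- The weight `3/2` theta series whose conjugate is the `∂/∂(conj τ)`-derivative of `μ̂`. -/
noncomputable def shadowTheta (a b : ℝ) (τ : ℂ) : ℂ :=
  ∑' n : ℤ, (-1 : ℂ) ^ n * e ((((n : ℝ) + 1 / 2) * b : ℝ)) * ((n + 1 / 2 + a : ℝ) : ℂ) *
    e (((n + 1 / 2 + a : ℝ) : ℂ) ^ 2 / 2 * τ)

lemma conj_conjTheta (a b : ℝ) (z : ℂ) :
    (starRingEnd ℂ) (conjTheta (torsionSign b) (1 / 2 + a) 1 z) = shadowTheta a b z := by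
  rw [conjTheta, Complex.conj_tsum, shadowTheta]
  refine tsum_congr fun n ↦ ?_
  rw [torsionSign, conjGauss, map_mul, map_mul, map_mul, Complex.conj_conj, map_zpow₀, map_neg,
    map_one, map_pow, Complex.conj_ofReal, pow_one, conj_e, map_neg, Complex.conj_ofReal, neg_neg,
    add_assoc]

lemma harmonicHalf_torsionMuHat {a b a' b' : ℝ} (h : NotBothInt a b) (h' : NotBothInt a' b')
    (ha : |a - a'| < 1 / 2) : HarmonicHalf (torsionMuHat a b a' b') fun z ↦ 0 + I / 2 *
      ((((√(2 * z.im))⁻¹ : ℝ) : ℂ) *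
        (-I * conjTheta (torsionSign (b - b')) (1 / 2 + (a - a')) 1 z)) := by
  have := (holUHP_torsionMu h h').harmonicHalf.add
    ((harmonicHalf_torsionR ha (b - b')).const_mul (I / 2))
  rwa [← funext (torsionMuHat_eq a b a' b')] at this

lemma HarmonicHalf.xi_torsionMuHat {F : ℍ → ℂ} {w : ℂ} {a b : ℝ}
    (h : HarmonicHalf F fun z ↦ w * (0 + I / 2 * ((((√(2 * z.im))⁻¹ : ℝ) : ℂ) *
        (-I * conjTheta (torsionSign b) (1 / 2 + a) 1 z)))) (τ : ℍ) :
    xiOperator (1 / 2) F τ = I * ((√2)⁻¹ : ℝ) * (starRingEnd ℂ) w * shadowTheta a b τ := by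
  rw [h.xiOperator_eq]
  simp only [map_mul, map_add, map_zero, map_div₀, map_neg, Complex.conj_I, Complex.conj_ofNat,
    Complex.conj_ofReal, conj_conjTheta, coe_im]
  have h1 : (√(2 * τ.im))⁻¹ * √τ.im = (√2)⁻¹ := by
    rw [Real.sqrt_mul zero_le_two]
    have : √τ.im ≠ 0 := (Real.sqrt_pos.mpr τ.im_pos).ne'
    field_simp
  rw [← h1]
  push_cast
  linear_combination (-I * (starRingEnd ℂ) w * shadowTheta a b τ * √τ.im * (√(2 * τ.im))⁻¹) *
    Complex.I_sq

/-! ### Fourier expansions -/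

/-- A large power of $q^{1/N}$ makes the function bounded at $i\infty$; its power series in
$q^{1/N}$, shifted back, is the expansion. -/
lemma HolUHP.exists_hasSum {f : ℍ → ℂ} (hf : HolUHP f) (hg : ExpGrowth f) {N : ℕ} (hN : 0 < N)
    (hper : ∀ τ τ' : ℍ, (τ' : ℂ) = τ + N → f τ' = f τ) :
    ∃ (n₀ : ℤ) (c : ℕ → ℂ), ∀ τ : ℍ,
      HasSum (fun n : ℕ ↦ c n * e (((n : ℂ) + (n₀ : ℂ)) * τ / N)) (f τ) := by
  obtain ⟨C, hC⟩ := hg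
  have hN' : (0 : ℝ) < N := by exact_mod_cast hN
  have hN0 : (N : ℂ) ≠ 0 := by exact_mod_cast hN.ne'
  -- $|q^{M/N}|=e^{-2\pi My/N}$ then beats $e^{Cy}$. The expansion starts at $n_0=-M$.
  obtain ⟨M, hM⟩ := exists_nat_ge (C * N / (2 * π))
  let g : ℍ → ℂ := fun τ ↦ e (M / N * τ + 0) * f τ
  have hgh : HolUHP g := (holUHP_e _ _).mul hf
  have hgper : Function.Periodic (g ∘ ofComplex) (N : ℝ) := by
    intro w
    rcases lt_or_ge 0 w.im with hw | hw
    · have hw' : 0 < (w + ((N : ℝ) : ℂ)).im := by simpa using hw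
      simp only [Function.comp_apply, g]
      rw [hper (ofComplex w) (ofComplex (w + ((N : ℝ) : ℂ))) (by
        rw [ofComplex_coe_of_im_pos hw, ofComplex_coe_of_im_pos hw']; simp),
        ofComplex_coe_of_im_pos hw, ofComplex_coe_of_im_pos hw']
      congr 1
      refine e_mul_int_of_exp M ?_
      push_cast
      field_simp
      ring
    · have : (w + ((N : ℝ) : ℂ)).im ≤ 0 := by simpa using hw
      rw [Function.comp_apply, Function.comp_apply, ofComplex_apply_of_im_nonpos this,
        ofComplex_apply_of_im_nonpos hw]
  have hbdd : IsBoundedAtImInfty g := by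
    have h1 : (fun τ : ℍ ↦ e (M / N * τ + 0)) =O[atImInfty]
        fun τ : ℍ ↦ Real.exp (-C * τ.im) := by
      refine IsBigO.of_bound 1 (.of_forall fun τ ↦ ?_)
      have := norm_e_lin (M / N) 0 τ
      push_cast at this
      rw [this, e_zero, norm_one, one_mul, one_mul, Real.norm_eq_abs, Real.abs_exp]
      have hτ := τ.im_pos
      refine Real.exp_le_exp.mpr ?_
      have : C ≤ 2 * π * (M / N) := by
        rw [div_le_iff₀ (by positivity)] at hM
        rw [← mul_div_assoc, le_div_iff₀ hN']
        linarith
      nlinarith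
    refine ((h1.mul hC).congr_right fun τ ↦ ?_)
    rw [← Real.exp_add]
    simp
  have hsum := hasSum_qExpansion hN' hgper (UpperHalfPlane.mdifferentiable_iff.mpr hgh) hbdd
  refine ⟨-M, fun n ↦ (qExpansion (N : ℝ) g).coeff n, fun τ ↦ ?_⟩
  have := (hsum τ).mul_left (e (-(M / N * τ)))
  have hfin : e (-(M / N * τ)) * g τ = f τ := by
    simp only [g]
    rw [add_zero, e_neg, inv_mul_cancel_left₀ (e_ne_zero _)]
  rw [hfin] at this
  refine this.congr_fun fun n ↦ ?_
  rw [smul_eq_mul, mul_left_comm]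
  congr 1
  rw [Function.Periodic.qParam, ← Complex.exp_nat_mul, e, e, ← Complex.exp_add]
  congr 1
  push_cast
  field_simp
  ring

/-- The shape of the non-holomorphic part of a harmonic Maass form of weight `1/2` whose shadow is
a cusp form. -/
def NonHolExpansion (N : ℕ) (G : ℍ → ℂ) : Prop := ∃ b : ℕ → ℂ, ∀ τ : ℍ,
  HasSum (fun n : ℕ ↦ b n * (upperGamma (1 - 1 / 2) (4 * π * ((n : ℝ) + 1) * τ.im / N) : ℂ)
      * e (-((n : ℂ) + 1) * τ / N)) (G τ)

lemma NonHolExpansion.add {N : ℕ} {F G : ℍ → ℂ} (hF : NonHolExpansion N F)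
    (hG : NonHolExpansion N G) : NonHolExpansion N fun τ ↦ F τ + G τ := by
  obtain ⟨b, hb⟩ := hF
  obtain ⟨b', hb'⟩ := hG
  exact ⟨fun n ↦ b n + b' n, fun τ ↦ ((hb τ).add (hb' τ)).congr_fun fun n ↦ by ring⟩

lemma NonHolExpansion.const_mul {N : ℕ} {F : ℍ → ℂ} (hF : NonHolExpansion N F) (c : ℂ) :
    NonHolExpansion N fun τ ↦ c * F τ := by
  obtain ⟨b, hb⟩ := hF
  exact ⟨fun n ↦ c * b n, fun τ ↦ ((hb τ).mul_left c).congr_fun fun n ↦ by ring⟩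

open MeasureTheory in
-- Substitute $s=\pi t^2$ in the Gaussian tail.
lemma one_sub_erfE_eq_upperGamma {x : ℝ} (hx : 0 < x) :
    1 - erfE x = (√π)⁻¹ * upperGamma (1 / 2) (π * x ^ 2) := by
  have hpi := Real.pi_pos
  have hpt : ∀ t : ℝ, 0 < t → (π * t ^ 2) ^ ((1 / 2 : ℝ) - 1) * Real.exp (-(π * t ^ 2)) *
      (2 * π * t) = 2 * √π * Real.exp (-π * t ^ 2) := by
    intro t ht
    rw [show (1 / 2 : ℝ) - 1 = -(1 / 2) by norm_num, Real.rpow_neg (by positivity),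
      ← Real.sqrt_eq_rpow, Real.sqrt_mul hpi.le, Real.sqrt_sq ht.le, neg_mul]
    have : √π ≠ 0 := by positivity
    field_simp
    rw [Real.sq_sqrt hpi.le]
  have himage : ∀ t ∈ (fun t : ℝ ↦ π * t ^ 2) '' Set.Ici x, 0 < t := by
    rintro _ ⟨t, ht, rfl⟩
    have : 0 < t := hx.trans_le ht
    positivity
  have key := integral_comp_mul_deriv_Ioi (a := x) (f := fun t : ℝ ↦ π * t ^ 2)
    (f' := fun t ↦ 2 * π * t) (g := fun t ↦ t ^ ((1 / 2 : ℝ) - 1) * Real.exp (-t))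
    (by fun_prop)
    (Tendsto.const_mul_atTop hpi (tendsto_pow_atTop two_ne_zero))
    (fun t _ ↦ by
      have := ((hasDerivAt_pow 2 t).const_mul π)
      refine (this.congr_deriv ?_).hasDerivWithinAt
      push_cast
      ring) ?_ ?_ ?_
  · rw [upperGamma, ← key, one_sub_erfE, ← integral_const_mul, ← integral_const_mul]
    refine setIntegral_congr_fun measurableSet_Ioi fun t ht ↦ ?_
    have := hpt t (hx.trans ht)
    simp only [Function.comp_apply]
    rw [this]
    have : √π ≠ 0 := by positivity
    field_simp
  · exact ContinuousOn.mul (ContinuousOn.rpow_const continuousOn_id fun t ht ↦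
      Or.inl (himage t (Set.image_mono Set.Ioi_subset_Ici_self ht)).ne') (by fun_prop)
  · refine (Real.GammaIntegral_convergent (s := 1 / 2) (by norm_num)).mono_set himage |>.congr_fun_ae
      (.of_forall fun t ↦ mul_comm _ _)
  · refine IntegrableOn.congr_fun (f := fun t ↦ 2 * √π * Real.exp (-π * t ^ 2))
      (integrable_gauss.const_mul _).integrableOn (fun t ht ↦ ?_) measurableSet_Ici
    exact (hpt t (hx.trans_le ht)).symm

lemma incErf_eq (l : ℝ) (hl : l ≠ 0) {z : ℂ} (hz : 0 < z.im) :
    incErf l z = l.sign * (√π)⁻¹ * upperGamma (1 / 2) (2 * π * l ^ 2 * z.im) *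
      e (-(l : ℂ) ^ 2 / 2 * z) := by
  have h2 : l.sign - erfE (l * √(2 * z.im)) = l.sign * (1 - erfE (|l| * √(2 * z.im))) := by
    rcases lt_or_gt_of_ne hl with h | h
    · rw [Real.sign_of_neg h, abs_of_neg h, neg_mul, neg_mul, erfE_neg]; ring
    · rw [Real.sign_of_pos h, abs_of_pos h]; ring
  rw [incErf, h2, one_sub_erfE_eq_upperGamma (by positivity), mul_pow, sq_abs,
    Real.sq_sqrt (by positivity), show π * (l ^ 2 * (2 * z.im)) = 2 * π * l ^ 2 * z.im by ring]
  push_cast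
  ring

/-- The other sign would give $k=-6(m+n)$. Hence distinct theta terms occupy distinct Fourier
exponents. -/
lemma int_sq_injective {k : ℤ} (hk : ¬(6 ∣ k)) {m n : ℤ}
    (h : (12 * m + k) ^ 2 = (12 * n + k) ^ 2) : m = n := by
  rcases sq_eq_sq_iff_eq_or_eq_neg.mp h with h | h
  · omega
  · exact absurd ⟨-(m + n), by omega⟩ hk

/-- With $l=(12n+k)/12$ one has $l^2/2=(12n+k)^2/288$, which is the origin of the width $288$. Each
theta term is one Fourier term, and the other coefficients are zero. -/
lemma nonHolExpansion_torsionR {a : ℝ} (ha : |a| < 1 / 2) (b : ℝ) {k : ℤ} (hk : ¬(6 ∣ k))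
    (hak : 12 * (1 / 2 + a) = k) : NonHolExpansion 288 (torsionR a b) := by
  have hne : ∀ n : ℤ, 12 * n + k ≠ 0 := fun n h ↦ hk ⟨-(2 * n), by omega⟩
  have hl : ∀ n : ℤ, ((n : ℝ) + (1 / 2 + a)) = ((12 * n + k : ℤ) : ℝ) / 12 := by
    intro n; push_cast; linarith
  -- The index $n$ of the expansion stands for the exponent $n+1$, hence the $-1$.
  let g : ℤ → ℕ := fun n ↦ ((12 * n + k) ^ 2).toNat - 1
  have hg1 : ∀ n, ((g n : ℕ) : ℤ) + 1 = (12 * n + k) ^ 2 := by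
    intro n
    have : 0 < (12 * n + k) ^ 2 := by have := hne n; positivity
    simp only [g]
    omega
  have hg : Function.Injective g := by
    intro m n h
    refine int_sq_injective hk ?_
    rw [← hg1, ← hg1, h]
  let d : ℤ → ℂ := fun n ↦ torsionSign b n * ((n : ℝ) + (1 / 2 + a)).sign * ((√π)⁻¹ : ℝ)
  refine ⟨Function.extend g d 0, fun τ ↦ ?_⟩
  have hs : Summable fun n : ℤ ↦ torsionSign b n * incErf (n + (1 / 2 + a)) τ := by
    simpa using summable_nonHolTheta (c := 1 / 2 + a) (norm_torsionSign b) 0 τ.im_pos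
  have h1 := hs.hasSum
  have h2 : ∑' n : ℤ, torsionSign b n * incErf (n + (1 / 2 + a)) τ = torsionR a b τ := by
    rw [torsionR_eq ha, nonHolTheta]
    simp
  rw [h2, ← hasSum_extend_zero hg] at h1
  refine h1.congr_fun fun m ↦ ?_
  by_cases hm : ∃ n, g n = m
  · obtain ⟨n, rfl⟩ := hm
    rw [hg.extend_apply, hg.extend_apply, incErf_eq _ (by
      rw [hl]; exact div_ne_zero (by exact_mod_cast hne n) (by norm_num)) τ.im_pos]
    have h3 : (g n : ℝ) + 1 = 144 * ((n : ℝ) + (1 / 2 + a)) ^ 2 := by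
      have : (g n : ℝ) + 1 = ((12 * n + k : ℤ) : ℝ) ^ 2 := by exact_mod_cast hg1 n
      rw [this, hl]; ring
    have h4 : (g n : ℂ) + 1 = 144 * ((n + (1 / 2 + a) : ℝ) : ℂ) ^ 2 := by exact_mod_cast h3
    rw [h3, h4, coe_im, show (1 - 1 / 2 : ℝ) = 1 / 2 by norm_num,
      show 4 * π * (144 * ((n : ℝ) + (1 / 2 + a)) ^ 2) * τ.im / (288 : ℕ) =
        2 * π * ((n : ℝ) + (1 / 2 + a)) ^ 2 * τ.im by push_cast; ring,
      show -(144 * ((n + (1 / 2 + a) : ℝ) : ℂ) ^ 2) * τ / (288 : ℕ) =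
        -((n + (1 / 2 + a) : ℝ) : ℂ) ^ 2 / 2 * τ by push_cast; ring]
    simp only [d]
    push_cast
    ring
  · rw [Function.extend_apply' _ _ _ hm, Function.extend_apply' _ _ _ hm]
    simp

lemma isHolomorphicPart_of {F f G : ℍ → ℂ} (hf : HolUHP f) (hg : ExpGrowth f) {N : ℕ} (hN : 0 < N)
    (hper : ∀ τ τ' : ℍ, (τ' : ℂ) = τ + N → f τ' = f τ) (hG : NonHolExpansion N G)
    (hF : ∀ τ, F τ = f τ + G τ) : IsHolomorphicPart (1 / 2) F f := by
  obtain ⟨n₀, c, hc⟩ := hf.exists_hasSum hg hN hper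
  obtain ⟨b, hb⟩ := hG
  refine ⟨N, n₀, c, b, hN, fun τ ↦ ⟨hc τ, ?_⟩⟩
  rw [hF, add_sub_cancel_left]
  exact hb τ

end EtaTheta

/-! ### Unary theta series of weight $3/2$: behaviour at $i\infty$ and inversion. -/

namespace EtaTheta

open Filter Topology Asymptotics
open ModularForm (eta)

/-! ### Unary theta series of weight `3/2` -/

/-- `∑ (n + a) e(n b) e((n + a)² z / 2)`. -/
noncomputable def thetaSum (a b : ℝ) (z : ℂ) : ℂ :=
  ∑' n : ℤ, ((n + a : ℝ) : ℂ) * e ((n * b : ℝ)) * e (((n + a : ℝ) : ℂ) ^ 2 / 2 * z)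

lemma norm_thetaSum_term (a b : ℝ) (z : ℂ) (n : ℤ) :
    ‖((n + a : ℝ) : ℂ) * e ((n * b : ℝ)) * e (((n + a : ℝ) : ℂ) ^ 2 / 2 * z)‖ =
      |(n : ℝ) + a| ^ 1 * Real.exp (-π * (z.im * ((n : ℝ) + a) ^ 2)) := by
  rw [← norm_conjGauss, conjGauss, RCLike.norm_conj, norm_mul, norm_mul, norm_e_ofReal, mul_one,
    Complex.norm_real, Real.norm_eq_abs, pow_one]

lemma summable_thetaSum (a b : ℝ) {z : ℂ} (hz : 0 < z.im) : Summable fun n : ℤ ↦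
    ((n + a : ℝ) : ℂ) * e ((n * b : ℝ)) * e (((n + a : ℝ) : ℂ) ^ 2 / 2 * z) :=
  Summable.of_norm_bounded (summable_pow_gauss a hz 1) fun n ↦ (norm_thetaSum_term a b z n).le

lemma HasWirtingerAt.conj {f : ℂ → ℂ} {p b z : ℂ} (h : HasWirtingerAt f p b z) :
    HasWirtingerAt (fun w ↦ (starRingEnd ℂ) (f w)) ((starRingEnd ℂ) b) ((starRingEnd ℂ) p) z := by
  refine HasFDerivAt.congr_fderiv (Complex.conjCLE.hasFDerivAt.comp z h) ?_
  ext w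
  simp
  ring

lemma thetaSum_eq_conj (a b : ℝ) (z : ℂ) : thetaSum a b z =
    (starRingEnd ℂ) (conjTheta (fun n : ℤ ↦ e ((-(n * b) : ℝ))) a 1 z) := by
  rw [conjTheta, Complex.conj_tsum, thetaSum]
  refine tsum_congr fun n ↦ ?_
  rw [conjGauss, map_mul, map_mul, Complex.conj_conj, map_pow, Complex.conj_ofReal, pow_one, conj_e,
    Complex.conj_ofReal]
  push_cast
  rw [neg_neg]
  ring

/-- It is the conjugate of a `conjTheta`, whose $\partial$-derivative vanishes. -/
lemma differentiableOn_thetaSum (a b : ℝ) : DifferentiableOn ℂ (thetaSum a b) {z | 0 < z.im} := by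
  intro z hz
  have h := (hasWirtingerAt_conjTheta (s := fun n : ℤ ↦ e ((-(n * b) : ℝ))) (c := a)
    (fun n ↦ norm_e_ofReal _) 1 hz).conj
  rw [map_zero] at h
  have h2 := h.hasDerivAt.differentiableAt
  rw [← funext (thetaSum_eq_conj a b)] at h2
  exact h2.differentiableWithinAt

lemma thetaSum_add {a b b' : ℝ} {s C : ℂ}
    (h : ∀ n : ℤ, e ((n * b : ℝ)) * e (((n + a : ℝ) : ℂ) ^ 2 / 2 * s) = C * e ((n * b' : ℝ)))
    (z : ℂ) : thetaSum a b (z + s) = C * thetaSum a b' z := by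
  rw [thetaSum, thetaSum, ← tsum_mul_left]
  refine tsum_congr fun n ↦ ?_
  rw [mul_add, e_add]
  linear_combination ((n + a : ℝ) : ℂ) * e (((n + a : ℝ) : ℂ) ^ 2 / 2 * z) * h n

/-! ### The cusp `i∞` -/

/-- The filter of neighbourhoods of `i∞` in `ℂ`. -/
def imInfty : Filter ℂ := comap Complex.im atTop

lemma tendsto_im_imInfty : Tendsto Complex.im imInfty atTop := tendsto_comap

lemma eventually_lt_im_imInfty (A : ℝ) : ∀ᶠ z in imInfty, A < z.im :=
  tendsto_im_imInfty.eventually_gt_atTop A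

lemma tendsto_lin_imInfty {c : ℝ} (hc : 0 < c) (d : ℝ) :
    Tendsto (fun z : ℂ ↦ c * z + d) imInfty imInfty := by
  rw [imInfty, tendsto_comap_iff]
  have : Complex.im ∘ (fun z : ℂ ↦ (c : ℂ) * z + d) = fun z ↦ c * z.im := by
    ext z; simp
  rw [this]
  exact tendsto_im_imInfty.const_mul_atTop hc

lemma tendsto_of_atImInfty {α : Type*} {f : ℂ → α} {l : Filter α}
    (h : Tendsto (fun τ : ℍ ↦ f τ) atImInfty l) : Tendsto f imInfty l := by
  refine (h.comp tendsto_comap_im_ofComplex).congr' ?_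
  filter_upwards [eventually_lt_im_imInfty 0] with z hz
  simp only [Function.comp_apply]
  rw [ofComplex_coe_of_im_pos hz]

/-- The normalised exponents $n(n+2a)/2$ are positive for $n\ne0$ since $|2a|<1$; only $n=0$
survives. -/
lemma tendsto_thetaSum {a : ℝ} (ha : |a| < 1 / 2) (b : ℝ) :
    Tendsto (fun z : ℂ ↦ e (-(a ^ 2 / 2 * z)) * thetaSum a b z) imInfty (𝓝 a) := by
  refine tendsto_of_atImInfty ?_
  obtain ⟨ha1, ha2⟩ := abs_lt.mp ha
  let f : ℍ → ℤ → ℂ := fun τ n ↦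
    ((n + a : ℝ) : ℂ) * e ((n * b : ℝ)) * e (((n * (n + 2 * a) / 2 : ℝ) : ℂ) * τ)
  have hf : ∀ τ : ℍ, e (-(a ^ 2 / 2 * τ)) * thetaSum a b τ = ∑' n, f τ n := by
    intro τ
    rw [thetaSum, ← tsum_mul_left]
    refine tsum_congr fun n ↦ ?_
    simp only [f]
    rw [mul_left_comm, ← e_add]
    congr 2
    push_cast
    ring
  let g : ℤ → ℂ := fun n ↦ if n = 0 then a else 0
  have hg : ∑' n, g n = a := by simp [g]
  suffices H : Tendsto (fun τ : ℍ ↦ ∑' n, f τ n) atImInfty (𝓝 (∑' n, g n)) by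
    rw [hg] at H
    exact H.congr fun τ ↦ (hf τ).symm
  have hs : Summable fun n : ℤ ↦ |(n : ℝ)| ^ 1 *
      Real.exp (-π * (1 * (n : ℝ) ^ 2 - 2 * (1 / 2) * |(n : ℝ)|)) +
      |(n : ℝ)| ^ 0 * Real.exp (-π * (1 * (n : ℝ) ^ 2 - 2 * (1 / 2) * |(n : ℝ)|)) := by
    have h1 := summable_gauss_shift 0 (S := 1 / 2) (by norm_num) one_pos 1
    have h2 := summable_gauss_shift 0 (S := 1 / 2) (by norm_num) one_pos 0
    simp only [add_zero] at h1 h2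
    exact h1.add h2
  have hn : ∀ n : ℤ, (n : ℝ) ^ 2 - |(n : ℝ)| ≤ n * (n + 2 * a) := by
    intro n
    have h1 := neg_abs_le (n : ℝ)
    have h2 := le_abs_self (n : ℝ)
    nlinarith
  have hn0 : ∀ n : ℤ, 0 ≤ (n : ℝ) ^ 2 - |(n : ℝ)| := by
    intro n
    rw [← sq_abs, sub_nonneg]
    rcases eq_or_ne n 0 with rfl | h
    · simp
    · have : (1 : ℝ) ≤ |(n : ℝ)| := by exact_mod_cast Int.one_le_abs h
      nlinarith
  refine tendsto_tsum_of_dominated_convergence hs (fun n ↦ ?_) ?_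
  · by_cases h : n = 0
    · subst h
      simp [f, g, e_zero]
    · have hpos : 0 < (n : ℝ) * (n + 2 * a) / 2 := by
        rcases lt_or_gt_of_ne h with h | h
        · have : (n : ℝ) ≤ -1 := by exact_mod_cast (by omega : n ≤ -1)
          nlinarith
        · have : (1 : ℝ) ≤ n := by exact_mod_cast (by omega : 1 ≤ n)
          nlinarith
      simp only [f, g, h, if_false]
      rw [← mul_zero (((n + a : ℝ) : ℂ) * e ((n * b : ℝ)))]
      exact (tendsto_e_mul_atImInfty hpos).const_mul _
  · filter_upwards [eventually_le_im 1] with τ hτ n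
    simp only [f]
    rw [norm_mul, norm_mul, norm_e_ofReal, mul_one, Complex.norm_real, Real.norm_eq_abs, norm_e,
      Complex.im_ofReal_mul, coe_im, ← add_mul, pow_one, pow_zero]
    have h1 : |(n : ℝ) + a| ≤ |(n : ℝ)| + 1 := (abs_add_le _ _).trans (by linarith)
    refine mul_le_mul h1 (Real.exp_le_exp.mpr ?_) (Real.exp_pos _).le (by positivity)
    have h4 : (n : ℝ) * (n + 2 * a) ≤ (n : ℝ) * (n + 2 * a) * τ.im :=
      le_mul_of_one_le_right ((hn0 n).trans (hn n)) hτ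
    nlinarith [Real.pi_pos, hn n]

/-- Taking moduli lets the $24$th root of the product for $\eta^{24}$ be extracted in the positive
reals. -/
lemma tendsto_norm_eta : Tendsto (fun z : ℂ ↦ ‖e (-(z / 24)) * eta z‖) imInfty (𝓝 1) := by
  refine tendsto_of_atImInfty ?_
  have h := ModularForm.tendsto_atImInfty_tprod_one_sub_eta_q_pow.norm
  rw [norm_one] at h
  have h2 := h.rpow_const (p := 1 / 24) (Or.inl one_ne_zero)
  rw [Real.one_rpow] at h2
  refine h2.congr fun τ ↦ ?_
  have h3 : ∏' n, (1 - ModularForm.eta_q n τ) ^ 24 = (e (-(τ / 24)) * eta τ) ^ 24 := by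
    have := ModularForm.discriminant_eq_q_prod τ
    rw [mul_pow, ← e_nat_mul, show ((24 : ℕ) : ℂ) * -((τ : ℂ) / 24) = -τ by push_cast; ring]
    change _ = e (-τ) * ModularForm.discriminant τ
    rw [this, Function.Periodic.qParam, ← mul_assoc, e, ← Complex.exp_add,
      show 2 * (π : ℂ) * I * -τ + 2 * π * I * τ / (1 : ℝ) = 0 by push_cast; ring, Complex.exp_zero,
      one_mul]
  rw [h3, norm_pow, ← Real.rpow_natCast, ← Real.rpow_mul (norm_nonneg _)]
  norm_num

/-! ### Inversion -/

lemma im_neg_inv_pos {z : ℂ} (hz : 0 < z.im) : 0 < (-1 / z).im := by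
  rw [neg_div, Complex.neg_im, one_div, Complex.inv_im, neg_div, neg_neg]
  exact div_pos hz (Complex.normSq_pos.mpr fun h ↦ by simp [h] at hz)

lemma ne_zero_of_im_pos {z : ℂ} (hz : 0 < z.im) : z ≠ 0 := fun h ↦ by simp [h] at hz

lemma eta_neg_inv {z : ℂ} (hz : 0 < z.im) : eta (-1 / z) = (-I * z) ^ (1 / 2 : ℂ) * eta z :=
  eta_S (τ := ⟨z, hz⟩) (τ' := ⟨-1 / z, im_neg_inv_pos hz⟩) rfl

lemma neg_I_cpow_half_ne_zero {z : ℂ} (hz : 0 < z.im) : (-I * z) ^ (1 / 2 : ℂ) ≠ 0 :=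
  mul_neg_I_sqrt_ne_zero ⟨z, hz⟩

lemma cpow_half_scale {c : ℝ} (hc : 0 < c) {z : ℂ} (hz : z ≠ 0) :
    ((c : ℂ) * z) ^ (1 / 2 : ℂ) = (√c : ℝ) * z ^ (1 / 2 : ℂ) := by
  have hc' : (c : ℂ) ≠ 0 := by exact_mod_cast hc.ne'
  rw [Complex.cpow_def_of_ne_zero (mul_ne_zero hc' hz), Complex.cpow_def_of_ne_zero hz,
    Complex.log_ofReal_mul hc hz, add_mul, Complex.exp_add, Real.sqrt_eq_rpow,
    Real.rpow_def_of_pos hc]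
  push_cast
  rfl

lemma neg_I_cpow_half_scale {c : ℝ} (hc : 0 < c) {z : ℂ} (hz : 0 < z.im) :
    (-I * (c * z)) ^ (1 / 2 : ℂ) = (√c : ℝ) * (-I * z) ^ (1 / 2 : ℂ) := by
  rw [mul_left_comm, cpow_half_scale hc (mul_ne_zero (by simp) (ne_zero_of_im_pos hz))]

lemma jacobiTheta₂'_term_eq (n : ℤ) (w z : ℂ) :
    jacobiTheta₂'_term n w z = 2 * π * I * (n * e (n * w) * e ((n : ℂ) ^ 2 / 2 * z)) := by
  rw [jacobiTheta₂'_term, jacobiTheta₂_term, mul_assoc (n : ℂ), ← e_add, e, mul_assoc (2 * π * I)]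
  congr 3
  ring

lemma summable_int_mul_e (a : ℝ) {z : ℂ} (hz : 0 < z.im) :
    Summable fun n : ℤ ↦ (n : ℂ) * e (n * a) * e ((n : ℂ) ^ 2 / 2 * z) := by
  have := summable_thetaSum 0 a hz
  simpa using this

/-- This is the inversion of the elliptic derivative of Jacobi's theta function. The correction
$-2\pi i a\,\theta$ turns the weight $n$ into $n-a$, and $n\mapsto-n$ gives $-(n+a)$. -/
lemma thetaSum_neg_inv (a : ℝ) {z : ℂ} (hz : 0 < z.im) : thetaSum a 0 (-1 / z) =
    -((-I * z) ^ (1 / 2 : ℂ) * z) * ∑' n : ℤ, (n : ℂ) * e (n * a) * e ((n : ℂ) ^ 2 / 2 * z) := by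
  have hz0 := ne_zero_of_im_pos hz
  have hz' := im_neg_inv_pos hz
  have hκ := neg_I_cpow_half_ne_zero hz
  have hpi : (π : ℂ) ≠ 0 := by exact_mod_cast Real.pi_ne_zero
  have key := jacobiTheta₂'_functional_equation a z
  have h1 : jacobiTheta₂' a z =
      2 * π * I * ∑' n : ℤ, (n : ℂ) * e (n * a) * e ((n : ℂ) ^ 2 / 2 * z) := by
    rw [jacobiTheta₂', ← tsum_mul_left]
    exact tsum_congr fun n ↦ jacobiTheta₂'_term_eq n _ _
  have h2 : Complex.exp (-π * I * a ^ 2 / z) * (jacobiTheta₂' (a / z) (-1 / z) -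
      2 * π * I * a * jacobiTheta₂ (a / z) (-1 / z)) = -(2 * π * I) * thetaSum a 0 (-1 / z) := by
    have h3 := ((hasSum_jacobiTheta₂'_term (a / z) hz').sub
      ((hasSum_jacobiTheta₂_term (a / z) hz').mul_left (2 * π * I * a))).mul_left
      (Complex.exp (-π * I * a ^ 2 / z))
    rw [← h3.tsum_eq, thetaSum, ← tsum_mul_left, ← (Equiv.neg ℤ).tsum_eq]
    refine tsum_congr fun n ↦ ?_
    rw [jacobiTheta₂'_term, ← sub_mul, mul_left_comm, jacobiTheta₂_term, ← Complex.exp_add, e, e,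
      mul_assoc (((n + a : ℝ) : ℂ)), ← Complex.exp_add, ← mul_assoc]
    simp only [Equiv.neg_apply]
    congr 1
    · push_cast; ring
    · congr 1
      push_cast
      field_simp
      ring
  rw [h1, mul_div_right_comm, mul_assoc (_ / _), h2] at key
  generalize thetaSum a 0 (-1 / z) = T at key ⊢
  generalize (∑' n : ℤ, (n : ℂ) * e (n * a) * e ((n : ℂ) ^ 2 / 2 * z)) = S at key ⊢
  generalize (-I * z) ^ (1 / 2 : ℂ) = κ at key hκ ⊢
  field_simp at key
  linear_combination key

/-! ### Splitting theta series -/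

/-- The support lies in the classes $\pm1$ modulo $P$, which are distinct for $P\ge3$ and exchanged
by $m\mapsto-m$. -/
lemma tsum_eq_two_mul_of_even {G : ℤ → ℂ} (hG : Summable G) (heven : ∀ m, G (-m) = G m) {P : ℤ}
    (hP : 3 ≤ P) (h0 : ∀ m, ¬ P ∣ m - 1 → ¬ P ∣ m + 1 → G m = 0) :
    ∑' m, G m = 2 * ∑' n, G (P * n + 1) := by
  classical
  let G₁ : ℤ → ℂ := {m | P ∣ m - 1}.indicator G
  have hs : Summable G₁ := hG.indicator _
  have hsplit : ∀ m, G m = G₁ m + G₁ (-m) := by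
    intro m
    by_cases h1 : P ∣ m - 1
    · have h2 : ¬ P ∣ -m - 1 := by
        intro h
        have h3 : P ∣ 2 := by
          have := dvd_add h1 h
          rw [show m - 1 + (-m - 1) = -2 by ring] at this
          exact (Int.dvd_neg).mp this
        have := Int.le_of_dvd two_pos h3
        omega
      simp [G₁, h1, h2]
    · by_cases h2 : P ∣ -m - 1
      · simp [G₁, h1, h2, heven]
      · have h3 : ¬ P ∣ m + 1 := by
          intro h; apply h2
          rw [show -m - 1 = -(m + 1) by ring]
          exact (Int.dvd_neg).mpr h
        simp [G₁, h1, h2, h0 m h1 h3]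
  have hs' : Summable fun m ↦ G₁ (-m) := (Equiv.neg ℤ).summable_iff.mpr hs
  have h1 : ∑' m, G₁ (-m) = ∑' m, G₁ m := (Equiv.neg ℤ).tsum_eq G₁
  have hinj : Function.Injective fun n : ℤ ↦ P * n + 1 := by
    intro m n h
    exact mul_left_cancel₀ (by omega : P ≠ 0) (add_right_cancel h)
  have h2 : ∑' n, G₁ (P * n + 1) = ∑' m, G₁ m := by
    refine hinj.tsum_eq (f := G₁) ?_
    intro m hm
    have hd : P ∣ m - 1 := by
      by_contra hd
      exact hm (by simp [G₁, hd])
    obtain ⟨n, hn⟩ := hd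
    exact ⟨n, by simp only; omega⟩
  rw [tsum_congr hsplit, hs.tsum_add hs', h1, ← two_mul, ← h2]
  congr 1
  refine tsum_congr fun n ↦ ?_
  simp [G₁]

/-- Since the weight $n$ is odd, $e(na)$ may be antisymmetrised to a sine. For the $a$ used below,
this vanishes off $\pm1$ modulo $P$, and the dual series is again a `thetaSum`. -/
lemma tsum_int_mul_e_eq_thetaSum {P : ℕ} (hP : 3 ≤ P) {a b : ℝ} {C : ℂ}
    (h1 : ∀ n : ℤ, e ((P * n + 1) * a) - e (-((P * n + 1) * a)) = C * e ((n * b : ℝ)))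
    (h0 : ∀ m : ℤ, ¬ (P : ℤ) ∣ m - 1 → ¬ (P : ℤ) ∣ m + 1 → e (m * a) - e (-(m * a)) = 0)
    {z : ℂ} (hz : 0 < z.im) : ∑' n : ℤ, (n : ℂ) * e (n * a) * e ((n : ℂ) ^ 2 / 2 * z) =
      C * P * thetaSum (1 / P) b (P ^ 2 * z) := by
  have hP0 : (P : ℂ) ≠ 0 := by
    have : P ≠ 0 := by omega
    exact_mod_cast this
  set F : ℤ → ℂ := fun n ↦ (n : ℂ) * e (n * a) * e ((n : ℂ) ^ 2 / 2 * z)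
  have hF : Summable F := summable_int_mul_e a hz
  have hF' : Summable fun n ↦ F (-n) := (Equiv.neg ℤ).summable_iff.mpr hF
  have hG : ∀ n, F n + F (-n) = n * (e (n * a) - e (-(n * a))) * e ((n : ℂ) ^ 2 / 2 * z) := by
    intro n
    simp only [F]
    push_cast
    simp only [neg_sq, neg_mul]
    ring
  have h2 := tsum_eq_two_mul_of_even (hF.add hF') (fun m ↦ by rw [neg_neg, add_comm])
    (P := P) (by exact_mod_cast hP) (fun m hm hm' ↦ by rw [hG, h0 m hm hm']; ring)
  have h3 : ∑' n, F (-n) = ∑' n, F n := (Equiv.neg ℤ).tsum_eq F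
  rw [hF.tsum_add hF', h3, ← two_mul] at h2
  rw [mul_left_cancel₀ two_ne_zero h2, thetaSum, ← tsum_mul_left]
  refine tsum_congr fun n ↦ ?_
  rw [hG]
  push_cast
  have := h1 n
  push_cast at this
  rw [this, show ((P : ℂ) * n + 1) ^ 2 / 2 * z = (n + 1 / P) ^ 2 / 2 * (P ^ 2 * z) by field_simp]
  field_simp

/-! ### Level one functions of weight zero -/

open scoped ModularForm in
lemma const_of_level_one {g : ℂ → ℂ} (hd : DifferentiableOn ℂ g {z | 0 < z.im})
    (hT : ∀ z, 0 < z.im → g (z + 1) = g z) (hS : ∀ z, 0 < z.im → g (-1 / z) = g z)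
    (hb : (fun z ↦ g z) =O[imInfty] fun _ ↦ (1 : ℝ)) : ∃ c, ∀ z, 0 < z.im → g z = c := by
  let F : ℍ → ℂ := fun τ ↦ g τ
  have hS' : F ∣[(0 : ℤ)] ModularGroup.S = F := by
    ext τ
    rw [ModularForm.SL_slash_apply, UpperHalfPlane.modular_S_smul]
    have := hS τ τ.im_pos
    simp only [neg_zero, zpow_zero, mul_one, F]
    rw [← this]
    congr 1
    rw [neg_div, one_div, ← inv_neg]
  have hT' : F ∣[(0 : ℤ)] ModularGroup.T = F := by
    ext τ
    rw [ModularForm.SL_slash_apply, UpperHalfPlane.modular_T_smul]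
    have := hT τ τ.im_pos
    simp only [neg_zero, zpow_zero, mul_one, F]
    rw [← this]
    simp [add_comm]
  have hslash := SlashInvariantForm.slash_action_generators_SL2Z hS' hT'
  have hbdd : IsBoundedAtImInfty F := hb.comp_tendsto tendsto_coe_atImInfty
  let f : ModularForm 𝒮ℒ 0 :=
    { toFun := F
      slash_action_eq' := fun A hA ↦ by
        obtain ⟨A, rfl⟩ := hA
        exact hslash A
      holo' := by
        rw [UpperHalfPlane.mdifferentiable_iff]
        exact hd.congr fun z hz ↦ congrArg g (ofComplex_coe_of_im_pos hz)
      bdd_at_cusps' := fun hc ↦ by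
        rw [Subgroup.IsArithmetic.isCusp_iff_isCusp_SL2Z] at hc
        rw [OnePoint.isBoundedAt_iff_forall_SL2Z hc]
        intro γ _
        rw [hslash]
        exact hbdd }
  obtain ⟨c, hc⟩ := ModularFormClass.levelOne_weight_zero_const f
  exact ⟨c, fun z hz ↦ congrFun hc ⟨z, hz⟩⟩

end EtaTheta

/-! ### Rigidity from level one and the explicit inversion formulas. -/

namespace EtaTheta

open Filter Topology Asymptotics
open ModularForm (eta)

/-! ### Leading terms at `i∞` -/

instance : imInfty.NeBot := by
  rw [imInfty, comap_neBot_iff_frequently]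
  exact Frequently.of_forall fun y ↦ ⟨⟨0, y⟩, rfl⟩

/-- `‖f z‖ ∼ c ‖e(x z)‖` as `Im z → ∞`. -/
def HasLeadingExponent (f : ℂ → ℂ) (x c : ℝ) : Prop :=
  Tendsto (fun z ↦ ‖e (-(x * z)) * f z‖) imInfty (𝓝 c)

namespace HasLeadingExponent

variable {f g : ℂ → ℂ} {x y c d : ℝ}

lemma mul (hf : HasLeadingExponent f x c) (hg : HasLeadingExponent g y d) :
    HasLeadingExponent (fun z ↦ f z * g z) (x + y) (c * d) := by
  refine (Tendsto.mul hf hg).congr fun z ↦ ?_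
  rw [← norm_mul, mul_mul_mul_comm, ← e_add]
  push_cast
  congr 3
  ring

lemma pow (hf : HasLeadingExponent f x c) (n : ℕ) :
    HasLeadingExponent (fun z ↦ f z ^ n) (n * x) (c ^ n) := by
  refine (Tendsto.pow hf n).congr fun z ↦ ?_
  rw [← norm_pow, mul_pow, ← e_nat_mul]
  push_cast
  congr 3
  ring

lemma inv (hf : HasLeadingExponent f x c) (hc : c ≠ 0) :
    HasLeadingExponent (fun z ↦ (f z)⁻¹) (-x) c⁻¹ := by
  refine (Tendsto.inv₀ hf hc).congr fun z ↦ ?_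
  rw [← norm_inv, mul_inv, ← e_neg]
  push_cast
  congr 3
  ring

lemma div (hf : HasLeadingExponent f x c) (hg : HasLeadingExponent g y d) (hd : d ≠ 0) :
    HasLeadingExponent (fun z ↦ f z / g z) (x - y) (c / d) := by
  simpa only [div_eq_mul_inv, sub_eq_add_neg] using hf.mul (hg.inv hd)

lemma comp_lin (hf : HasLeadingExponent f x c) {k : ℝ} (hk : 0 < k) (l : ℝ) :
    HasLeadingExponent (fun z ↦ f (k * z + l)) (x * k) c := by
  refine (Tendsto.comp hf (tendsto_lin_imInfty hk l)).congr fun z ↦ ?_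
  simp only [Function.comp_apply]
  rw [norm_mul, norm_mul, show -((x : ℂ) * (k * z + l)) = -((x * k : ℝ) * z) + (-(x * l) : ℝ) by
    push_cast; ring, e_add, norm_mul, norm_e_ofReal, mul_one]

lemma isBigO_one (hf : HasLeadingExponent f x c) (hx : x = 0) :
    f =O[imInfty] fun _ ↦ (1 : ℝ) := by
  subst hx
  have h : Tendsto (fun z ↦ ‖f z‖) imInfty (𝓝 c) := by simpa [HasLeadingExponent] using hf
  exact (h.isBigO_one ℝ).of_norm_left

lemma ne_zero_of_const (hf : HasLeadingExponent f x c) (hx : x = 0) (hc : c ≠ 0) {C : ℂ}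
    (h : ∀ z, 0 < z.im → f z = C) : C ≠ 0 := by
  subst hx
  rintro rfl
  have h1 : Tendsto (fun z ↦ ‖f z‖) imInfty (𝓝 c) := by simpa [HasLeadingExponent] using hf
  refine hc (tendsto_nhds_unique (h1.congr' ?_) (tendsto_const_nhds (x := (0 : ℝ))))
  filter_upwards [eventually_lt_im_imInfty 0] with z hz
  rw [h z hz, norm_zero]

end HasLeadingExponent

lemma hasLeadingExponent_eta : HasLeadingExponent eta (1 / 24) 1 := by
  refine tendsto_norm_eta.congr fun z ↦ ?_
  push_cast
  congr 3
  ring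

lemma hasLeadingExponent_thetaSum {a : ℝ} (ha : |a| < 1 / 2) (b : ℝ) :
    HasLeadingExponent (thetaSum a b) (a ^ 2 / 2) |a| := by
  have h := (tendsto_thetaSum ha b).norm
  rw [Complex.norm_real] at h
  refine h.congr fun z ↦ ?_
  push_cast
  rfl

/-! ### Continuous functions with finitely many values -/

lemma const_of_mem_finite {g : ℂ → ℂ} (hg : ContinuousOn g {z | 0 < z.im}) {s : Set ℂ}
    (hs : s.Finite) (h : ∀ z : ℂ, 0 < z.im → g z ∈ s) : ∃ c, ∀ z : ℂ, 0 < z.im → g z = c := by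
  have hU : IsPreconnected {z : ℂ | 0 < z.im} := (convex_halfSpace_im_gt 0).isPreconnected
  refine ⟨g I, fun z hz ↦ ?_⟩
  by_contra hne
  refine (hU.image g hg).infinite_of_nontrivial ⟨g z, ⟨z, hz, rfl⟩, g I, ⟨I, by simp, rfl⟩, hne⟩
    (hs.subset ?_)
  rintro _ ⟨w, hw, rfl⟩
  exact h w hw

open Polynomial in
/-- Three functions permuted by `T` and `S` as the three nonzero points of order two are
constant. -/
lemma const_of_permuted {A B C : ℂ → ℂ} (hA : DifferentiableOn ℂ A {z | 0 < z.im})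
    (hB : DifferentiableOn ℂ B {z | 0 < z.im}) (hC : DifferentiableOn ℂ C {z | 0 < z.im})
    (hbA : A =O[imInfty] fun _ ↦ (1 : ℝ)) (hbB : B =O[imInfty] fun _ ↦ (1 : ℝ))
    (hbC : C =O[imInfty] fun _ ↦ (1 : ℝ))
    (hTA : ∀ z, 0 < z.im → A (z + 1) = A z) (hTB : ∀ z, 0 < z.im → B (z + 1) = C z)
    (hTC : ∀ z, 0 < z.im → C (z + 1) = B z) (hSA : ∀ z, 0 < z.im → A (-1 / z) = B z)
    (hSB : ∀ z, 0 < z.im → B (-1 / z) = A z) (hSC : ∀ z, 0 < z.im → C (-1 / z) = C z) :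
    ∃ c, ∀ z, 0 < z.im → A z = c := by
  obtain ⟨s₁, h₁⟩ := const_of_level_one (g := fun z ↦ A z + B z + C z) ((hA.add hB).add hC)
    (fun z hz ↦ by simp only [hTA z hz, hTB z hz, hTC z hz]; ring)
    (fun z hz ↦ by simp only [hSA z hz, hSB z hz, hSC z hz]; ring) ((hbA.add hbB).add hbC)
  have mulb : ∀ {f g : ℂ → ℂ}, f =O[imInfty] (fun _ ↦ (1 : ℝ)) → g =O[imInfty] (fun _ ↦ (1 : ℝ)) →
      (fun z ↦ f z * g z) =O[imInfty] fun _ ↦ (1 : ℝ) := fun hf hg ↦ by simpa using hf.mul hg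
  obtain ⟨s₂, h₂⟩ := const_of_level_one (g := fun z ↦ A z * B z + B z * C z + A z * C z)
    (((hA.mul hB).add (hB.mul hC)).add (hA.mul hC))
    (fun z hz ↦ by simp only [hTA z hz, hTB z hz, hTC z hz]; ring)
    (fun z hz ↦ by simp only [hSA z hz, hSB z hz, hSC z hz]; ring)
    (((mulb hbA hbB).add (mulb hbB hbC)).add (mulb hbA hbC))
  obtain ⟨s₃, h₃⟩ := const_of_level_one (g := fun z ↦ A z * B z * C z) ((hA.mul hB).mul hC)
    (fun z hz ↦ by simp only [hTA z hz, hTB z hz, hTC z hz]; ring)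
    (fun z hz ↦ by simp only [hSA z hz, hSB z hz, hSC z hz]; ring) (mulb (mulb hbA hbB) hbC)
  -- The elementary symmetric functions are level-one invariant and bounded, hence constant. So $A$
  -- takes values among the roots of a fixed cubic.
  let p : ℂ[X] := X ^ 3 + (- Polynomial.C s₁ * X ^ 2 + Polynomial.C s₂ * X - Polynomial.C s₃)
  have hp : p ≠ 0 := by
    refine Monic.ne_zero (monic_X_pow_add ?_)
    compute_degree!
  refine const_of_mem_finite hA.continuousOn (p.rootSet_finite ℂ) fun z hz ↦ ?_
  rw [mem_rootSet]
  refine ⟨hp, ?_⟩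
  simp only [p, map_add, map_sub, map_mul, map_neg, map_pow, aeval_X, aeval_C, Algebra.algebraMap_self,
    RingHom.id_apply]
  rw [← h₁ z hz, ← h₂ z hz, ← h₃ z hz]
  ring

/-! ### Transformations of the theta series -/

lemma e_sub_e_neg (x : ℝ) : e x - e (-x) = 2 * I * (Real.sin (2 * π * x) : ℝ) := by
  rw [e, e, Complex.ofReal_sin, Complex.sin]
  push_cast
  rw [show 2 * (π : ℂ) * I * -x = -(2 * π * x) * I by ring,
    show 2 * (π : ℂ) * I * x = 2 * π * x * I by ring]
  linear_combination (Complex.exp (2 * π * x * I) - Complex.exp (-(2 * π * x) * I)) * Complex.I_sq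

lemma e_sixth_sub : e (1 / 6) - e (-(1 / 6)) = I * (√3 : ℝ) := by
  have h := e_sub_e_neg (1 / 6)
  rw [show 2 * π * (1 / 6) = π / 3 by ring, Real.sin_pi_div_three] at h
  push_cast at h ⊢
  rw [h]
  ring

lemma e_third_sub : e (1 / 3) - e (-(1 / 3)) = I * (√3 : ℝ) := by
  have h := e_sub_e_neg (1 / 3)
  rw [show 2 * π * (1 / 3) = π - π / 3 by ring, Real.sin_pi_sub, Real.sin_pi_div_three] at h
  push_cast at h ⊢
  rw [h]
  ring

lemma im_smul_pos {z : ℂ} (hz : 0 < z.im) {c : ℝ} (hc : 0 < c) : 0 < ((c : ℂ) * z).im := by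
  rw [Complex.im_ofReal_mul]; exact mul_pos hc hz

lemma neg_I_cpow_half_sq {z : ℂ} : ((-I * z) ^ (1 / 2 : ℂ)) ^ 2 = -I * z := cpow_half_sq _

lemma thetaSum_scaled_neg_inv {P : ℕ} (hP : 3 ≤ P) {q : ℝ} (hq : 0 < q) {a b : ℝ} {C : ℂ}
    (h1 : ∀ n : ℤ, e ((P * n + 1) * a) - e (-((P * n + 1) * a)) = C * e ((n * b : ℝ)))
    (h0 : ∀ m : ℤ, ¬ (P : ℤ) ∣ m - 1 → ¬ (P : ℤ) ∣ m + 1 → e (m * a) - e (-(m * a)) = 0)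
    {z : ℂ} (hz : 0 < z.im) : thetaSum a 0 (q * (-1 / z)) =
      -(C * P * (√q⁻¹ : ℝ) * q⁻¹ * (-I * z) ^ (1 / 2 : ℂ) * z) *
        thetaSum (1 / P) b (P ^ 2 / q * z) := by
  have hq0 : (q : ℂ) ≠ 0 := by exact_mod_cast hq.ne'
  have hz0 := ne_zero_of_im_pos hz
  rw [show (q : ℂ) * (-1 / z) = -1 / (((q⁻¹ : ℝ) : ℂ) * z) by push_cast; field_simp,
    thetaSum_neg_inv a (im_smul_pos hz (inv_pos.mpr hq)),
    tsum_int_mul_e_eq_thetaSum hP h1 h0 (im_smul_pos hz (inv_pos.mpr hq)),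
    neg_I_cpow_half_scale (inv_pos.mpr hq) hz,
    show (P : ℂ) ^ 2 * (((q⁻¹ : ℝ) : ℂ) * z) = P ^ 2 / q * z by push_cast; ring]
  push_cast
  ring

/-- $e(m/4)-e(-m/4)$ vanishes for even $m$ and equals $2i$ for $m\equiv1$ modulo $4$: the series is
self-dual. -/
lemma thetaSum_quarter_neg_inv {z : ℂ} (hz : 0 < z.im) : thetaSum (1 / 4) 0 (4 * (-1 / z)) =
    ((-I * z) ^ (1 / 2 : ℂ)) ^ 3 * thetaSum (1 / 4) 0 (4 * z) := by
  have h := thetaSum_scaled_neg_inv (P := 4) (q := 4) (a := 1 / 4) (b := 0) (C := 2 * I)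
    (by norm_num) (by norm_num) (fun n ↦ ?_) (fun m h1 h2 ↦ ?_) hz
  · rw [show √(4 : ℝ)⁻¹ = 1 / 2 by
      rw [show (4 : ℝ)⁻¹ = (1 / 2) ^ 2 by norm_num]; exact Real.sqrt_sq (by norm_num)] at h
    push_cast at h
    rw [show ((4 : ℂ) ^ 2 / 4) = 4 by norm_num] at h
    norm_num only at h ⊢
    rw [h, pow_succ, neg_I_cpow_half_sq]
    ring
  · rw [e_mul_int_of_exp (w := 1 / 4) n (by push_cast; ring),
      e_mul_int_of_exp (z := -_) (w := -(1 / 4)) (-n) (by push_cast; ring), e_neg, e_quarter]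
    simp
    ring
  · have h3 : ∃ k, m = 2 * k := by
      push_cast at h1 h2
      exact ⟨m / 2, by omega⟩
    obtain ⟨k, rfl⟩ := h3
    rw [sub_eq_zero]
    exact e_mul_int_of_exp k (by push_cast; ring)

lemma sqrt_third_inv : ((√3⁻¹ : ℝ) : ℂ) * (√3 : ℝ) = 1 := by
  rw [← Complex.ofReal_mul, ← Real.sqrt_mul (by norm_num)]
  norm_num

/-- $e(m/6)-e(-m/6)$ vanishes for $3\mid m$ and equals $i\sqrt3\,(-1)^n$ at $m=3n+1$; the sign is
the dual characteristic $b=1/2$. -/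
lemma thetaSum_sixth_neg_inv {z : ℂ} (hz : 0 < z.im) : thetaSum (1 / 6) 0 (3 * (-1 / z)) =
    ((-I * z) ^ (1 / 2 : ℂ)) ^ 3 * thetaSum (1 / 3) (1 / 2) (3 * z) := by
  have h := thetaSum_scaled_neg_inv (P := 3) (q := 3) (a := 1 / 6) (b := 1 / 2)
    (C := I * (√3 : ℝ)) (by norm_num) (by norm_num) (fun n ↦ ?_) (fun m h1 h2 ↦ ?_) hz
  · have h4 := sqrt_third_inv
    push_cast at h h4
    rw [show ((3 : ℂ) ^ 2 / 3) = 3 by norm_num] at h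
    norm_num only at h h4 ⊢
    rw [h, pow_succ, neg_I_cpow_half_sq]
    linear_combination -(I * z * (-I * z) ^ (1 / 2 : ℂ) * thetaSum (1 / 3) (1 / 2) (3 * z)) * h4
  · have h5 : e (((n * (1 / 2) : ℝ) : ℂ)) = e (-(n / 2)) := by
      exact e_mul_int_of_exp n (by push_cast; ring)
    rw [← e_sixth_sub, sub_mul, ← e_add, h5, ← e_add]
    congr 1 <;> congr 1 <;> push_cast <;> ring
  · obtain ⟨k, rfl⟩ : ∃ k, m = 3 * k := by
      push_cast at h1 h2
      exact ⟨m / 3, by omega⟩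
    rw [sub_eq_zero]
    exact e_mul_int_of_exp k (by push_cast; ring)

lemma thetaSum_third_neg_inv {z : ℂ} (hz : 0 < z.im) : thetaSum (1 / 3) 0 (3 * (-1 / z)) =
    ((-I * z) ^ (1 / 2 : ℂ)) ^ 3 * thetaSum (1 / 3) 0 (3 * z) := by
  have h := thetaSum_scaled_neg_inv (P := 3) (q := 3) (a := 1 / 3) (b := 0)
    (C := I * (√3 : ℝ)) (by norm_num) (by norm_num) (fun n ↦ ?_) (fun m h1 h2 ↦ ?_) hz
  · have h4 := sqrt_third_inv
    push_cast at h h4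
    rw [show ((3 : ℂ) ^ 2 / 3) = 3 by norm_num] at h
    norm_num only at h h4 ⊢
    rw [h, pow_succ, neg_I_cpow_half_sq]
    linear_combination -(I * z * (-I * z) ^ (1 / 2 : ℂ) * thetaSum (1 / 3) 0 (3 * z)) * h4
  · rw [← e_third_sub, e_mul_int_of_exp (w := 1 / 3) n (by push_cast; ring),
      e_mul_int_of_exp (z := -_) (w := -(1 / 3)) (-n) (by push_cast; ring)]
    simp
  · obtain ⟨k, rfl⟩ : ∃ k, m = 3 * k := by
      push_cast at h1 h2
      exact ⟨m / 3, by omega⟩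
    rw [sub_eq_zero]
    exact e_mul_int_of_exp (2 * k) (by push_cast; ring)

end EtaTheta

/-! ### Theta series as eta quotients by rigidity. -/

namespace EtaTheta

open Filter Topology Asymptotics
open ModularForm (eta)

/-! ### Theta series as eta quotients -/

lemma im_lin_pos {z : ℂ} (hz : 0 < z.im) {c : ℝ} (hc : 0 < c) (d : ℝ) :
    0 < ((c : ℂ) * z + d).im := by
  rw [Complex.add_im, Complex.ofReal_im, add_zero]
  exact im_smul_pos hz hc

lemma DifferentiableOn.comp_lin {f : ℂ → ℂ} (hf : DifferentiableOn ℂ f {z | 0 < z.im}) {c : ℝ}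
    (hc : 0 < c) (d : ℝ) : DifferentiableOn ℂ (fun z ↦ f (c * z + d)) {z | 0 < z.im} :=
  hf.comp (by fun_prop) fun _ hz ↦ im_lin_pos hz hc d

lemma differentiableOn_eta : DifferentiableOn ℂ eta {z | 0 < z.im} := fun _ hz ↦
  (ModularForm.differentiableAt_eta_of_mem_upperHalfPlaneSet hz).differentiableWithinAt

lemma eta_add_nat (z : ℂ) (n : ℕ) : eta (z + n) = e (n / 24) * eta z := by
  induction n with
  | zero => simp
  | succ n ih =>
    rw [Nat.cast_succ, ← add_assoc, eta_add_one, ih, ← mul_assoc, ← e_add]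
    congr 2
    ring

/-- Jacobi's formula for $\eta^3$: the quotient is invariant under $S$ and $T$, and both sides have
leading exponent $1/8$, so it is a nonzero constant. -/
lemma thetaSum_quarter_eq : ∃ C : ℂ, C ≠ 0 ∧ ∀ z : ℂ, 0 < z.im →
    thetaSum (1 / 4) 0 (4 * z) = C * eta z ^ 3 := by
  have hne : ∀ z : ℂ, 0 < z.im → eta z ≠ 0 := fun z hz ↦ ModularForm.eta_ne_zero hz
  let h : ℂ → ℂ := fun z ↦ thetaSum (1 / 4) 0 ((4 : ℝ) * z + (0 : ℝ)) / eta z ^ 3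
  have hlead := ((hasLeadingExponent_thetaSum (a := 1 / 4) (by norm_num [abs_of_pos]) 0).comp_lin
    (k := 4) (by norm_num) 0).div (hasLeadingExponent_eta.pow 3) (by norm_num)
  have hd : DifferentiableOn ℂ h {z | 0 < z.im} :=
    (DifferentiableOn.comp_lin (differentiableOn_thetaSum _ _) (by norm_num) 0).div
      (differentiableOn_eta.pow 3) fun z hz ↦ pow_ne_zero 3 (hne z hz)
  have hT : ∀ z, 0 < z.im → h (z + 1) = h z := by
    intro z hz
    simp only [h, Complex.ofReal_zero, add_zero, Complex.ofReal_ofNat]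
    rw [mul_add, thetaSum_add (b' := 0) (C := e (1 / 8)), eta_add_one, mul_pow, ← e_nat_mul,
      show ((3 : ℕ) * (1 / 24) : ℂ) = 1 / 8 by push_cast; norm_num,
      mul_div_mul_left _ _ (e_ne_zero _)]
    intro n
    simp only [mul_zero, Complex.ofReal_zero, e_zero, one_mul, mul_one]
    exact e_mul_int_of_exp (2 * n ^ 2 + n) (by push_cast; ring)
  have hS : ∀ z, 0 < z.im → h (-1 / z) = h z := by
    intro z hz
    simp only [h, Complex.ofReal_zero, add_zero, Complex.ofReal_ofNat]
    rw [thetaSum_quarter_neg_inv hz, eta_neg_inv hz, mul_pow,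
      mul_div_mul_left _ _ (pow_ne_zero 3 (neg_I_cpow_half_ne_zero hz))]
  obtain ⟨C, hC⟩ := const_of_level_one hd hT hS (hlead.isBigO_one (by norm_num))
  refine ⟨C, hlead.ne_zero_of_const (by norm_num) (by norm_num) hC, fun z hz ↦ ?_⟩
  rw [← hC z hz]
  simp only [h, Complex.ofReal_zero, add_zero, Complex.ofReal_ofNat]
  rw [div_mul_cancel₀ _ (pow_ne_zero 3 (hne z hz))]

lemma eta_two_mul_neg_inv {z : ℂ} (hz : 0 < z.im) :
    eta (2 * (-1 / z)) ^ 2 = ((-I * z) ^ (1 / 2 : ℂ)) ^ 2 / 2 * eta (z / 2) ^ 2 := by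
  have h := eta_neg_inv (im_smul_pos hz (c := 1 / 2) (by norm_num))
  rw [show -1 / (((1 / 2 : ℝ) : ℂ) * z) = 2 * (-1 / z) by
    have := ne_zero_of_im_pos hz
    push_cast; field_simp] at h
  rw [h, mul_pow, neg_I_cpow_half_sq, neg_I_cpow_half_sq]
  push_cast
  rw [show (1 / 2 : ℂ) * z = z / 2 by ring]
  ring

/-- The points $(-1/z+1)/2$ and $(z-1)/2$ have inverses differing by $2$, so two inversions and
translations suffice. Squaring turns the half-integral powers into rational functions of $z$ and
avoids branches. -/
lemma eta_half_add_one_neg_inv {z : ℂ} (hz : 0 < z.im) :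
    eta ((-1 / z + 1) / 2) ^ 2 = ((-I * z) ^ (1 / 2 : ℂ)) ^ 2 * eta ((z + 1) / 2) ^ 2 := by
  have hz0 := ne_zero_of_im_pos hz
  have hx : 0 < ((-1 / z + 1) / 2).im := by
    have := im_lin_pos (im_neg_inv_pos hz) (c := 1 / 2) (by norm_num) (1 / 2)
    push_cast at this
    rwa [show (-1 / z + 1) / 2 = 1 / 2 * (-1 / z) + 1 / 2 by ring]
  have hw : 0 < ((z - 1) / 2).im := by
    have := im_lin_pos hz (c := 1 / 2) (by norm_num) (-(1 / 2))
    push_cast at this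
    rwa [show (z - 1) / 2 = 1 / 2 * z + -(1 / 2) by ring]
  have hz1 : z - 1 ≠ 0 := fun h ↦ by simp [h] at hw
  have h1 := eta_neg_inv hx
  have h2 := eta_neg_inv hw
  have h3 : -1 / ((-1 / z + 1) / 2) + (2 : ℕ) = -1 / ((z - 1) / 2) := by
    have : -1 / z + 1 = (z - 1) / z := by field_simp; ring
    rw [this]
    push_cast
    field_simp
    ring
  have h4 := eta_add_nat (-1 / ((-1 / z + 1) / 2)) 2
  have h5 := eta_add_one ((z - 1) / 2)
  rw [h3, h2, h1] at h4
  rw [show (z - 1) / 2 + 1 = (z + 1) / 2 by ring] at h5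
  have h6 := congrArg (· ^ 2) h4
  simp only [mul_pow, neg_I_cpow_half_sq] at h6
  have h7 : (e ((2 : ℕ) / 24)) ^ 2 * e (1 / 24) ^ 2 = I := by
    rw [← e_nat_mul, ← e_nat_mul, ← e_add, ← e_quarter]
    congr 1; push_cast; norm_num
  have h8 : (z - 1) * eta ((z - 1) / 2) ^ 2 =
      (e ((2 : ℕ) / 24)) ^ 2 * ((z - 1) / z) * eta ((-1 / z + 1) / 2) ^ 2 := by
    have : (z - 1) / z = -1 / z + 1 := by field_simp; ring
    rw [this]
    linear_combination 2 * I * h6 + (z - 1) * eta ((z - 1) / 2) ^ 2 * Complex.I_sq -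
      (e ((2 : ℕ) / 24)) ^ 2 * (-1 / z + 1) * eta ((-1 / z + 1) / 2) ^ 2 * Complex.I_sq
  have h9 : z * eta ((z - 1) / 2) ^ 2 = (e ((2 : ℕ) / 24)) ^ 2 * eta ((-1 / z + 1) / 2) ^ 2 := by
    refine mul_left_cancel₀ hz1 ?_
    calc (z - 1) * (z * eta ((z - 1) / 2) ^ 2) = z * ((z - 1) * eta ((z - 1) / 2) ^ 2) := by ring
      _ = _ := by rw [h8]; field_simp
  rw [neg_I_cpow_half_sq, h5, mul_pow]
  linear_combination I * e (1 / 24) ^ 2 * h9 + I * eta ((-1 / z + 1) / 2) ^ 2 * h7 +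
    eta ((-1 / z + 1) / 2) ^ 2 * Complex.I_sq

/-- The theta series `∑ (n + 1/6) q ^ (3 (n + 1/6)² / 2)` and its two conjugates, divided by eta
quotients. -/
lemma weber_quotients_const :
    (∃ C : ℂ, C ≠ 0 ∧ ∀ z : ℂ, 0 < z.im →
      thetaSum (1 / 6) 0 (3 * z) * eta (2 * z) ^ 2 = C * eta z ^ 5) ∧
    (∃ C : ℂ, C ≠ 0 ∧ ∀ z : ℂ, 0 < z.im →
      thetaSum (1 / 3) (1 / 2) (3 * z) * eta (z / 2) ^ 2 = C * eta z ^ 5) ∧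
    (∃ C : ℂ, C ≠ 0 ∧ ∀ z : ℂ, 0 < z.im →
      thetaSum (1 / 3) 0 (3 * z) * eta ((z + 1) / 2) ^ 2 = C * eta z ^ 5) := by
  have hne : ∀ z : ℂ, 0 < z.im → eta z ^ 5 ≠ 0 :=
    fun z hz ↦ pow_ne_zero 5 (ModularForm.eta_ne_zero hz)
  have diff : ∀ (a b k l : ℝ), 0 < k → DifferentiableOn ℂ (fun z : ℂ ↦
      thetaSum a b ((3 : ℝ) * z + (0 : ℝ)) * eta (k * z + l) ^ 2 / eta z ^ 5) {z | 0 < z.im} :=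
    fun a b k l hk ↦ ((DifferentiableOn.comp_lin (differentiableOn_thetaSum a b) three_pos 0).mul
      ((DifferentiableOn.comp_lin differentiableOn_eta hk l).pow 2)).div
      (differentiableOn_eta.pow 5) hne
  have lead : ∀ {a : ℝ} (b k l : ℝ), |a| < 1 / 2 → 0 < k → HasLeadingExponent (fun z : ℂ ↦
      thetaSum a b ((3 : ℝ) * z + (0 : ℝ)) * eta (k * z + l) ^ 2 / eta z ^ 5)
      (a ^ 2 / 2 * 3 + (2 : ℕ) * (1 / 24 * k) - (5 : ℕ) * (1 / 24)) (|a| * 1 ^ 2 / 1 ^ 5) :=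
    fun b k l ha hk ↦ (((hasLeadingExponent_thetaSum ha b).comp_lin three_pos 0).mul
      ((hasLeadingExponent_eta.comp_lin hk l).pow 2)).div (hasLeadingExponent_eta.pow 5)
      (by norm_num)
  let A : ℂ → ℂ := fun z ↦
    thetaSum (1 / 6) 0 ((3 : ℝ) * z + (0 : ℝ)) * eta ((2 : ℝ) * z + (0 : ℝ)) ^ 2 / eta z ^ 5
  let B : ℂ → ℂ := fun z ↦
    thetaSum (1 / 3) (1 / 2) ((3 : ℝ) * z + (0 : ℝ)) * eta ((1 / 2 : ℝ) * z + (0 : ℝ)) ^ 2 /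
      eta z ^ 5
  let C : ℂ → ℂ := fun z ↦
    thetaSum (1 / 3) 0 ((3 : ℝ) * z + (0 : ℝ)) * eta ((1 / 2 : ℝ) * z + (1 / 2 : ℝ)) ^ 2 /
      eta z ^ 5
  have lA : HasLeadingExponent A _ _ := lead 0 2 0 (a := 1 / 6) (by norm_num [abs_of_pos]) two_pos
  have lB : HasLeadingExponent B _ _ :=
    lead (1 / 2) (1 / 2) 0 (a := 1 / 3) (by norm_num [abs_of_pos]) (by norm_num)
  have lC : HasLeadingExponent C _ _ :=
    lead 0 (1 / 2) (1 / 2) (a := 1 / 3) (by norm_num [abs_of_pos]) (by norm_num)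
  have eA : ∀ z, A z = thetaSum (1 / 6) 0 (3 * z) * eta (2 * z) ^ 2 / eta z ^ 5 := fun z ↦ by
    simp [A]
  have eB : ∀ z, B z = thetaSum (1 / 3) (1 / 2) (3 * z) * eta (z / 2) ^ 2 / eta z ^ 5 := fun z ↦ by
    simp [B, div_eq_inv_mul]
  have eC : ∀ z, C z = thetaSum (1 / 3) 0 (3 * z) * eta ((z + 1) / 2) ^ 2 / eta z ^ 5 := fun z ↦ by
    simp [C, div_eq_inv_mul, mul_add]
  have hTA : ∀ z, A (z + 1) = A z := by
    intro z
    have h1 : thetaSum (1 / 6) 0 (3 * z + 3) = e (1 / 24) * thetaSum (1 / 6) 0 (3 * z) := by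
      refine thetaSum_add (fun n ↦ ?_) _
      simp only [mul_zero, Complex.ofReal_zero, e_zero, one_mul, mul_one]
      obtain ⟨k, hk⟩ := Int.even_mul_succ_self n
      refine e_mul_int_of_exp (n ^ 2 + k) ?_
      have hk' : (n : ℂ) * (n + 1) = k + k := by exact_mod_cast hk
      push_cast
      linear_combination (1 / 2 : ℂ) * hk'
    have h2 := eta_add_nat (2 * z) 2
    push_cast at h2
    rw [eA, eA, mul_add, mul_add, mul_one, mul_one, h1, h2, eta_add_one, mul_pow, mul_pow,
      mul_mul_mul_comm, ← e_nat_mul, ← e_nat_mul, ← e_add,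
      show (1 / 24 + (2 : ℕ) * (2 / 24) : ℂ) = (5 : ℕ) * (1 / 24) by push_cast; norm_num,
      mul_div_mul_left _ _ (e_ne_zero _)]
  have hTB : ∀ z, B (z + 1) = e (-(1 / 24)) * C z := by
    intro z
    have h1 : thetaSum (1 / 3) (1 / 2) (3 * z + 3) = e (1 / 6) * thetaSum (1 / 3) 0 (3 * z) := by
      refine thetaSum_add (fun n ↦ ?_) _
      simp only [mul_zero, Complex.ofReal_zero, e_zero, mul_one]
      rw [← e_add]
      obtain ⟨k, hk⟩ := Int.even_mul_succ_self n
      refine e_mul_int_of_exp (n ^ 2 + n + k) ?_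
      have hk' : (n : ℂ) * (n + 1) = k + k := by exact_mod_cast hk
      push_cast
      linear_combination (1 / 2 : ℂ) * hk'
    rw [eB, eC, mul_add, mul_one, h1, eta_add_one, mul_pow, ← e_nat_mul,
      show (1 / 6 : ℂ) = -(1 / 24) + (5 : ℕ) * (1 / 24) by push_cast; norm_num, e_add]
    have := e_ne_zero ((5 : ℕ) * (1 / 24))
    generalize e ((5 : ℕ) * (1 / 24)) = w at this ⊢
    rw [show e (-(1 / 24)) * w * thetaSum (1 / 3) 0 (3 * z) * eta ((z + 1) / 2) ^ 2 =
      w * (e (-(1 / 24)) * (thetaSum (1 / 3) 0 (3 * z) * eta ((z + 1) / 2) ^ 2)) by ring,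
      mul_div_mul_left _ _ this, mul_div_assoc]
  have hTC : ∀ z, C (z + 1) = e (1 / 24) * B z := by
    intro z
    have h1 : thetaSum (1 / 3) 0 (3 * z + 3) = e (1 / 6) * thetaSum (1 / 3) (1 / 2) (3 * z) := by
      refine thetaSum_add (fun n ↦ ?_) _
      simp only [mul_zero, Complex.ofReal_zero, e_zero, one_mul]
      rw [← e_add]
      obtain ⟨k, hk⟩ := Int.even_mul_pred_self n
      refine e_mul_int_of_exp (n ^ 2 + k + n) ?_
      have hk' : (n : ℂ) * (n - 1) = k + k := by exact_mod_cast hk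
      push_cast
      linear_combination (1 / 2 : ℂ) * hk'
    rw [eB, eC, mul_add, mul_one, h1, eta_add_one, show (z + 1 + 1) / 2 = z / 2 + 1 by ring,
      eta_add_one, mul_pow, mul_pow, mul_mul_mul_comm, ← e_nat_mul, ← e_nat_mul, ← e_add,
      show (1 / 6 + (2 : ℕ) * (1 / 24) : ℂ) = 1 / 24 + (5 : ℕ) * (1 / 24) by push_cast; norm_num,
      e_add]
    have := e_ne_zero ((5 : ℕ) * (1 / 24))
    generalize e ((5 : ℕ) * (1 / 24)) = w at this ⊢
    rw [mul_comm _ w, mul_assoc w, mul_div_mul_left _ _ this, mul_div_assoc]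
  have hκ : ∀ {z : ℂ}, 0 < z.im → (-I * z) ^ (1 / 2 : ℂ) ≠ 0 := neg_I_cpow_half_ne_zero
  have hSA : ∀ z, 0 < z.im → A (-1 / z) = B z / 2 := by
    intro z hz
    rw [eA, eB, thetaSum_sixth_neg_inv hz, eta_two_mul_neg_inv hz, eta_neg_inv hz]
    have := hκ hz
    have := hne z hz
    generalize (-I * z) ^ (1 / 2 : ℂ) = κ at *
    field_simp
  have hSB : ∀ z, 0 < z.im → B (-1 / z) = 2 * A z := by
    intro z hz
    have h := hSA (-1 / z) (im_neg_inv_pos hz)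
    rw [show -1 / (-1 / z) = z by have := ne_zero_of_im_pos hz; field_simp] at h
    rw [h]; ring
  have hSC : ∀ z, 0 < z.im → C (-1 / z) = C z := by
    intro z hz
    rw [eC, eC, thetaSum_third_neg_inv hz, eta_half_add_one_neg_inv hz, eta_neg_inv hz]
    have := hκ hz
    have := hne z hz
    generalize (-I * z) ^ (1 / 2 : ℂ) = κ at *
    field_simp
  have hee : e (-(1 / 24)) * e (1 / 24) = 1 := by rw [← e_add]; simp
  -- The scalars $1/2$ and $e(-1/24)/2$ absorb the constants in `hSA`, `hTB` and `hTC`, so that $S$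
  -- and $T$ permute the three functions exactly.
  obtain ⟨c, hc⟩ := const_of_permuted (A := A) (B := fun z ↦ (1 / 2) * B z)
    (C := fun z ↦ (1 / 2 * e (-(1 / 24))) * C z) (diff _ _ _ _ two_pos)
    ((diff _ _ _ _ (by norm_num)).const_mul _) ((diff _ _ _ _ (by norm_num)).const_mul _)
    (lA.isBigO_one (by norm_num)) ((lB.isBigO_one (by norm_num)).const_mul_left _)
    ((lC.isBigO_one (by norm_num)).const_mul_left _)
    (fun z _ ↦ hTA z) (fun z _ ↦ by simp only [hTB]; ring)
    (fun z _ ↦ by simp only [hTC]; linear_combination (1 / 2) * B z * hee)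
    (fun z hz ↦ by rw [hSA z hz]; ring) (fun z hz ↦ by simp only [hSB z hz]; ring)
    (fun z hz ↦ by simp only [hSC z hz])
  have hB : ∀ z, 0 < z.im → B z = 2 * c := by
    intro z hz
    have := hSA z hz
    rw [hc _ (im_neg_inv_pos hz)] at this
    rw [this]; ring
  have hC : ∀ z, 0 < z.im → C z = e (1 / 24) * (2 * c) := by
    intro z hz
    have := hTB z
    rw [hB _ (by simpa using hz)] at this
    rw [this, ← mul_assoc, mul_comm (e _), hee, one_mul]
  refine ⟨⟨_, lA.ne_zero_of_const (by norm_num) (by norm_num) hc, fun z hz ↦ ?_⟩,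
    ⟨_, lB.ne_zero_of_const (by norm_num) (by norm_num) hB, fun z hz ↦ ?_⟩,
    ⟨_, lC.ne_zero_of_const (by norm_num) (by norm_num) hC, fun z hz ↦ ?_⟩⟩
  · rw [← hc z hz, eA, div_mul_cancel₀ _ (hne z hz)]
  · rw [← hB z hz, eB, div_mul_cancel₀ _ (hne z hz)]
  · rw [← hC z hz, eC, div_mul_cancel₀ _ (hne z hz)]

end EtaTheta

/-! ### Half-period translates of $\eta$ and identification of the functions $E_m$. -/

namespace EtaTheta

open Filter Topology Asymptotics
open ModularForm (eta)

/-! ### The eta function at `z + 1/2` -/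

/-- The Euler function `∏ (1 - x ^ (n + 1))`. -/
noncomputable def eulerProd (x : ℂ) : ℂ := ∏' n : ℕ, (1 - x ^ (n + 1))

/-- The product `∏ (1 - x ^ (2 n + 1))`. -/
noncomputable def oddEulerProd (x : ℂ) : ℂ := ∏' n : ℕ, (1 - x ^ (2 * n + 1))

lemma multipliable_odd_one_sub_pow {x : ℂ} (hx : ‖x‖ < 1) :
    Multipliable fun n : ℕ ↦ 1 - x ^ (2 * n + 1) := by
  have hs : Summable fun n : ℕ ↦ ‖-x ^ (2 * n + 1)‖ := by
    have h := summable_geometric_of_lt_one (norm_nonneg x) hx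
    refine (h.comp_injective (i := fun n : ℕ ↦ 2 * n + 1) fun m n h ↦ ?_).congr fun n ↦ ?_
    · simpa using h
    · simp
  simpa only [← sub_eq_add_neg] using multipliable_one_add_of_summable hs

lemma eulerProd_eq {x : ℂ} (hx : ‖x‖ < 1) : eulerProd x = oddEulerProd x * eulerProd (x ^ 2) := by
  have hx2 : ‖x ^ 2‖ < 1 := by rw [norm_pow]; exact pow_lt_one₀ (norm_nonneg x) hx two_ne_zero
  have h1 := multipliable_odd_one_sub_pow hx
  have h2 := ModularForm.multipliable_one_sub_pow hx2
  have h3 : ∀ k : ℕ, (x ^ 2) ^ (k + 1) = x ^ (2 * k + 1 + 1) := fun k ↦ by rw [← pow_mul]; rfl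
  simp only [h3] at h2
  rw [eulerProd, ← tprod_even_mul_odd (f := fun n ↦ 1 - x ^ (n + 1)) h1 h2, oddEulerProd, eulerProd]
  simp only [h3]

lemma oddEulerProd_mul_neg {x : ℂ} (hx : ‖x‖ < 1) :
    oddEulerProd x * oddEulerProd (-x) = oddEulerProd (x ^ 2) := by
  have h1 := multipliable_odd_one_sub_pow hx
  have h2 := multipliable_odd_one_sub_pow (x := -x) (by rwa [norm_neg])
  rw [oddEulerProd, oddEulerProd, ← h1.tprod_mul h2, oddEulerProd]
  refine tprod_congr fun n ↦ ?_
  rw [Odd.neg_pow ⟨n, rfl⟩]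
  ring

/-- Split each product into odd and even exponents. Only the odd part feels $x\mapsto-x$, and the
odd parts at $x$ and $-x$ multiply to the odd part at $x^2$. -/
lemma eulerProd_neg {x : ℂ} (hx : ‖x‖ < 1) :
    eulerProd (-x) * (eulerProd x * eulerProd (x ^ 4)) = eulerProd (x ^ 2) ^ 3 := by
  have hx2 : ‖x ^ 2‖ < 1 := by rw [norm_pow]; exact pow_lt_one₀ (norm_nonneg x) hx two_ne_zero
  have h1 := eulerProd_eq hx
  have h2 := eulerProd_eq (x := -x) (by rwa [norm_neg])
  have h3 := eulerProd_eq hx2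
  have h4 := oddEulerProd_mul_neg hx
  rw [neg_sq] at h2
  rw [← pow_mul] at h3
  norm_num only at h3
  rw [h1, h2]
  linear_combination eulerProd (x ^ 2) ^ 2 * eulerProd (x ^ 4) * h4 - eulerProd (x ^ 2) ^ 2 * h3

lemma eta_eq_eulerProd (z : ℂ) : eta z = e (z / 24) * eulerProd (e z) := by
  rw [eta, eulerProd, Function.Periodic.qParam, e]
  congr 1
  · congr 1; push_cast; ring
  · refine tprod_congr fun n ↦ ?_
    rw [ModularForm.eta_q_eq_pow, e]

lemma eta_add_half {z : ℂ} (hz : 0 < z.im) :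
    eta (z + 1 / 2) = e (1 / 48) * (eta (2 * z) ^ 3 / (eta z * eta (4 * z))) := by
  have h4z : 0 < (4 * z).im := by simpa using im_smul_pos hz (c := 4) (by norm_num)
  have hx : ‖e z‖ < 1 := by
    rw [norm_e, Real.exp_lt_one_iff]
    have := mul_pos Real.two_pi_pos hz
    linarith
  have h := eulerProd_neg hx
  have h1 := e_nat_mul 2 z
  have h2 := e_nat_mul 4 z
  have h3 : e (z + 1 / 2) = -e z := by rw [e_add, e_half]; ring
  have h2' : e (4 * z) = e z ^ 4 := by exact_mod_cast h2
  push_cast at h1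
  rw [← mul_div_assoc, eq_div_iff (mul_ne_zero (ModularForm.eta_ne_zero hz)
    (ModularForm.eta_ne_zero h4z)), eta_eq_eulerProd, eta_eq_eulerProd z, eta_eq_eulerProd (4 * z),
    eta_eq_eulerProd (2 * z), h1, h2', h3, mul_pow, ← e_nat_mul 3]
  have h5 : e ((z + 1 / 2) / 24) * (e (z / 24) * e (4 * z / 24)) =
      e (1 / 48) * e ((3 : ℕ) * (2 * z / 24)) := by
    rw [← e_add, ← e_add, ← e_add]
    congr 1; push_cast; ring
  linear_combination e (1 / 48) * e ((3 : ℕ) * (2 * z / 24)) * h +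
    eulerProd (-e z) * (eulerProd (e z) * eulerProd (e z ^ 4)) * h5

/-! ### The odd eta-theta functions as theta series -/

lemma thetaSum_oddEtaTheta_one : ∃ C : ℂ, C ≠ 0 ∧ ∀ z : ℂ, 0 < z.im →
    thetaSum (1 / 4) 0 z = C * oddEtaTheta .one (2 * z / (shadowLevel .one : ℂ) ^ 2) := by
  obtain ⟨C, hC, h⟩ := thetaSum_quarter_eq
  refine ⟨C, hC, fun z hz ↦ ?_⟩
  have h1 := h (z / 4) (by simpa using div_pos hz four_pos)
  simp only [oddEtaTheta, shadowLevel]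
  push_cast
  rw [show 8 * (2 * z / 8 ^ 2) = z / 4 by ring, ← h1, show 4 * (z / 4) = z by ring]

/-- The translate of the formula for $\eta^3$ by $1/2$: the translation twists the theta series by
$(-1)^n$. -/
lemma thetaSum_oddEtaTheta_two : ∃ C : ℂ, C ≠ 0 ∧ ∀ z : ℂ, 0 < z.im →
    thetaSum (1 / 4) (1 / 2) z = C * oddEtaTheta .two (2 * z / (shadowLevel .two : ℂ) ^ 2) := by
  obtain ⟨C, hC, h⟩ := thetaSum_quarter_eq
  refine ⟨e (-(1 / 16)) * (C * e (1 / 48) ^ 3), mul_ne_zero (e_ne_zero _)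
    (mul_ne_zero hC (pow_ne_zero 3 (e_ne_zero _))), fun z hz ↦ ?_⟩
  have hz4 : 0 < (z / 4).im := by simpa using div_pos hz four_pos
  have h1 := h (z / 4 + 1 / 2) (by simpa using hz4)
  have h2 : thetaSum (1 / 4) 0 (z + 2) = e (1 / 16) * thetaSum (1 / 4) (1 / 2) z := by
    refine thetaSum_add (fun n ↦ ?_) _
    simp only [mul_zero, Complex.ofReal_zero, e_zero, one_mul]
    rw [← e_add]
    exact e_mul_int_of_exp (n ^ 2) (by push_cast; ring)
  rw [show 4 * (z / 4 + 1 / 2) = z + 2 by ring, h2, eta_add_half hz4] at h1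
  have hE : oddEtaTheta .two (2 * z / (shadowLevel .two : ℂ) ^ 2) =
      (eta (2 * (z / 4)) ^ 3 / (eta (z / 4) * eta (4 * (z / 4)))) ^ 3 := by
    simp only [oddEtaTheta, shadowLevel]
    push_cast
    rw [show 16 * (2 * z / 8 ^ 2) = 2 * (z / 4) by ring, show 8 * (2 * z / 8 ^ 2) = z / 4 by ring,
      show 32 * (2 * z / 8 ^ 2) = 4 * (z / 4) by ring]
    ring
  rw [hE, e_neg]
  have := e_ne_zero (1 / 16)
  rw [mul_assoc, mul_assoc, ← mul_pow, ← h1, inv_mul_cancel_left₀ this]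

lemma thetaSum_oddEtaTheta_three : ∃ C : ℂ, C ≠ 0 ∧ ∀ z : ℂ, 0 < z.im →
    thetaSum (1 / 3) 0 z = C * oddEtaTheta .three (2 * z / (shadowLevel .three : ℂ) ^ 2) := by
  obtain ⟨C, hC, h⟩ := weber_quotients_const.2.2
  refine ⟨C / e (1 / 48) ^ 2, div_ne_zero hC (pow_ne_zero 2 (e_ne_zero _)), fun z hz ↦ ?_⟩
  have hz6 : 0 < (z / 6).im := by simpa using div_pos hz (by norm_num : (0 : ℝ) < 6)
  have hz3 : 0 < (2 * (z / 6)).im := by simpa using im_smul_pos hz6 two_pos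
  have hz23 : 0 < (4 * (z / 6)).im := by simpa using im_smul_pos hz6 four_pos
  have h1 := h (2 * (z / 6)) hz3
  rw [show 3 * (2 * (z / 6)) = z by ring,
    show (2 * (z / 6) + 1) / 2 = z / 6 + 1 / 2 by ring, eta_add_half hz6] at h1
  simp only [oddEtaTheta, shadowLevel]
  push_cast
  rw [show 3 * (2 * z / 6 ^ 2) = z / 6 by ring, show 12 * (2 * z / 6 ^ 2) = 4 * (z / 6) by ring,
    show 6 * (2 * z / 6 ^ 2) = 2 * (z / 6) by ring]
  have h2 := ModularForm.eta_ne_zero hz6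
  have h3 := ModularForm.eta_ne_zero hz3
  have h4 := ModularForm.eta_ne_zero hz23
  have h5 := e_ne_zero (1 / 48)
  generalize eta (z / 6) = x at *
  generalize eta (2 * (z / 6)) = y at *
  generalize eta (4 * (z / 6)) = t at *
  generalize e (1 / 48) = w at *
  generalize thetaSum (1 / 3) 0 z = s at *
  field_simp at h1 ⊢
  linear_combination h1

lemma thetaSum_oddEtaTheta_five : ∃ C : ℂ, C ≠ 0 ∧ ∀ z : ℂ, 0 < z.im →
    thetaSum (1 / 6) 0 z = C * oddEtaTheta .five (2 * z / (shadowLevel .five : ℂ) ^ 2) := by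
  obtain ⟨C, hC, h⟩ := weber_quotients_const.1
  refine ⟨C, hC, fun z hz ↦ ?_⟩
  have hz3 : 0 < (z / 3).im := by simpa using div_pos hz three_pos
  have hz23 : 0 < (2 * (z / 3)).im := by simpa using im_smul_pos hz3 two_pos
  have h1 := h (z / 3) hz3
  simp only [oddEtaTheta, shadowLevel]
  push_cast
  rw [show 24 * (2 * z / 12 ^ 2) = z / 3 by ring, show 48 * (2 * z / 12 ^ 2) = 2 * (z / 3) by ring,
    ← mul_div_assoc, eq_div_iff (pow_ne_zero 2 (ModularForm.eta_ne_zero hz23)), ← h1,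
    show 3 * (z / 3) = z by ring]

lemma thetaSum_oddEtaTheta_six : ∃ C : ℂ, C ≠ 0 ∧ ∀ z : ℂ, 0 < z.im →
    thetaSum (1 / 3) (1 / 2) z = C * oddEtaTheta .six (2 * z / (shadowLevel .six : ℂ) ^ 2) := by
  obtain ⟨C, hC, h⟩ := weber_quotients_const.2.1
  refine ⟨C, hC, fun z hz ↦ ?_⟩
  have hz3 : 0 < (z / 3).im := by simpa using div_pos hz three_pos
  have hz6 : 0 < (z / 3 / 2).im := by simpa using div_pos hz3 two_pos
  have h1 := h (z / 3) hz3
  simp only [oddEtaTheta, shadowLevel]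
  push_cast
  rw [show 6 * (2 * z / 6 ^ 2) = z / 3 by ring, show 3 * (2 * z / 6 ^ 2) = z / 3 / 2 by ring,
    ← mul_div_assoc, eq_div_iff (pow_ne_zero 2 (ModularForm.eta_ne_zero hz6)), ← h1,
    show 3 * (z / 3) = z by ring]

/-- For $n=2k$ the argument $n+1/6$ is $2(k+1/12)$, and for $n=-2k-1$ it is $-2(k+5/12)$.
Translation by $6/4$ supplies the twist $(-1)^k$, and in the odd class also a sign that offsets the
minus. This is why $V_{4n}$ has two constituents. -/
lemma thetaSum_sixth_split {z : ℂ} (hz : 0 < z.im) : thetaSum (1 / 6) 0 ((z + 6) / 4) =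
    2 * e (1 / 48) * (thetaSum (1 / 12) (1 / 2) z + thetaSum (5 / 12) (1 / 2) z) := by
  have hz4 : 0 < ((z + 6) / 4).im := by simpa using div_pos hz four_pos
  let F : ℤ → ℂ := fun n ↦
    ((n + (1 / 6 : ℝ) : ℝ) : ℂ) * e ((n * 0 : ℝ)) *
      e (((n + (1 / 6 : ℝ) : ℝ) : ℂ) ^ 2 / 2 * ((z + 6) / 4))
  have h1 : HasSum (fun k : ℤ ↦ F (2 * k)) (2 * e (1 / 48) * thetaSum (1 / 12) (1 / 2) z) := by
    have h := (summable_thetaSum (1 / 12) (1 / 2) hz).hasSum.mul_left (2 * e (1 / 48))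
    refine h.congr_fun fun k ↦ ?_
    have h3 : e (((2 * k : ℤ) + (1 / 6 : ℝ) : ℝ) ^ 2 / 2 * ((z + 6) / 4)) = e (1 / 48) *
        (e ((k * (1 / 2) : ℝ)) * e (((k + (1 / 12 : ℝ) : ℝ) : ℂ) ^ 2 / 2 * z)) := by
      rw [← e_add, ← e_add]
      obtain ⟨j, hj⟩ := Int.even_mul_succ_self k
      refine e_mul_int_of_exp (3 * k ^ 2) ?_
      push_cast
      ring
    simp only [F]
    rw [h3, mul_zero, Complex.ofReal_zero, e_zero]
    push_cast
    ring
  have h2 : HasSum (fun k : ℤ ↦ F (-2 * k - 1)) (2 * e (1 / 48) * thetaSum (5 / 12) (1 / 2) z) := by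
    have h := (summable_thetaSum (5 / 12) (1 / 2) hz).hasSum.mul_left (2 * e (1 / 48))
    refine h.congr_fun fun k ↦ ?_
    have h3 : e (((-2 * k - 1 : ℤ) + (1 / 6 : ℝ) : ℝ) ^ 2 / 2 * ((z + 6) / 4)) = e (1 / 2) *
        (e (1 / 48) * (e ((k * (1 / 2) : ℝ)) * e (((k + (5 / 12 : ℝ) : ℝ) : ℂ) ^ 2 / 2 * z))) := by
      rw [← e_add, ← e_add, ← e_add]
      refine e_mul_int_of_exp (3 * k ^ 2 + 2 * k) ?_
      push_cast
      ring
    simp only [F]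
    rw [h3, mul_zero, Complex.ofReal_zero, e_zero, e_half]
    push_cast
    ring
  have hinj : Function.Injective fun k : ℤ ↦ 2 * k := fun a b h ↦ by simpa using h
  have hinj' : Function.Injective fun k : ℤ ↦ -2 * k - 1 := fun a b h ↦ by simpa using h
  have hc : IsCompl (Set.range fun k : ℤ ↦ 2 * k) (Set.range fun k : ℤ ↦ -2 * k - 1) := by
    rw [isCompl_iff, Set.disjoint_left, codisjoint_iff]
    constructor
    · rintro _ ⟨a, rfl⟩ ⟨b, hb⟩
      simp only at hb
      omega
    · refine Set.eq_univ_of_forall fun n ↦ ?_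
      rcases Int.even_or_odd' n with ⟨k, rfl | rfl⟩
      · exact Or.inl ⟨k, rfl⟩
      · exact Or.inr ⟨-k - 1, by simp only; ring⟩
  have h := HasSum.add_isCompl (f := F) hc (hinj.hasSum_range_iff.mpr h1)
    (hinj'.hasSum_range_iff.mpr h2)
  rw [mul_add, ← h.tsum_eq]
  rfl

lemma thetaSum_oddEtaTheta_four : ∃ C : ℂ, C ≠ 0 ∧ ∀ z : ℂ, 0 < z.im →
    thetaSum (1 / 12) (1 / 2) z + thetaSum (5 / 12) (1 / 2) z =
      C * oddEtaTheta .four (2 * z / (shadowLevel .four : ℂ) ^ 2) := by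
  obtain ⟨C, hC, h⟩ := thetaSum_oddEtaTheta_five
  refine ⟨C * e (1 / 48) ^ 5 / (e (1 / 24) ^ 2 * (2 * e (1 / 48))), div_ne_zero
    (mul_ne_zero hC (pow_ne_zero 5 (e_ne_zero _))) (mul_ne_zero (pow_ne_zero 2 (e_ne_zero _))
    (mul_ne_zero two_ne_zero (e_ne_zero _))), fun z hz ↦ ?_⟩
  have hz4 : 0 < ((z + 6) / 4).im := by simpa using div_pos hz four_pos
  have hz12 : 0 < (z / 12).im := by simpa using div_pos hz (by norm_num : (0 : ℝ) < 12)
  have hz6 : 0 < (2 * (z / 12)).im := by simpa using im_smul_pos hz12 two_pos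
  have hz3 : 0 < (4 * (z / 12)).im := by simpa using im_smul_pos hz12 four_pos
  have h1 := h _ hz4
  rw [thetaSum_sixth_split hz] at h1
  have hE : oddEtaTheta .five (2 * ((z + 6) / 4) / (shadowLevel .five : ℂ) ^ 2) =
      (e (1 / 48) * (eta (2 * (z / 12)) ^ 3 / (eta (z / 12) * eta (4 * (z / 12))))) ^ 5 /
        (e (1 / 24) * eta (2 * (z / 12))) ^ 2 := by
    simp only [oddEtaTheta, shadowLevel]
    push_cast
    rw [← eta_add_half hz12, ← eta_add_one]
    congr 3
    · ring
    · ring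
  rw [hE] at h1
  simp only [oddEtaTheta, shadowLevel]
  push_cast
  rw [show 48 * (2 * z / 24 ^ 2) = 2 * (z / 12) by ring, show 24 * (2 * z / 24 ^ 2) = z / 12 by ring,
    show 96 * (2 * z / 24 ^ 2) = 4 * (z / 12) by ring]
  have h2 := ModularForm.eta_ne_zero hz12
  have h3 := ModularForm.eta_ne_zero hz6
  have h4 := ModularForm.eta_ne_zero hz3
  have h5 := e_ne_zero (1 / 48)
  have h6 := e_ne_zero (1 / 24)
  generalize eta (z / 12) = x at *
  generalize eta (2 * (z / 12)) = y at *
  generalize eta (4 * (z / 12)) = t at *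
  generalize e (1 / 48) = w at *
  generalize e (1 / 24) = u at *
  generalize thetaSum (1 / 12) (1 / 2) z + thetaSum (5 / 12) (1 / 2) z = s at *
  field_simp at h1 ⊢
  linear_combination h1

lemma thetaSum_add_one_right (a b : ℝ) (z : ℂ) : thetaSum a (b + 1) z = thetaSum a b z := by
  refine tsum_congr fun n ↦ ?_
  rw [e_mul_int_of_exp (z := ((n * (b + 1) : ℝ) : ℂ)) (w := ((n * b : ℝ) : ℂ)) n
    (by push_cast; ring)]

lemma shadowTheta_eq_thetaSum (a b : ℝ) (z : ℂ) :
    shadowTheta a b z = e (((b / 2 : ℝ) : ℂ)) * thetaSum (1 / 2 + a) (b + 1 / 2) z := by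
  rw [shadowTheta, thetaSum, ← tsum_mul_left]
  refine tsum_congr fun n ↦ ?_
  have h : (-1 : ℂ) ^ n * e ((((n : ℝ) + 1 / 2) * b : ℝ)) =
      e (((b / 2 : ℝ) : ℂ)) * e ((n * (b + 1 / 2) : ℝ)) := by
    rw [← e_int_div_two, ← e_add, ← e_add]
    congr 1; push_cast; ring
  rw [h]
  push_cast
  ring_nf

end EtaTheta

/-! ### Periodicity and the arithmetic of the parameter tables and groups. -/

namespace EtaTheta

open Filter Topology Asymptotics

/-! ### Periodicity of `μ` at torsion points -/

lemma mu_add_one_left (u v : ℂ) (τ : ℍ) : mu (u + 1) v τ = -mu u v τ := by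
  have : e (u + 1) = e u := by simpa using e_add_int u 1
  rw [mu, mu, e_half_add, this]
  ring

lemma mu_add_one_right (u v : ℂ) (τ : ℍ) : mu u (v + 1) τ = -mu u v τ := by
  rw [mu, mu, vartheta_add_one, ← appellSum, ← appellSum, appellSum_add_one, div_neg]
  ring

lemma mu_add_even_int (u v : ℂ) (m n : ℤ) (τ : ℍ) : mu (u + 2 * m) (v + 2 * n) τ = mu u v τ := by
  have h1 : ∀ u v : ℂ, mu (u + 2) v τ = mu u v τ := fun u v ↦ by
    rw [show u + 2 = u + 1 + 1 by ring, mu_add_one_left, mu_add_one_left, neg_neg]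
  have h2 : ∀ u v : ℂ, mu u (v + 2) τ = mu u v τ := fun u v ↦ by
    rw [show v + 2 = v + 1 + 1 by ring, mu_add_one_right, mu_add_one_right, neg_neg]
  have h3 : Function.Periodic (fun u ↦ mu u (v + 2 * n) τ) 2 := fun u ↦ h1 u _
  have h4 : Function.Periodic (fun v ↦ mu u v τ) 2 := fun v ↦ h2 u v
  have h5 := (h3.int_mul m) u
  have h6 := (h4.int_mul n) v
  rw [mul_comm 2 (m : ℂ), h5, mul_comm 2 (n : ℂ), h6]

lemma torsionMu_add_nat (a b a' b' : ℝ) (n : ℕ) {τ τ' : ℍ} (h : (τ' : ℂ) = τ + n) :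
    torsionMu a b a' b' τ' = e (((-(a - a') ^ 2 / 2 - 1 / 8 : ℝ) : ℂ)) ^ n *
      torsionMu a (b + n * a) a' (b' + n * a') τ := by
  induction n generalizing b b' τ with
  | zero =>
    have : τ' = τ := by ext; simpa using h
    simp [this]
  | succ n ih =>
    let σ : ℍ := ⟨τ + 1, by simpa using τ.im_pos⟩
    have hσ : (σ : ℂ) = τ + 1 := rfl
    rw [ih b b' (τ := σ) (by rw [h, hσ]; push_cast; ring), pow_succ (e _) n, mul_assoc]
    congr 1
    rw [torsionMu, torsionMu, mu_T _ _ hσ, hσ, ← mul_assoc, ← mul_assoc, ← e_add, ← e_add]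
    push_cast
    congr 2
    · ring
    · ring
    · ring

/-- $288$ clears both $(a-a')^2/2\in\frac1{288}\mathbb Z$ and $1/8$. The resulting shifts $288a$ and
$288a'$ are even integers, so no sign appears. -/
lemma torsionMu_periodic {a b a' b' : ℝ} {A A' : ℤ} (hA : a * 12 = A) (hA' : a' * 12 = A')
    {τ τ' : ℍ} (h : (τ' : ℂ) = τ + (288 : ℕ)) :
    torsionMu a b a' b' τ' = torsionMu a b a' b' τ := by
  have hA1 : (a : ℂ) * 12 = A := by exact_mod_cast hA
  have hA2 : (a' : ℂ) * 12 = A' := by exact_mod_cast hA'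
  have h1 : e (((-(a - a') ^ 2 / 2 - 1 / 8 : ℝ) : ℂ)) ^ 288 = 1 := by
    rw [← e_nat_mul, ← e_zero]
    refine e_mul_int_of_exp (-(A - A') ^ 2 - 36) ?_
    push_cast
    rw [← hA1, ← hA2]
    ring
  rw [torsionMu_add_nat a b a' b' 288 h, h1, one_mul, torsionMu, torsionMu]
  congr 1
  have h2 := mu_add_even_int (a * τ + b) (a' * τ + b') (12 * A) (12 * A') τ
  rw [← h2]
  push_cast
  rw [← hA1, ← hA2]
  congr 1 <;> ring

/-! ### The coefficients of `u` and `v` -/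

/-- The pair `(α, β)` with `u = α τ + β`. -/
def uCoeff (j : MuIndex) (n : ℕ) : ℚ × ℚ :=
  ((vCoeff n).1 + (dCoeff j).1, (vCoeff n).2 + (dCoeff j).2)

lemma notBothInt_of_den {q r : ℚ} (h : q.den ≠ 1 ∨ r.den ≠ 1) : NotBothInt (q : ℝ) (r : ℝ) := by
  rintro m n ⟨hm, hn⟩
  have hm' : q = m := by exact_mod_cast hm
  have hn' : r = n := by exact_mod_cast hn
  rcases h with h | h
  · exact h (by rw [hm', Rat.den_intCast])
  · exact h (by rw [hn', Rat.den_intCast])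

lemma vCoeff_spec {n : ℕ} (h1 : 1 ≤ n) (h8 : n ≤ 8) : (vCoeff n).1.den ≠ 1 ∧ 0 ≤ (vCoeff n).1 ∧
    (vCoeff n).1 < 1 ∧ ((vCoeff n).1 * 12).den = 1 := by
  interval_cases n <;> decide +kernel

/-- These properties of $\alpha$ give, in order, the matching signs in $R$, the width $288$, the
distinct exponents of the non-holomorphic part, and the exact normalising power of $q$. -/
lemma dCoeff_spec (j : MuIndex) : |(dCoeff j).1| < 1 / 2 ∧ ((dCoeff j).1 * 12).den = 1 ∧
    ¬ (6 ∣ ((dCoeff j).1 * 12).num) ∧ tConst j = -(dCoeff j).1 ^ 2 / 2 := by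
  cases j <;> decide +kernel

/-- Here admissibility is decisive: at the five excluded pairs $u=0$, a pole of $\mu$. -/
lemma uCoeff_den {j : MuIndex} {n : ℕ} (h : Admissible (.ofMu j) n) :
    (uCoeff j n).1.den ≠ 1 ∨ (uCoeff j n).2.den ≠ 1 := by
  obtain ⟨h1, h8, h⟩ := h
  interval_cases n <;> cases j <;> first | (exact absurd rfl h) | decide +kernel

lemma groupLevel_spec {j : MuIndex} {n : ℕ} (h : Admissible (.ofMu j) n) :
    (((vCoeff n).1 * groupLevel (.ofMu j) n).den = 1 ∧
      ((uCoeff j n).1 * groupLevel (.ofMu j) n).den = 1) ∧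
    ((vCoeff n).2 * 2).den = 1 ∧ ((uCoeff j n).2 * 2).den = 1 := by
  obtain ⟨h1, h8, h⟩ := h
  interval_cases n <;> cases j <;> first | (exact absurd rfl h) | decide +kernel

lemma needsGammaZeroTwo_of_ne_zero {j : MuIndex} {n : ℕ} (h : Admissible (.ofMu j) n)
    (h0 : (vCoeff n).2 ≠ 0 ∨ (uCoeff j n).2 ≠ 0) : NeedsGammaZeroTwo (.ofMu j) n := by
  obtain ⟨h1, h8, -⟩ := h
  interval_cases n <;> cases j <;> first
    | exact trivial
    | exact Nat.even_iff.mpr rfl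
    | exact absurd h0 (by decide +kernel)

/-! ### The groups -/

lemma groupA_le_gammaUpperOne (m : MockIndex) (n : ℕ) :
    groupA m n ≤ GammaUpperOne (groupLevel m n) := by
  rw [groupA]
  split_ifs
  · exact inf_le_left
  · exact le_rfl

lemma even_of_mem_groupA {m : MockIndex} {n : ℕ} (h : NeedsGammaZeroTwo m n) {γ : SL(2, ℤ)}
    (hγ : γ ∈ groupA m n) : (2 : ℤ) ∣ γ 1 0 := by
  rw [groupA, if_pos h] at hγ
  have := CongruenceSubgroup.Gamma0_mem.mp hγ.2
  exact (ZMod.intCast_zmod_eq_zero_iff_dvd _ 2).mp this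

lemma mem_gammaUpperOne_iff {N : ℕ} {γ : SL(2, ℤ)} : γ ∈ GammaUpperOne N ↔
    (N : ℤ) ∣ γ 0 0 - 1 ∧ (N : ℤ) ∣ γ 1 1 - 1 ∧ (N : ℤ) ∣ γ 0 1 := by
  rw [← ZMod.intCast_zmod_eq_zero_iff_dvd, ← ZMod.intCast_zmod_eq_zero_iff_dvd,
    ← ZMod.intCast_zmod_eq_zero_iff_dvd, Int.cast_sub, Int.cast_sub, Int.cast_one, sub_eq_zero,
    sub_eq_zero]
  rfl

lemma gamma_two_mul_le (N : ℕ) : CongruenceSubgroup.Gamma (2 * N) ≤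
    GammaUpperOne N ⊓ CongruenceSubgroup.Gamma0 2 := by
  intro γ hγ
  obtain ⟨h1, h2, h3, h4⟩ := CongruenceSubgroup.Gamma_mem.mp hγ
  have h1' : ((γ 0 0 - 1 : ℤ) : ZMod (2 * N)) = 0 := by push_cast; rw [h1, sub_self]
  have h4' : ((γ 1 1 - 1 : ℤ) : ZMod (2 * N)) = 0 := by push_cast; rw [h4, sub_self]
  rw [ZMod.intCast_zmod_eq_zero_iff_dvd] at h1' h2 h3 h4'
  have hN : (N : ℤ) ∣ (2 * N : ℕ) := by push_cast; exact dvd_mul_left _ _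
  have h2N : ((2 : ℕ) : ℤ) ∣ (2 * N : ℕ) := by push_cast; exact dvd_mul_right _ _
  exact ⟨mem_gammaUpperOne_iff.mpr ⟨hN.trans h1', hN.trans h4', hN.trans h2⟩,
    CongruenceSubgroup.Gamma0_mem.mpr ((ZMod.intCast_zmod_eq_zero_iff_dvd _ 2).mpr (h2N.trans h3))⟩

lemma groupLevel_pos (m : MockIndex) (n : ℕ) : 0 < groupLevel m n := by
  unfold groupLevel
  split <;> (try split_ifs) <;> norm_num

lemma isCongruenceSubgroup_groupA (m : MockIndex) (n : ℕ) :
    CongruenceSubgroup.IsCongruenceSubgroup (groupA m n) := by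
  refine ⟨2 * groupLevel m n, by have := groupLevel_pos m n; omega, ?_⟩
  refine (gamma_two_mul_le _).trans ?_
  rw [groupA]
  split_ifs
  · exact le_rfl
  · exact inf_le_left

lemma exists_int_of_den {q : ℚ} (h : q.den = 1) : ∃ A : ℤ, (q : ℝ) = A :=
  ⟨q.num, by
    have := Rat.num_div_den q
    rw [h] at this
    exact_mod_cast (by simpa using this.symm : q = (q.num : ℚ))⟩

/-- The row $(q,r)$ times $\gamma$ must differ from $(q,r)$ by integers. The conditions on $a$ and
$b$ modulo $N$ handle $q$; a nonzero half-integral $r$ is handled by $c$ even and $d$ odd, which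
explains the factor $\Gamma_0(2)$. -/
lemma exists_shift {q r : ℚ} {N : ℕ} {γ : SL(2, ℤ)} (hγ : γ ∈ GammaUpperOne N)
    (hq : (q * N).den = 1) (hr : (r * 2).den = 1) (h : r = 0 ∨ (2 : ℤ) ∣ γ 1 0) :
    ∃ k l : ℤ, (q : ℝ) * γ 0 0 + r * γ 1 0 = q + k ∧ (q : ℝ) * γ 0 1 + r * γ 1 1 = r + l := by
  obtain ⟨⟨a, ha⟩, ⟨d, hd⟩, ⟨b, hb⟩⟩ := mem_gammaUpperOne_iff.mp hγ
  obtain ⟨A, hA⟩ := exists_int_of_den hq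
  obtain ⟨B, hB⟩ := exists_int_of_den hr
  have ha' : (γ 0 0 : ℝ) = 1 + N * a := by
    have : (γ 0 0 : ℤ) = 1 + N * a := by omega
    exact_mod_cast this
  have hb' : (γ 0 1 : ℝ) = N * b := by exact_mod_cast hb
  push_cast at hA hB
  rcases h with rfl | h
  · refine ⟨A * a, A * b, ?_, ?_⟩
    · rw [ha']; push_cast; rw [← hA]; ring
    · rw [hb']; push_cast; rw [← hA]; ring
  · have hdet := det_eq_one_int γ
    -- The determinant forces $d$ to be odd when $c$ is even.
    have h1 : (2 : ℤ) ∣ γ 1 1 - 1 := by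
      obtain ⟨c, hc⟩ := h
      rw [hc] at hdet
      rcases Int.even_or_odd (γ 1 1) with ⟨x, hx⟩ | ⟨x, hx⟩
      · exfalso
        rw [hx] at hdet
        have : 2 * (γ 0 0 * x - γ 0 1 * c) = 1 := by linarith
        omega
      · exact ⟨x, by omega⟩
    obtain ⟨c, hc⟩ := h
    obtain ⟨x, hx⟩ := h1
    have hc' : (γ 1 0 : ℝ) = 2 * c := by exact_mod_cast hc
    have hx' : (γ 1 1 : ℝ) = 1 + 2 * x := by
      have : (γ 1 1 : ℤ) = 1 + 2 * x := by omega
      exact_mod_cast this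
    refine ⟨A * a + B * c, A * b + B * x, ?_, ?_⟩
    · rw [ha', hc']; push_cast; rw [← hA, ← hB]; ring
    · rw [hb', hx']; push_cast; rw [← hA, ← hB]; ring

end EtaTheta

/-! ### Transfer to $V_{mn}$ and comparison of multipliers. -/

namespace EtaTheta

open Filter Topology Asymptotics

/-! ### The functions `V` as functions attached to torsion points -/

lemma wConst_ne_zero (j : MuIndex) : wConst j ≠ 0 := by cases j <;> simp [wConst]

lemma tConst_eq (j : MuIndex) (n : ℕ) : ((tConst j : ℚ) : ℂ) =
    ((-(((uCoeff j n).1 : ℝ) - ((vCoeff n).1 : ℝ)) ^ 2 / 2 : ℝ) : ℂ) := by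
  rw [(dCoeff_spec j).2.2.2, uCoeff]
  push_cast
  ring

lemma vParam_eq (n : ℕ) (τ : ℍ) :
    vParam n τ = (((vCoeff n).1 : ℝ) : ℂ) * τ + (((vCoeff n).2 : ℝ) : ℂ) := by
  rw [vParam]; push_cast; rfl

lemma uParam_eq (j : MuIndex) (n : ℕ) (τ : ℍ) :
    uParam j n τ = (((uCoeff j n).1 : ℝ) : ℂ) * τ + (((uCoeff j n).2 : ℝ) : ℂ) := by
  rw [uParam, vParam, uCoeff]; push_cast; ring

lemma muV_eq (j : MuIndex) (n : ℕ) : muV j n = fun τ ↦ wConst j *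
    torsionMu (uCoeff j n).1 (uCoeff j n).2 (vCoeff n).1 (vCoeff n).2 τ := by
  ext τ
  rw [muV, torsionMu, tConst_eq j n, uParam_eq, vParam_eq, mul_assoc]

lemma muVHat_eq (j : MuIndex) (n : ℕ) : muVHat j n = fun τ ↦ wConst j *
    torsionMuHat (uCoeff j n).1 (uCoeff j n).2 (vCoeff n).1 (vCoeff n).2 τ := by
  ext τ
  rw [muVHat, torsionMuHat, tConst_eq j n, uParam_eq, vParam_eq, mul_assoc]

lemma uCoeff_sub_fst (j : MuIndex) (n : ℕ) :
    ((uCoeff j n).1 : ℝ) - ((vCoeff n).1 : ℝ) = ((dCoeff j).1 : ℝ) := by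
  rw [uCoeff]; push_cast; ring

lemma uCoeff_sub_snd (j : MuIndex) (n : ℕ) :
    ((uCoeff j n).2 : ℝ) - ((vCoeff n).2 : ℝ) = ((dCoeff j).2 : ℝ) := by
  rw [uCoeff]; push_cast; ring

lemma abs_dCoeff_lt (j : MuIndex) : |((dCoeff j).1 : ℝ)| < 1 / 2 := by
  have := (Rat.cast_lt (K := ℝ)).mpr (dCoeff_spec j).1
  rw [Rat.cast_abs] at this
  norm_num at this ⊢
  exact this

lemma notBothInt_vCoeff {j : MuIndex} {n : ℕ} (h : Admissible (.ofMu j) n) :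
    NotBothInt ((vCoeff n).1 : ℝ) ((vCoeff n).2 : ℝ) :=
  notBothInt_of_den (.inl (vCoeff_spec h.1 h.2.1).1)

lemma notBothInt_uCoeff {j : MuIndex} {n : ℕ} (h : Admissible (.ofMu j) n) :
    NotBothInt ((uCoeff j n).1 : ℝ) ((uCoeff j n).2 : ℝ) :=
  notBothInt_of_den (uCoeff_den h)

lemma exists_vCoeff_mul {j : MuIndex} {n : ℕ} (h : Admissible (.ofMu j) n) :
    ∃ A : ℤ, ((vCoeff n).1 : ℝ) * 12 = A := by
  obtain ⟨A, hA⟩ := exists_int_of_den (vCoeff_spec h.1 h.2.1).2.2.2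
  exact ⟨A, by rw [← hA]; push_cast; rfl⟩

lemma dCoeff_mul_eq (j : MuIndex) :
    ((dCoeff j).1 : ℝ) * 12 = (((dCoeff j).1 * 12).num : ℤ) := by
  obtain ⟨A, hA⟩ := exists_int_of_den (dCoeff_spec j).2.1
  have : (dCoeff j).1 * 12 = (A : ℚ) := by exact_mod_cast hA
  rw [this, Rat.num_intCast, ← hA]
  push_cast; rfl

lemma holUHP_muV {j : MuIndex} {n : ℕ} (h : Admissible (.ofMu j) n) : HolUHP (muV j n) := by
  rw [muV_eq]
  exact (holUHP_torsionMu (notBothInt_uCoeff h) (notBothInt_vCoeff h)).const_mul _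

lemma expGrowth_muV {j : MuIndex} {n : ℕ} (h : Admissible (.ofMu j) n) : ExpGrowth (muV j n) := by
  rw [muV_eq]
  refine (expGrowth_torsionMu (notBothInt_uCoeff h) (notBothInt_vCoeff h) ?_ ?_).const_mul _
  · exact_mod_cast (vCoeff_spec h.1 h.2.1).2.1
  · exact_mod_cast (vCoeff_spec h.1 h.2.1).2.2.1

lemma muV_periodic {j : MuIndex} {n : ℕ} (h : Admissible (.ofMu j) n) (τ τ' : ℍ)
    (hτ : (τ' : ℂ) = τ + (288 : ℕ)) : muV j n τ' = muV j n τ := by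
  obtain ⟨A', hA'⟩ := exists_vCoeff_mul h
  have hA : ((uCoeff j n).1 : ℝ) * 12 = ((A' + ((dCoeff j).1 * 12).num : ℤ) : ℝ) := by
    push_cast
    rw [← hA', ← dCoeff_mul_eq, ← uCoeff_sub_fst j n]
    ring
  simp only [muV_eq]
  rw [torsionMu_periodic hA hA' hτ]

lemma muVHat_eq_muV_add (j : MuIndex) (n : ℕ) (τ : ℍ) : muVHat j n τ =
    muV j n τ + wConst j * (I / 2) * torsionR (dCoeff j).1 (dCoeff j).2 τ := by
  simp only [muV_eq, muVHat_eq]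
  rw [torsionMuHat_eq, uCoeff_sub_fst, uCoeff_sub_snd]
  ring

lemma nonHolExpansion_dCoeff (j : MuIndex) :
    NonHolExpansion 288 (torsionR (dCoeff j).1 (dCoeff j).2) := by
  refine nonHolExpansion_torsionR (abs_dCoeff_lt j) _ (k := 6 + ((dCoeff j).1 * 12).num) ?_ ?_
  · have := (dCoeff_spec j).2.2.1
    omega
  · push_cast
    rw [← dCoeff_mul_eq]
    ring

lemma harmonicHalf_muVHat {j : MuIndex} {n : ℕ} (h : Admissible (.ofMu j) n) :
    HarmonicHalf (muVHat j n) fun z ↦ wConst j * (0 + I / 2 * ((((√(2 * z.im))⁻¹ : ℝ) : ℂ) *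
      (-I * conjTheta (torsionSign (dCoeff j).2) (1 / 2 + (dCoeff j).1) 1 z))) := by
  have h1 := harmonicHalf_torsionMuHat (notBothInt_uCoeff h) (notBothInt_vCoeff h)
    (by rw [uCoeff_sub_fst]; exact abs_dCoeff_lt j)
  rw [uCoeff_sub_fst, uCoeff_sub_snd] at h1
  rw [muVHat_eq]
  exact h1.const_mul _

lemma expGrowth_slash_muVHat {j : MuIndex} {n : ℕ} (h : Admissible (.ofMu j) n) (γ : SL(2, ℤ)) :
    ExpGrowth fun τ ↦ autFactor γ τ ^ (-((1 / 2 : ℝ) : ℂ)) * muVHat j n (γ • τ) := by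
  have hu := notBothInt_uCoeff h
  have hv := notBothInt_vCoeff h
  refine ((expGrowth_torsionMuHat (hu.smul γ) (hv.smul γ)).const_mul (wConst j *
    (etaMultiplier γ ^ (-3 : ℤ) * e (torsionPhase (dCoeff j).1 (dCoeff j).2 γ)))).mono_norm
    fun τ ↦ congrArg norm ?_
  have hc := autFactor_cpow_half_ne_zero γ τ
  rw [muVHat_eq]
  simp only
  rw [torsionMuHat_smul hu hv, uCoeff_sub_fst, uCoeff_sub_snd, Complex.cpow_neg,
    show ((1 / 2 : ℝ) : ℂ) = 1 / 2 by push_cast; rfl]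
  field_simp

/-! ### Transformation under the groups `A` -/

/-- `(k, l, r, s)` is the shift of the coefficients of `u` and `v` under `γ`. -/
def CoeffShift (j : MuIndex) (n : ℕ) (γ : SL(2, ℤ)) (k l r s : ℤ) : Prop :=
  (((uCoeff j n).1 : ℝ) * γ 0 0 + (uCoeff j n).2 * γ 1 0 = (uCoeff j n).1 + k ∧
    ((uCoeff j n).1 : ℝ) * γ 0 1 + (uCoeff j n).2 * γ 1 1 = (uCoeff j n).2 + l) ∧
  (((vCoeff n).1 : ℝ) * γ 0 0 + (vCoeff n).2 * γ 1 0 = (vCoeff n).1 + r ∧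
    ((vCoeff n).1 : ℝ) * γ 0 1 + (vCoeff n).2 * γ 1 1 = (vCoeff n).2 + s)

lemma exists_coeffShift {j : MuIndex} {n : ℕ} (h : Admissible (.ofMu j) n) {γ : SL(2, ℤ)}
    (hγ : γ ∈ groupA (.ofMu j) n) : ∃ k l r s : ℤ, CoeffShift j n γ k l r s := by
  have hγ' := groupA_le_gammaUpperOne _ _ hγ
  obtain ⟨⟨h1, h2⟩, h3, h4⟩ := groupLevel_spec h
  have key : ((vCoeff n).2 ≠ 0 ∨ (uCoeff j n).2 ≠ 0) → (2 : ℤ) ∣ γ 1 0 := fun h0 ↦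
    even_of_mem_groupA (needsGammaZeroTwo_of_ne_zero h h0) hγ
  obtain ⟨k, l, hkl⟩ := exists_shift hγ' h2 h4 (or_iff_not_imp_left.mpr fun h0 ↦ key (.inr h0))
  obtain ⟨r, s, hrs⟩ := exists_shift hγ' h1 h3 (or_iff_not_imp_left.mpr fun h0 ↦ key (.inl h0))
  exact ⟨k, l, r, s, hkl, hrs⟩

namespace CoeffShift

variable {j : MuIndex} {n : ℕ} {γ : SL(2, ℤ)} {k l r s : ℤ}

lemma isShift (h : CoeffShift j n γ k l r s) : IsShift j n γ k l r s := by
  obtain ⟨⟨h1, h2⟩, h3, h4⟩ := h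
  intro τ
  rw [uParam_eq, uParam_eq, vParam_eq, vParam_eq, lin_smul, lin_smul, h1, h2, h3, h4,
    div_mul_cancel₀ _ (autFactor_ne_zero γ τ), div_mul_cancel₀ _ (autFactor_ne_zero γ τ)]
  push_cast
  exact ⟨by ring, by ring⟩

lemma sub_fst (h : CoeffShift j n γ k l r s) : (k : ℝ) - r =
    (dCoeff j).1 * (γ 0 0 - 1) + (dCoeff j).2 * γ 1 0 := by
  obtain ⟨⟨h1, -⟩, h3, -⟩ := h
  rw [← uCoeff_sub_fst j n, ← uCoeff_sub_snd j n]
  linear_combination h3 - h1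

lemma sub_snd (h : CoeffShift j n γ k l r s) : (l : ℝ) - s =
    (dCoeff j).1 * γ 0 1 + (dCoeff j).2 * (γ 1 1 - 1) := by
  obtain ⟨⟨-, h1⟩, -, h3⟩ := h
  rw [← uCoeff_sub_fst j n, ← uCoeff_sub_snd j n]
  linear_combination h3 - h1

end CoeffShift

/-- The exponent of `ε`. -/
noncomputable def torsionEpsilon (α β : ℝ) (γ : SL(2, ℤ)) : ℝ :=
  torsionPhase α β γ + (α * (γ 0 0 - 1) + β * γ 1 0) * β

/-- For $\beta=0$ the exponents coincide. For $m=1,3,5$ they agree only modulo $1$, using $c$ even,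
the divisibility of $b$ by $4$, $6$, $3$ respectively, and for $m=1$ also $4\mid d-1$. -/
lemma e_torsionEpsilon {j : MuIndex} {n : ℕ} (h : Admissible (.ofMu j) n) {γ : SL(2, ℤ)}
    (hγ : γ ∈ groupA (.ofMu j) n) :
    e (torsionEpsilon (dCoeff j).1 (dCoeff j).2 γ) = epsilonFactor j γ := by
  obtain ⟨-, ⟨d, hd⟩, ⟨b, hb⟩⟩ := mem_gammaUpperOne_iff.mp (groupA_le_gammaUpperOne _ _ hγ)
  have hL : ∀ {p : ℕ}, p ∣ groupLevel (.ofMu j) n → (p : ℤ) ∣ γ 0 1 ∧ (p : ℤ) ∣ γ 1 1 - 1 :=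
    fun hp ↦ ⟨hb ▸ (Int.natCast_dvd_natCast.mpr hp).mul_right b,
      hd ▸ (Int.natCast_dvd_natCast.mpr hp).mul_right d⟩
  cases j with
  | one =>
    obtain ⟨c, hc⟩ := even_of_mem_groupA (m := .ofMu .one) trivial hγ
    have h4 : 4 ∣ groupLevel (.ofMu .one) n := by
      unfold groupLevel; simp only; split_ifs <;> norm_num
    obtain ⟨⟨b, hb⟩, d, hd⟩ := hL h4
    refine e_mul_int_of_exp (c * (b - d)) ?_
    have hc' : (γ 1 0 : ℂ) = 2 * c := by exact_mod_cast hc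
    have hb' : (γ 0 1 : ℂ) = 4 * b := by exact_mod_cast hb
    have hd' : (γ 1 1 : ℂ) = 4 * d + 1 := by
      exact_mod_cast (by push_cast at hd; omega : (γ 1 1 : ℤ) = 4 * d + 1)
    simp only [torsionEpsilon, torsionPhase, dCoeff]
    push_cast
    rw [hc', hb', hd']
    ring
  | three =>
    obtain ⟨c, hc⟩ := even_of_mem_groupA (m := .ofMu .three) trivial hγ
    have h6 : 6 ∣ groupLevel (.ofMu .three) n := by
      unfold groupLevel; simp only; split_ifs <;> norm_num
    obtain ⟨⟨b, hb⟩, -⟩ := hL h6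
    refine e_mul_int_of_exp (c * b) ?_
    have hc' : (γ 1 0 : ℂ) = 2 * c := by exact_mod_cast hc
    have hb' : (γ 0 1 : ℂ) = 6 * b := by exact_mod_cast hb
    simp only [torsionEpsilon, torsionPhase, dCoeff]
    push_cast
    rw [hc', hb']
    ring
  | five =>
    obtain ⟨c, hc⟩ := even_of_mem_groupA (m := .ofMu .five) trivial hγ
    have h3 : 3 ∣ groupLevel (.ofMu .five) n := by
      unfold groupLevel; simp only; split_ifs <;> norm_num
    obtain ⟨⟨b, hb⟩, -⟩ := hL h3
    refine e_mul_int_of_exp (c * b) ?_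
    have hc' : (γ 1 0 : ℂ) = 2 * c := by exact_mod_cast hc
    have hb' : (γ 0 1 : ℂ) = 3 * b := by exact_mod_cast hb
    simp only [torsionEpsilon, torsionPhase, dCoeff]
    push_cast
    rw [hc', hb']
    ring
  | _ =>
    simp only [torsionEpsilon, torsionPhase, dCoeff, epsilonFactor, tConst]
    congr 1
    push_cast
    ring

lemma CoeffShift.muVHat_smul {j : MuIndex} {n : ℕ} (h : Admissible (.ofMu j) n) {γ : SL(2, ℤ)}
    (hγ : γ ∈ groupA (.ofMu j) n) {k l r s : ℤ} (hs : CoeffShift j n γ k l r s) (τ : ℍ) :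
    muVHat j n (γ • τ) =
      multiplierValue j γ k l r s * autFactor γ τ ^ (1 / 2 : ℂ) * muVHat j n τ := by
  have hu := notBothInt_uCoeff h
  have hv := notBothInt_vCoeff h
  have hk := hs.sub_fst
  obtain ⟨⟨h1, h2⟩, h3, h4⟩ := hs
  rw [muVHat_eq]
  simp only
  rw [torsionMuHat_smul hu hv, h1, h2, h3, h4, torsionMuHat_add_int hu hv, uCoeff_sub_fst,
    uCoeff_sub_snd, hk, multiplierValue, ← e_torsionEpsilon h hγ, torsionEpsilon,
    Complex.ofReal_add, e_add]
  ring

lemma norm_multiplierValue {j : MuIndex} {n : ℕ} (h : Admissible (.ofMu j) n) {γ : SL(2, ℤ)}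
    (hγ : γ ∈ groupA (.ofMu j) n) (k l r s : ℤ) : ‖multiplierValue j γ k l r s‖ = 1 := by
  rw [multiplierValue, ← e_torsionEpsilon h hγ, norm_mul, norm_mul, norm_e_ofReal, norm_zpow,
    norm_zpow, norm_etaMultiplier, norm_neg, norm_one, one_zpow, one_zpow, one_mul, one_mul]

/-- The two $\alpha$ differ by $1/3$ and the two $t$ by $1/12$. Since $12\mid a-1$ and $12\mid b$,
the shifts $k,\ell$ differ by multiples of $4$ and the exponents of $\varepsilon$ by an integer, so
the sum $\widehat V_{4n}$ has a multiplier. -/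
lemma multiplierValue_fourDoublePrime {n : ℕ} {γ : SL(2, ℤ)} (hγ : γ ∈ groupA .four n)
    {k l r s k' l' r' s' : ℤ} (h : CoeffShift .fourPrime n γ k l r s)
    (h' : CoeffShift .fourDoublePrime n γ k' l' r' s') :
    multiplierValue .fourDoublePrime γ k' l' r' s' = multiplierValue .fourPrime γ k l r s := by
  obtain ⟨⟨a, ha⟩, -, ⟨b, hb⟩⟩ := mem_gammaUpperOne_iff.mp (groupA_le_gammaUpperOne _ _ hγ)
  have ha' : (γ 0 0 : ℝ) = 12 * a + 1 := by
    exact_mod_cast (by simp only [groupLevel] at ha; push_cast at ha; omega :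
      (γ 0 0 : ℤ) = 12 * a + 1)
  have hb' : (γ 0 1 : ℝ) = 12 * b := by exact_mod_cast hb
  have hbc : (γ 0 1 : ℂ) = 12 * b := by exact_mod_cast hb
  have h1 := h.sub_fst
  have h2 := h.sub_snd
  have h1' := h'.sub_fst
  have h2' := h'.sub_snd
  obtain ⟨-, h3, h4⟩ := h
  obtain ⟨-, h3', h4'⟩ := h'
  have hr : r' = r := by
    exact_mod_cast (by linarith : (r' : ℝ) = r)
  have hs : s' = s := by
    exact_mod_cast (by linarith : (s' : ℝ) = s)
  subst hr hs
  simp only [dCoeff] at h1 h2 h1' h2'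
  push_cast at h1 h2 h1' h2'
  rw [ha'] at h1 h1'
  rw [hb'] at h2 h2'
  have hk : k' = k + 4 * a := by
    exact_mod_cast (by linarith : (k' : ℝ) = k + 4 * a)
  have hl : l' = l + 4 * b := by
    exact_mod_cast (by linarith : (l' : ℝ) = l + 4 * b)
  have hpar : (-1 : ℂ) ^ (k' + l' + r' + s') = (-1 : ℂ) ^ (k + l + r' + s') := by
    rw [hk, hl, show k + 4 * a + (l + 4 * b) + r' + s' = k + l + r' + s' + 2 * (2 * a + 2 * b) by
      ring, zpow_add₀ (by norm_num), zpow_mul]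
    norm_num
  have heps : epsilonFactor .fourDoublePrime γ = epsilonFactor .fourPrime γ := by
    simp only [epsilonFactor, tConst]
    refine e_mul_int_of_exp (γ 0 0 * b) ?_
    rw [hbc]
    push_cast
    ring
  rw [multiplierValue, multiplierValue, hpar, heps]

end EtaTheta

/-! ### Assembly: harmonic Maass forms and shadows. -/

namespace EtaTheta

open Filter Topology Asymptotics

/-! ### The completions as harmonic Maass forms -/

lemma admissible_four {n : ℕ} (h : Admissible .four n) :
    Admissible (.ofMu .fourPrime) n ∧ Admissible (.ofMu .fourDoublePrime) n := ⟨h, h⟩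

/-- The value `c` of the multiplier at `γ`, with the shifts that it comes from. -/
def IsMultiplierAt (m : MockIndex) (n : ℕ) (γ : SL(2, ℤ)) (c : ℂ) : Prop :=
  ‖c‖ = 1 ∧ (∀ τ : ℍ, mockVHat m n (γ • τ) = c * autFactor γ τ ^ (1 / 2 : ℂ) * mockVHat m n τ) ∧
    ∀ j ∈ m.constituents, ∃ k l r s : ℤ, IsShift j n γ k l r s ∧ c = multiplierValue j γ k l r s

lemma exists_isMultiplierAt {m : MockIndex} {n : ℕ} (h : Admissible m n) {γ : SL(2, ℤ)}
    (hγ : γ ∈ groupA m n) : ∃ c, IsMultiplierAt m n γ c := by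
  cases m with
  | ofMu j =>
    obtain ⟨k, l, r, s, hs⟩ := exists_coeffShift h hγ
    refine ⟨_, norm_multiplierValue h hγ k l r s, fun τ ↦ hs.muVHat_smul h hγ τ, ?_⟩
    rintro i rfl
    exact ⟨k, l, r, s, hs.isShift, rfl⟩
  | four =>
    obtain ⟨h1, h2⟩ := admissible_four h
    obtain ⟨k, l, r, s, hs⟩ := exists_coeffShift h1 (γ := γ) hγ
    obtain ⟨k', l', r', s', hs'⟩ := exists_coeffShift h2 (γ := γ) hγ
    have heq := multiplierValue_fourDoublePrime hγ hs hs'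
    refine ⟨_, norm_multiplierValue h1 (γ := γ) hγ k l r s, fun τ ↦ ?_, ?_⟩
    · have e1 := hs.muVHat_smul h1 hγ τ
      have e2 := hs'.muVHat_smul h2 hγ τ
      rw [heq] at e2
      simp only [mockVHat]
      rw [e1, e2]
      ring
    · rintro i (rfl | rfl)
      · exact ⟨k, l, r, s, hs.isShift, rfl⟩
      · exact ⟨k', l', r', s', hs'.isShift, heq.symm⟩

lemma exists_harmonicHalf_mockVHat {m : MockIndex} {n : ℕ} (h : Admissible m n) :
    ∃ b, HarmonicHalf (mockVHat m n) b := by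
  cases m with
  | ofMu j => exact ⟨_, harmonicHalf_muVHat h⟩
  | four =>
    obtain ⟨h1, h2⟩ := admissible_four h
    exact ⟨_, (harmonicHalf_muVHat h1).add (harmonicHalf_muVHat h2)⟩

lemma expGrowth_slash_mockVHat {m : MockIndex} {n : ℕ} (h : Admissible m n) (γ : SL(2, ℤ)) :
    ExpGrowth fun τ ↦ autFactor γ τ ^ (-((1 / 2 : ℝ) : ℂ)) * mockVHat m n (γ • τ) := by
  cases m with
  | ofMu j => exact expGrowth_slash_muVHat h γ
  | four =>
    obtain ⟨h1, h2⟩ := admissible_four h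
    exact ((expGrowth_slash_muVHat h1 γ).add (expGrowth_slash_muVHat h2 γ)).mono_norm
      fun τ ↦ congrArg norm (mul_add _ _ _)

lemma isHolomorphicPart_mockVHat {m : MockIndex} {n : ℕ} (h : Admissible m n) :
    IsHolomorphicPart (1 / 2) (mockVHat m n) (mockV m n) := by
  cases m with
  | ofMu j =>
    exact isHolomorphicPart_of (holUHP_muV h) (expGrowth_muV h) (by norm_num : 0 < 288)
      (muV_periodic h) ((nonHolExpansion_dCoeff j).const_mul _) (muVHat_eq_muV_add j n)
  | four =>
    obtain ⟨h1, h2⟩ := admissible_four h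
    refine isHolomorphicPart_of ((holUHP_muV h1).add (holUHP_muV h2))
      ((expGrowth_muV h1).add (expGrowth_muV h2)) (by norm_num : 0 < 288)
      (fun τ τ' hτ ↦ by simp only [mockV]; rw [muV_periodic h1 τ τ' hτ, muV_periodic h2 τ τ' hτ])
      (((nonHolExpansion_dCoeff .fourPrime).const_mul (wConst .fourPrime * (I / 2))).add
        ((nonHolExpansion_dCoeff .fourDoublePrime).const_mul (wConst .fourDoublePrime * (I / 2))))
      fun τ ↦ ?_
    simp only [mockVHat, mockV]
    rw [muVHat_eq_muV_add, muVHat_eq_muV_add]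
    ring

lemma isHarmonicMaassForm_mockVHat {m : MockIndex} {n : ℕ} (h : Admissible m n) {ν : SL(2, ℤ) → ℂ}
    (hν : ∀ γ ∈ groupA m n, IsMultiplierAt m n γ (ν γ)) :
    IsHarmonicMaassForm (1 / 2) (groupA m n) ν (mockVHat m n) := by
  obtain ⟨b, hb⟩ := exists_harmonicHalf_mockVHat h
  refine ⟨hb.smooth, fun γ hγ ↦ (hν γ hγ).1, fun γ hγ τ ↦ ?_, hb.weightLaplacian_eq_zero,
    expGrowth_slash_mockVHat h⟩
  rw [(hν γ hγ).2.1 τ]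
  push_cast
  rfl

/-! ### The shadows -/

lemma HarmonicHalf.xiOperator_add {F G : ℍ → ℂ} {b b' : ℂ → ℂ} (hF : HarmonicHalf F b)
    (hG : HarmonicHalf G b') (τ : ℍ) : xiOperator (1 / 2) (fun τ ↦ F τ + G τ) τ =
      xiOperator (1 / 2) F τ + xiOperator (1 / 2) G τ := by
  rw [(hF.add hG).xiOperator_eq, hF.xiOperator_eq, hG.xiOperator_eq, map_add, mul_add]

/-- The constant in `ξ V̂ = C · ∑ (n + a) e(n b) q ^ ((n + a)² / 2)`. -/
noncomputable def shadowConst (j : MuIndex) : ℂ :=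
  I * ((√2)⁻¹ : ℝ) * (starRingEnd ℂ) (wConst j) * e (((((dCoeff j).2 : ℝ) / 2 : ℝ) : ℂ))

lemma shadowConst_ne_zero (j : MuIndex) : shadowConst j ≠ 0 := by
  have h2 : (((√2)⁻¹ : ℝ) : ℂ) ≠ 0 := by
    exact_mod_cast inv_ne_zero (Real.sqrt_pos.mpr two_pos).ne'
  exact mul_ne_zero (mul_ne_zero (mul_ne_zero Complex.I_ne_zero h2)
    ((map_ne_zero _).mpr (wConst_ne_zero j))) (e_ne_zero _)

lemma xiOperator_muVHat {j : MuIndex} {n : ℕ} (h : Admissible (.ofMu j) n) (τ : ℍ) :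
    xiOperator (1 / 2) (muVHat j n) τ =
      shadowConst j * thetaSum (1 / 2 + (dCoeff j).1) ((dCoeff j).2 + 1 / 2) τ := by
  rw [(harmonicHalf_muVHat h).xi_torsionMuHat, shadowTheta_eq_thetaSum, shadowConst]
  ring

lemma exists_xiOperator_mockVHat (m : EtaIndex) {n : ℕ} (h : Admissible m.toMock n) :
    ∃ C : ℂ, C ≠ 0 ∧ ∀ τ : ℍ, xiOperator (1 / 2) (mockVHat m.toMock n) τ =
      C * oddEtaTheta m (2 * (τ : ℂ) / (shadowLevel m : ℂ) ^ 2) := by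
  -- The series has characteristic $\beta+1/2$, which matters only modulo $1$; the two alternatives
  -- cover $\beta=0$ with $b=1/2$ and $\beta=1/2$ with $b=0$.
  have key : ∀ {j : MuIndex} {a b : ℝ}, Admissible (.ofMu j) n → 1 / 2 + ((dCoeff j).1 : ℝ) = a →
      ((dCoeff j).2 : ℝ) = b - 1 / 2 ∨ ((dCoeff j).2 : ℝ) = b + 1 / 2 → ∀ τ : ℍ,
      xiOperator (1 / 2) (muVHat j n) τ = shadowConst j * thetaSum a b τ := by
    intro j a b hj ha hb τ
    rw [xiOperator_muVHat hj, ha]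
    rcases hb with hb | hb
    · rw [hb, sub_add_cancel]
    · rw [hb, add_assoc, add_halves, thetaSum_add_one_right]
  have fin : ∀ {j : MuIndex} {a b : ℝ}, Admissible (.ofMu j) n → 1 / 2 + ((dCoeff j).1 : ℝ) = a →
      ((dCoeff j).2 : ℝ) = b - 1 / 2 ∨ ((dCoeff j).2 : ℝ) = b + 1 / 2 → ∀ m : EtaIndex,
      (∃ C : ℂ, C ≠ 0 ∧ ∀ z : ℂ, 0 < z.im →
        thetaSum a b z = C * oddEtaTheta m (2 * z / (shadowLevel m : ℂ) ^ 2)) →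
      ∃ C : ℂ, C ≠ 0 ∧ ∀ τ : ℍ, xiOperator (1 / 2) (muVHat j n) τ =
        C * oddEtaTheta m (2 * (τ : ℂ) / (shadowLevel m : ℂ) ^ 2) := by
    rintro j a b hj ha hb m ⟨C, hC, hθ⟩
    exact ⟨shadowConst j * C, mul_ne_zero (shadowConst_ne_zero j) hC, fun τ ↦ by
      rw [key hj ha hb, hθ τ τ.im_pos, mul_assoc]⟩
  cases m with
  | one => exact fin h (by norm_num [dCoeff]) (by norm_num [dCoeff]) _ thetaSum_oddEtaTheta_one
  | two => exact fin h (by norm_num [dCoeff]) (by norm_num [dCoeff]) _ thetaSum_oddEtaTheta_two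
  | three => exact fin h (by norm_num [dCoeff]) (by norm_num [dCoeff]) _ thetaSum_oddEtaTheta_three
  | five => exact fin h (by norm_num [dCoeff]) (by norm_num [dCoeff]) _ thetaSum_oddEtaTheta_five
  | six => exact fin h (by norm_num [dCoeff]) (by norm_num [dCoeff]) _ thetaSum_oddEtaTheta_six
  | four =>
    obtain ⟨h1, h2⟩ := admissible_four h
    obtain ⟨C, hC, hθ⟩ := thetaSum_oddEtaTheta_four
    refine ⟨shadowConst .fourPrime * C, mul_ne_zero (shadowConst_ne_zero _) hC, fun τ ↦ ?_⟩
    have hadd := (harmonicHalf_muVHat h1).xiOperator_add (harmonicHalf_muVHat h2) τ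
    refine hadd.trans ?_
    rw [key h1 (a := 1 / 12) (b := 1 / 2) (by norm_num [dCoeff]) (by norm_num [dCoeff]),
      key h2 (a := 5 / 12) (b := 1 / 2) (by norm_num [dCoeff]) (by norm_num [dCoeff]), mul_assoc,
      ← hθ τ τ.im_pos, mul_add]
    -- Both constituents have $w=i$ and $\beta=0$, so their shadow constants coincide and the theta
    -- series add with equal weight.
    rfl

end EtaTheta

theorem theorem1p1 :
    (∀ (m : MockIndex) (n : ℕ), Admissible m n →
      CongruenceSubgroup.IsCongruenceSubgroup (groupA m n) ∧
      ∃ ν : SL(2, ℤ) → ℂ,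
        IsMockModularForm (1 / 2) (groupA m n) ν (mockV m n) ∧
        IsHarmonicMaassForm (1 / 2) (groupA m n) ν (mockVHat m n) ∧
        IsHolomorphicPart (1 / 2) (mockVHat m n) (mockV m n) ∧
        ∀ j ∈ m.constituents, ∀ γ ∈ groupA m n, ∃ k l r s : ℤ,
          IsShift j n γ k l r s ∧
          ν γ = multiplierValue j γ k l r s ∧
          ∀ τ : ℍ, mockVHat m n (γ • τ) =
            etaMultiplier γ ^ (-3 : ℤ) * (-1 : ℂ) ^ (k + l + r + s) * epsilonFactor j γ *
              autFactor γ τ ^ (1 / 2 : ℂ) * mockVHat m n τ) ∧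
    (∀ (m : EtaIndex) (n : ℕ), Admissible m.toMock n →
      ∃ C : ℂ, C ≠ 0 ∧ ∀ τ : ℍ,
        xiOperator (1 / 2) (mockVHat m.toMock n) τ =
          C * oddEtaTheta m (2 * (τ : ℂ) / (shadowLevel m : ℂ) ^ 2)) := by
  refine ⟨fun m n h ↦ ⟨isCongruenceSubgroup_groupA m n, ?_⟩,
    fun m n h ↦ exists_xiOperator_mockVHat m h⟩
  have hex : ∀ γ, ∃ c, γ ∈ groupA m n → IsMultiplierAt m n γ c := by
    intro γ
    by_cases hγ : γ ∈ groupA m n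
    · obtain ⟨c, hc⟩ := exists_isMultiplierAt h hγ
      exact ⟨c, fun _ ↦ hc⟩
    -- Outside the group the multiplier is unconstrained; $0$ is a filler.
    · exact ⟨0, fun h ↦ absurd h hγ⟩
  choose ν hν using hex
  have hF := isHarmonicMaassForm_mockVHat h hν
  have hf := isHolomorphicPart_mockVHat h
  refine ⟨ν, ⟨_, hF, hf⟩, hF, hf, fun j hj γ hγ ↦ ?_⟩
  obtain ⟨-, htrans, hshift⟩ := hν γ hγ
  obtain ⟨k, l, r, s, hs, hc⟩ := hshift j hj
  refine ⟨k, l, r, s, hs, hc, fun τ ↦ ?_⟩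
  rw [htrans, hc, multiplierValue]
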